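/- Let $V=\mathbb C^3$ carry a hermitian form of signature $++-$. Let $\mathbf H^2_{\mathbb C}$ be the set of negative points of $\mathbb P V$, and let $\partial\mathbf H^2_{\mathbb C}$ be the set of isotropic points. An element of $\mathrm{SU}(2,1)$ is loxodromic if it fixes exactly two points of $\mathbf H^2_{\mathbb C}\cup\partial\mathbf H^2_{\mathbb C}$, both in $\partial\mathbf H^2_{\mathbb C}$. It is hyperbolic if it is loxodromic and, up to a scalar factor, all its eigenvalues are positive reals (trivial elliptic part). It is loxodromic with elliptic part of order $2$ if it is a product $he$ of a hyperbolic $h$ and an elliptic $e$ that commute, where $e$ acts on $\mathbf H^2_{\mathbb C}$ with order $2$. A subgroup is $\mathbb C$-Fuchsian (respectively $\mathbb R$-Fuchsian) if it leaves invariant a complex geodesic (respectively a totally real plane) of $\mathbf H^2_{\mathbb C}$. It is non-elementary if it has no finite orbit in $\mathbf H^2_{\mathbb C}\cup\partial\mathbf H^2_{\mathbb C}$, and Kleinian if it is discrete. For a point $q$ of a complex geodesic with polar vector $e$ (a positive vector), put $$Q(q)x=x-2\frac{\langle x,q\rangle}{\langle q,q\rangle}q-2\frac{\langle x,e\rangle}{\langle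 e,e\rangle}e ;$$ this is $-1$ on $e$ and $x\mapsto x-2\frac{\langle x,q\rangle}{\langle q,q\rangle}q$ on $e^\perp$. Let $H_8$ be the group with generators $r_1,\dots,r_8$ and relations $r_i^2=1$, $r_8r_7\cdots r_1=1$, and let $G_8\le H_8$ be the subgroup of words of even length. **Statement.** In a complex geodesic (a hyperbolic plane, curvature $-1$) with polar vector $e$ there are points $c,p_5,\dots,p_9,q_1,\dots,q_{14}$ such that: * the pentagon $p_5p_6p_7p_8p_9$ is the union of ten congruent triangles with common vertex $c$, whose other vertices are an endpoint $p_i$ and the midpoint $q_j$ of a side, with interior angles $\frac\pi5,\frac\pi5,\frac\pi2$ at $c,p_i,q_j$, the points $q_6,\dots,q_{10}$ being the midpoints of the sides $p_5p_6,p_6p_7,p_7p_8,p_8p_9,p_9p_5$; * the pentagons $(q_5,q_{10},q_9,q_{12},q_{11})$, $(q_4,q_{11},q_{12},q_{13},q_{14})$, $(q_1,q_2,q_3,q_{14},q_{13})$ are congruent to $(q_6,q_7,q_8,q_9,q_{10})$, and consecutive pentagons in the list $(q_6,q_7,q_8,q_9,q_{10})$, $(q_5,q_{10},q_9,q_{12},q_{11})$,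 $(q_4,q_{11},q_{12},q_{13},q_{14})$, $(q_1,q_2,q_3,q_{14},q_{13})$ lie on opposite sides of their common sides $q_9q_{10}$, $q_{11}q_{12}$, $q_{13}q_{14}$; and the following holds. 1. The rule $r_i\mapsto Q(q_i)$ $(1\le i\le 8)$ defines a $\mathbb C$-Fuchsian, faithful and discrete representation of $H_8$ in $\mathrm{SU}(2,1)$. 2. $G_8$ is isomorphic to the fundamental group of a closed orientable surface of genus $3$, and the restriction to $G_8$ is a $\mathbb C$-Fuchsian, faithful and discrete representation of this fundamental group in $\mathrm{SU}(2,1)$. Let $\Gamma$ be its image. 3. For every $g\in\Gamma$ there is a basis $e_0,e_1,e_2$ of $V$, with $e_0=e$ and $e_1,e_2$ isotropic vectors in $e^\perp$, in which $g$ has the matrix $\mathrm{diag}(1,\varepsilon s^{-1},\varepsilon s)$ for some $s>0$ and $\varepsilon\in\{1,-1\}$. 4. Every loxodromic element of $\Gamma$ is hyperbolic or has elliptic part of order $2$. 5. $\Gamma$ is non-elementary and not $\mathbb R$-Fuchsian. Hence the following announced assertion is false: "a non-elementary Kleinian group $G\le\mathrm{SU}(2,1)$ is $\mathbb R$-Fuchsian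 if and only if every loxodromic element of $G$ is either hyperbolic or loxodromic with elliptic part of order $2$". -/

import Mathlib

open scoped LinearAlgebra.Projectivization ComplexConjugate

noncomputable section

namespace ComplexHyperbolic

/-! ### The complex hyperbolic plane and its isometries -/

/-- The space `V = ℂ³`. -/
abbrev V : Type := Fin 3 → ℂ

/-- The hermitian form of signature `++-` on `V`, linear in the first variable. -/
def herm (x y : V) : ℂ := x 0 * conj (y 0) + x 1 * conj (y 1) - x 2 * conj (y 2)

/-- The group `SU(2,1)` of all complex matrices of determinant one preserving `herm`. -/
def SU21 : Subgroup (Matrix.SpecialLinearGroup (Fin 3) ℂ) where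
  carrier := {g | ∀ x y : V, herm (g.1.mulVec x) (g.1.mulVec y) = herm x y}
  one_mem' := by intro x y; simp
  mul_mem' := by
    intro a b ha hb x y
    have h := (ha (b.1.mulVec x) (b.1.mulVec y)).trans (hb x y)
    simpa [Matrix.mulVec_mulVec] using h
  inv_mem' := by
    intro a ha x y
    have hx : ∀ z : V, a.1.mulVec ((a⁻¹).1.mulVec z) = z := by
      intro z
      have h : a.1 * (a⁻¹).1 = 1 := congrArg Subtype.val (mul_inv_cancel a)
      rw [Matrix.mulVec_mulVec, h, Matrix.one_mulVec]
    have h := ha ((a⁻¹).1.mulVec x) ((a⁻¹).1.mulVec y)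
    rw [hx, hx] at h
    exact h.symm

/-- A vector is negative if `⟨v, v⟩ < 0`. -/
def IsNegative (v : V) : Prop := (herm v v).re < 0

/-- The complex hyperbolic plane: the set of negative points of the projective plane. -/
def H2C : Set (ℙ ℂ V) := {x | ∃ v ∈ x.submodule, IsNegative v}

/-- The ideal boundary of the complex hyperbolic plane: the set of isotropic points. -/
def boundaryH2C : Set (ℙ ℂ V) := {x | ∃ v ∈ x.submodule, v ≠ 0 ∧ herm v v = 0}

/-- `g` is loxodromic: in the closed ball it fixes exactly two points, both on the boundary. -/
def IsLoxodromic (g : SU21) : Prop :=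
  (∀ x ∈ H2C, g • x ≠ x) ∧ {x ∈ boundaryH2C | g • x = x}.ncard = 2

/-- `g` is elliptic: it fixes a point of the complex hyperbolic plane. -/
def IsElliptic (g : SU21) : Prop := ∃ x ∈ H2C, g • x = x

/-- `g` is hyperbolic: it is loxodromic with trivial elliptic part, i.e. after multiplication
by a scalar all its eigenvalues are real and positive. -/
def IsHyperbolic (g : SU21) : Prop :=
  IsLoxodromic g ∧ ∃ c : ℂ, ∀ μ : ℂ,
    Module.End.HasEigenvalue (Matrix.toLin' g.1.1) μ → ∃ t : ℝ, 0 < t ∧ μ = c * t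

/-- `g` is loxodromic with elliptic part of order two: `g = h * e`, where `h` is hyperbolic,
`e` is elliptic, `h` and `e` commute, and `e` acts on the complex hyperbolic plane as an
isometry of order two. -/
def HasEllipticPartOfOrderTwo (g : SU21) : Prop :=
  ∃ h e : SU21, IsHyperbolic h ∧ IsElliptic e ∧ Commute h e ∧ g = h * e ∧
    (∀ x ∈ H2C, e • e • x = x) ∧ ∃ x ∈ H2C, e • x ≠ x

/-- `G` leaves invariant a set of points of the projective plane. -/
def LeavesInvariant (G : Subgroup SU21) (S : Set (ℙ ℂ V)) : Prop :=
  ∀ g ∈ G, (fun x => g • x) '' S = S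

/-- `G` is `ℂ`-Fuchsian: it leaves invariant a complex geodesic, i.e. the set of all points of
the complex hyperbolic plane in a complex projective line meeting it. -/
def IsCFuchsian (G : Subgroup SU21) : Prop :=
  ∃ W : Submodule ℂ V, Module.finrank ℂ W = 2 ∧ (∃ w ∈ W, IsNegative w) ∧
    LeavesInvariant G {x ∈ H2C | x.submodule ≤ W}

/-- `G` is `ℝ`-Fuchsian: it leaves invariant a totally real plane, i.e. the (nonempty) set of all
points of the complex hyperbolic plane represented by the vectors of a three-dimensional real
subspace on which the hermitian form is real. -/
def IsRFuchsian (G : Subgroup SU21) : Prop :=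
  ∃ U : Submodule ℝ V, Module.finrank ℝ U = 3 ∧ (∀ u ∈ U, ∀ v ∈ U, (herm u v).im = 0) ∧
    (∃ u ∈ U, IsNegative u) ∧
    LeavesInvariant G {x ∈ H2C | ∃ u ∈ U, u ≠ 0 ∧ u ∈ x.submodule}

/-- `G` is non-elementary: it has no finite orbit in the closed ball. -/
def IsNonElementary (G : Subgroup SU21) : Prop :=
  ∀ S : Set (ℙ ℂ V), S ⊆ H2C ∪ boundaryH2C → S.Finite → S.Nonempty → ¬ LeavesInvariant G S

/-- The group `G` is discrete. -/
def IsDiscrete (G : Subgroup SU21) : Prop := DiscreteTopology G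

/-- Every loxodromic element of `G` is hyperbolic or has elliptic part of order two. -/
def LoxodromicCondition (G : Subgroup SU21) : Prop :=
  ∀ g ∈ G, IsLoxodromic g → IsHyperbolic g ∨ HasEllipticPartOfOrderTwo g

/-- The announced characterization: a non-elementary Kleinian (i.e. discrete) group is
`ℝ`-Fuchsian if and only if each of its loxodromic elements is hyperbolic or has elliptic part
of order two. -/
def AnnouncedCharacterization : Prop :=
  ∀ G : Subgroup SU21, IsDiscrete G → IsNonElementary G →
    (IsRFuchsian G ↔ LoxodromicCondition G)

/-! ### Plane hyperbolic geometry in a complex geodesic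

Points are given by negative representatives in a two-dimensional subspace of `V`; the notions
below do not depend on the choice of the representatives. -/

/-- The distance between the points represented by `a` and `b`, normalized so that a complex
geodesic has curvature `-1`:  `cosh² (d / 2) = ⟨a, b⟩⟨b, a⟩ / (⟨a, a⟩⟨b, b⟩)`. -/
def hdist (a b : V) : ℝ :=
  2 * Real.arcosh (√((herm a b * herm b a).re / ((herm a a).re * (herm b b).re)))

/-- A tangent vector at `a`, realized in the orthogonal complement of `a`, of the geodesic ray
from `a` to `b`. -/
def direction (a b : V) : V := -herm a b • (b - (herm b a / herm a a) • a)

/-- The interior angle at `a` of the geodesic triangle with vertices `a`, `b`, `d`. -/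
def angle (a b d : V) : ℝ :=
  Real.arccos ((herm (direction a b) (direction a d)).re /
    (√(herm (direction a b) (direction a b)).re * √(herm (direction a d) (direction a d)).re))

/-- The geodesic triangle `a`, `b`, `d` has interior angles `π/5`, `π/5`, `π/2` at `a`, `b`, `d`. -/
def IsPentagonTriangle (a b d : V) : Prop :=
  angle a b d = Real.pi / 5 ∧ angle b a d = Real.pi / 5 ∧ angle d a b = Real.pi / 2

/-- The orientation of the triangle `a`, `b`, `x` in a complex geodesic: its sign tells on which
side of the geodesic through `a` and `b` the point `x` lies (zero on the geodesic). -/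
def side (a b x : V) : ℝ := (herm a x * herm x b * herm b a).im

/-- `x` and `y` lie (strictly) on opposite sides of the geodesic through `a` and `b`. -/
def OppositeSides (a b x y : V) : Prop := side a b x * side a b y < 0

/-- The pentagons with vertices `P i` and `P' i` are congruent. -/
def CongruentPentagons (P P' : Fin 5 → V) : Prop :=
  ∀ i j, hdist (P i) (P j) = hdist (P' i) (P' j)

/-- The involution `Q(q) ∈ SU(2,1)` attached to a point `q` of the complex geodesic with polar
vector `e`: it is `-1` on `e`, and on the orthogonal complement of `e` it is `-i R(q)`, that is
`x ↦ x - 2 (⟨x, q⟩ / ⟨q, q⟩) q`, where `R(q) x = i (x - 2 (⟨x, q⟩ / ⟨q, q⟩) q)`. -/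
def Q (e q : V) (x : V) : V :=
  x - (2 * (herm x q / herm q q)) • q - (2 * (herm x e / herm e e)) • e

/-- The configuration of pentagons. Only `p 5, …, p 9` and `q 1, …, q 14` matter. -/
structure PentagonConfiguration where
  /-- the polar vector of the complex geodesic that contains the configuration -/
  e : V
  /-- the centre of the first pentagon -/
  c : V
  /-- the vertices `p 5, …, p 9` of the first pentagon -/
  p : ℕ → V
  /-- the points `q 1, …, q 14` -/
  q : ℕ → V
  e_pos : 0 < (herm e e).re
  c_mem : herm c e = 0 ∧ IsNegative c
  p_mem : ∀ i ∈ Finset.Icc 5 9, herm (p i) e = 0 ∧ IsNegative (p i)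
  q_mem : ∀ i ∈ Finset.Icc 1 14, herm (q i) e = 0 ∧ IsNegative (q i)
  /- The pentagon `p 5, …, p 9` is formed by ten congruent triangles with common vertex `c`;
  the points `q 6, …, q 10` are the midpoints of its sides `p 5 p 6, …, p 8 p 9, p 9 p 5`. -/
  triangle : ∀ k < 5, IsPentagonTriangle c (p (5 + k)) (q (6 + k))
  triangle' : ∀ k < 5, IsPentagonTriangle c (p (5 + (k + 1) % 5)) (q (6 + k))
  /- Neighbouring triangles lie on opposite sides of their common side. -/
  opposite : ∀ k < 5, OppositeSides c (q (6 + k)) (p (5 + k)) (p (5 + (k + 1) % 5))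
  opposite' : ∀ k < 5,
    OppositeSides c (p (5 + (k + 1) % 5)) (q (6 + k)) (q (6 + (k + 1) % 5))
  /- Three more copies of the pentagon with vertices `q 6, …, q 10`. Consecutive copies have a
  common side and lie on opposite sides of it. -/
  copy₂ : CongruentPentagons ![q 6, q 7, q 8, q 9, q 10] ![q 5, q 10, q 9, q 12, q 11]
  copy₃ : CongruentPentagons ![q 6, q 7, q 8, q 9, q 10] ![q 4, q 11, q 12, q 13, q 14]
  copy₄ : CongruentPentagons ![q 6, q 7, q 8, q 9, q 10] ![q 1, q 2, q 3, q 14, q 13]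
  opposite₁₂ : OppositeSides (q 9) (q 10) (q 7) (q 5)
  opposite₂₃ : OppositeSides (q 11) (q 12) (q 5) (q 4)
  opposite₃₄ : OppositeSides (q 13) (q 14) (q 4) (q 2)

/-! ### Surfaces and the groups `H n`, `G n` -/

/-- `X` is a closed orientable surface of genus `g`: a compact connected Hausdorff
two-dimensional topological manifold with first homology group (the abelianized fundamental group)
isomorphic to `ℤ^(2g)`. A closed nonorientable surface has two-torsion in its first homology. -/
structure IsClosedSurfaceOfGenus (g : ℕ) (X : Type) [TopologicalSpace X] : Prop where
  t2 : T2Space X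
  compact : CompactSpace X
  connected : ConnectedSpace X
  manifold : Nonempty (ChartedSpace (EuclideanSpace ℝ (Fin 2)) X)
  homology : ∀ x : X,
    Nonempty (Abelianization (FundamentalGroup X x) ≃* Multiplicative (Fin (2 * g) → ℤ))

/-- The defining relations of `H n`: every generator is an involution, and the product
`r_n ⋯ r_2 r_1` of all generators is trivial. -/
def relations (n : ℕ) : Set (FreeGroup (Fin n)) :=
  Set.range (fun i => FreeGroup.of i * FreeGroup.of i) ∪
    {(List.ofFn fun i : Fin n => FreeGroup.of i).reverse.prod}

/-- The group `H n` generated by `r_1, …, r_n` with relations `r_i² = 1`, `r_n ⋯ r_1 = 1`. -/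
abbrev H (n : ℕ) : Type := PresentedGroup (relations n)

/-- The generator `r_(i+1)` of `H n`. -/
def r {n : ℕ} (i : Fin n) : H n := PresentedGroup.of i

/-- The subgroup `G n` of `H n` formed by the words of even length in the generators. -/
def G (n : ℕ) : Subgroup (H n) := Subgroup.closure (Set.range fun ij : Fin n × Fin n => r ij.1 * r ij.2)

end ComplexHyperbolic

end

/-!
The four pentagons of the configuration are regular and right-angled, so the reflections in the sides of
the first one generate a discrete group. All the points `q 1, …, q 14` are images of vertices of this
pentagon, and the half-turn at a vertex is the product of the reflections in the two sides through it.
Hence the eight half-turns `q 1, …, q 8` generate a subgroup of the right-angled Coxeter group `W` of the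
pentagon, and the theorem is deduced from the geometry of the action of `W` on the upper half-plane.

The reflections act on the upper half-plane by explicit real matrices `A k`. The values `wall k z` of the
five functionals that vanish on the sides satisfy an exchange property (`exchange`), which gives the word
problem for `W` (`wd_eq_one`), the stabilizers of points, and proper discontinuity. Distances to the centre
decrease under reflection, so the compact pentagon is a fundamental domain (`exists_smul_mem_chamber`,
`isCompact_chamber`).

The homomorphism `ψ : H 8 →* W` given by the half-turns is injective (`ψ_injective`) because there is an
inverse on the level of induced representations: explicit coset representatives and an explicit
cocycle define an action of `W` on `Fin 8 × H 8` that restricts to left multiplication by `H 8`. The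
same cocycle shows that the even subgroup `G 8` meets no stabilizer (`eq_one_of_ψ_smul_eq`). So `G 8`
is the fundamental group of the compact quotient surface (`fundamentalGroupSurface`), whose first
homology is computed from the relations (`abelianizationG`), and compactness excludes parabolic elements
(`two_lt_abs_trace`).

In `ℂ³` the orthogonal complement of `e` has coordinates (`emb`) in which the hermitian form is the
complexification of the area form of `ℝ²`. In these coordinates the involution `Q e (q i)` is `-1` on `e`
and `± i` times a product of matrices `A k` (`isHalfTurn_centrePoint`). The relation of `H 8` holds for
these products without a sign (`prodA_all`), which gives the representation `σ`. On `G 8` the scalars can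
be normalized to `1`, so that every nontrivial element of `Γ` is `diag(1, M)` with `M` a real matrix
of determinant one and `|tr M| > 2`. This gives the diagonal form and the loxodromic condition, where
the elliptic part is trivial or `diag(1, -1, -1)` according to the sign of the trace. Two translations along
adjacent sides have no common fixed point, so `Γ` is non-elementary. If `Γ` preserved a totally real
plane, the triple products of limit points of an orbit would be real, whereas those of the fixed points
at infinity of `Γ` are purely imaginary (`triple_cplx`).
-/

namespace PentagonGroup

open Matrix UpperHalfPlane MatrixGroups
noncomputable section

/-! ### The regular right-angled pentagon -/

/-- The cosine of `π / 5`, half the golden ratio. -/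
def c : ℝ := Real.cos (Real.pi / 5)

/-- The sine of `π / 5`. -/
def s : ℝ := Real.sin (Real.pi / 5)

/-- The square root of `cos (2π / 5)`; it is the radius, in the unit disc, of the regular pentagon
with angles `2π / 5`. -/
def κ : ℝ := √(Real.cos (2 * Real.pi / 5))

lemma s_pos : 0 < s := Real.sin_pos_of_pos_of_lt_pi (by positivity) (by linarith [Real.pi_pos])

lemma cos_two_pi_div_five : Real.cos (2 * Real.pi / 5) = c ^ 2 - s ^ 2 := by
  rw [show 2 * Real.pi / 5 = 2 * (Real.pi / 5) by ring, Real.cos_two_mul', c, s]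

lemma c_eq : c = (1 + √5) / 4 := Real.cos_pi_div_five

lemma c_sq : 4 * c ^ 2 = 2 * c + 1 := by
  have h := Real.sq_sqrt (show (0 : ℝ) ≤ 5 by norm_num)
  rw [c_eq]; linear_combination h / 4

lemma c_gt : 4 / 5 < c := by
  have : (11 / 5 : ℝ) < √5 := Real.lt_sqrt_of_sq_lt (by norm_num)
  rw [c_eq]; linarith

lemma c_pos : 0 < c := by linarith [c_gt]

lemma c_sq_add_s_sq : c ^ 2 + s ^ 2 = 1 := Real.cos_sq_add_sin_sq _

lemma κ_sq : κ ^ 2 = c ^ 2 - s ^ 2 := by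
  rw [κ, Real.sq_sqrt, cos_two_pi_div_five]
  exact Real.cos_nonneg_of_neg_pi_div_two_le_of_le (by linarith [Real.pi_pos])
    (by linarith [Real.pi_pos])

lemma κ_pos : 0 < κ := Real.sqrt_pos.2
  (Real.cos_pos_of_mem_Ioo ⟨by linarith [Real.pi_pos], by linarith [Real.pi_pos]⟩)

lemma s_lt_c : s < c := by nlinarith [κ_sq, κ_pos, s_pos, c_pos, sq_nonneg κ, mul_pos κ_pos κ_pos]

lemma cos_four_pi_div_five : Real.cos (4 * Real.pi / 5) = -c := by
  rw [show 4 * Real.pi / 5 = Real.pi - Real.pi / 5 by ring, Real.cos_pi_sub, c]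

/-- Cyclic neighbours among the five sides of a pentagon. -/
def Adj (i j : Fin 5) : Prop := i = j + 1 ∨ j = i + 1

instance : DecidableRel Adj := fun i j => inferInstanceAs (Decidable (i = j + 1 ∨ j = i + 1))

/-- The direction, seen from the centre, of the normal to the `k`-th side. -/
def sideAngle (k : Fin 5) : ℝ := (2 * (k : ℕ) + 1) * Real.pi / 5

/-- The Gram matrix of the unit normals to the sides of the regular right-angled pentagon. -/
def gram (i j : Fin 5) : ℝ := if i = j then 1 else if Adj i j then 0 else -2 * c

lemma cos_sideAngle_sub (i j : Fin 5) :
    Real.cos (sideAngle i - sideAngle j) =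
      if i = j then 1 else if Adj i j then κ ^ 2 else -c := by
  have h1 := cos_two_pi_div_five.trans κ_sq.symm
  have h2 := cos_four_pi_div_five
  have h3 : Real.cos (6 * Real.pi / 5) = -c := by
    rw [← h2, ← Real.cos_two_pi_sub]; congr 1; ring
  have h4 : Real.cos (8 * Real.pi / 5) = κ ^ 2 := by
    rw [← h1, ← Real.cos_two_pi_sub]; congr 1; ring
  have e : sideAngle i - sideAngle j = (2 * (i : ℕ) - 2 * (j : ℕ)) * Real.pi / 5 := by
    simp only [sideAngle]; ring
  rw [e]
  fin_cases i <;> fin_cases j <;> norm_num [Adj] <;>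
    first
    | exact h1 | exact h2 | exact h3 | exact h4
    | (rw [← Real.cos_neg, ← neg_div, neg_neg]; first | exact h1 | exact h2 | exact h3 | exact h4)

/-- The matrix, with square one and determinant `-1`, that acts on the upper half-plane as the
reflection in the `k`-th side of the regular right-angled pentagon centred at `i`. -/
def A (k : Fin 5) : Matrix (Fin 2) (Fin 2) ℝ :=
  (√2 * s)⁻¹ • !![Real.sin (sideAngle k), Real.cos (sideAngle k) + κ;
    Real.cos (sideAngle k) - κ, -Real.sin (sideAngle k)]

lemma sqrt_two_mul_s_inv_sq : (√2 * s)⁻¹ ^ 2 = 1 / (2 * s ^ 2) := by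
  rw [inv_pow, mul_pow, Real.sq_sqrt (by norm_num), one_div]

lemma gram_eq (i j : Fin 5) :
    gram i j = (Real.cos (sideAngle i - sideAngle j) - κ ^ 2) / (2 * s ^ 2) := by
  have hs := s_pos.ne'
  have h1 := c_sq_add_s_sq
  have h2 := c_sq
  rw [cos_sideAngle_sub, eq_div_iff (by positivity), gram, κ_sq]
  split_ifs
  · linear_combination h1
  · ring
  · rw [show s ^ 2 = 1 - c ^ 2 by linarith]
    linear_combination (c + 1) * h2

lemma A_traceless (k : Fin 5) : A k 1 1 = -A k 0 0 := by simp [A]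

/-- The polarization of `-det` on traceless matrices. -/
lemma A_form (i j : Fin 5) :
    2 * (A i 0 0 * A j 0 0) + A i 0 1 * A j 1 0 + A i 1 0 * A j 0 1 = 2 * gram i j := by
  have h := gram_eq i j
  rw [Real.cos_sub, div_eq_mul_one_div, ← sqrt_two_mul_s_inv_sq] at h
  simp only [A, Matrix.smul_apply, of_apply, cons_val', cons_val_zero, cons_val_one,
    cons_val_fin_one, smul_eq_mul]
  rw [h]; ring

lemma A_mul_add (i j : Fin 5) : A i * A j + A j * A i = (2 * gram i j) • 1 := by
  have h := A_form i j
  have hi := A_traceless i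
  have hj := A_traceless j
  ext a b
  fin_cases a <;> fin_cases b <;> simp [mul_apply, Fin.sum_univ_two, hi, hj] <;> linarith

lemma A_mul_self (k : Fin 5) : A k * A k = 1 := by
  have h := A_mul_add k k
  simp only [gram, if_true, mul_one] at h
  ext a b
  have := congr_fun (congr_fun h a) b
  simp only [Matrix.add_apply, Matrix.smul_apply, smul_eq_mul] at this
  linarith

lemma A_anticomm {i j : Fin 5} (h : Adj i j) : A i * A j = -(A j * A i) := by
  have hij : i ≠ j := by rintro rfl; revert h; fin_cases i <;> decide
  have := A_mul_add i j
  rw [gram, if_neg hij, if_pos h, mul_zero, zero_smul] at this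
  exact eq_neg_of_add_eq_zero_left this

lemma A_det (k : Fin 5) : (A k).det = -1 := by
  have := A_form k k
  simp only [gram, if_true] at this
  rw [det_fin_two, A_traceless]; linarith

/-- The reflection in the `k`-th side as an element of `GL(2, ℝ)`. -/
def R (k : Fin 5) : GL (Fin 2) ℝ := GeneralLinearGroup.mkOfDetNeZero (A k) (by simp [A_det])

@[simp] lemma R_val (k : Fin 5) : (R k).val = A k := rfl

/-! ### The right-angled Coxeter group of the pentagon -/

/-- The Coxeter relations of the right-angled pentagon. -/
def coxeterRelations : Set (FreeGroup (Fin 5)) :=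
  Set.range (fun i => FreeGroup.of i * FreeGroup.of i) ∪
    {w | ∃ i j, Adj i j ∧
      w = FreeGroup.of i * FreeGroup.of j * (FreeGroup.of j * FreeGroup.of i)⁻¹}

/-- The right-angled Coxeter group of the pentagon. -/
abbrev W : Type := PresentedGroup coxeterRelations

/-- The reflection in the `i`-th side of the pentagon. -/
def t (i : Fin 5) : W := PresentedGroup.of i

lemma lift_coxeterRelations {G : Type*} [Group G] {f : Fin 5 → G} (h1 : ∀ i, f i * f i = 1)
    (h2 : ∀ i j, Adj i j → f i * f j = f j * f i) :
    ∀ w ∈ coxeterRelations, FreeGroup.lift f w = 1 := by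
  rintro w (⟨i, rfl⟩ | ⟨i, j, hij, rfl⟩)
  · simp [h1]
  · simp [h2 i j hij]

/-- The homomorphism from the Coxeter group given by involutions satisfying its relations. -/
def lift {G : Type*} [Group G] (f : Fin 5 → G) (h1 : ∀ i, f i * f i = 1)
    (h2 : ∀ i j, Adj i j → f i * f j = f j * f i) : W →* G :=
  PresentedGroup.toGroup (lift_coxeterRelations h1 h2)

@[simp] lemma lift_t {G : Type*} [Group G] (f : Fin 5 → G) (h1 : ∀ i, f i * f i = 1)
    (h2 : ∀ i j, Adj i j → f i * f j = f j * f i) (i : Fin 5) : lift f h1 h2 (t i) = f i :=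
  PresentedGroup.toGroup.of _

@[simp] lemma t_mul_self (i : Fin 5) : t i * t i = 1 :=
  PresentedGroup.one_of_mem (rels := coxeterRelations) (Or.inl ⟨i, rfl⟩)

@[simp] lemma t_inv (i : Fin 5) : (t i)⁻¹ = t i := inv_eq_of_mul_eq_one_left (t_mul_self i)

lemma t_comm {i j : Fin 5} (h : Adj i j) : t i * t j = t j * t i :=
  mul_inv_eq_one.1 (PresentedGroup.one_of_mem (rels := coxeterRelations) (Or.inr ⟨i, j, h, rfl⟩))

/-- The element of the Coxeter group spelled by a word. -/
def wd (L : List (Fin 5)) : W := (L.map t).prod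

@[simp] lemma wd_nil : wd [] = 1 := rfl

@[simp] lemma wd_cons (i : Fin 5) (L : List (Fin 5)) : wd (i :: L) = t i * wd L := by simp [wd]

@[simp] lemma wd_append (L L' : List (Fin 5)) : wd (L ++ L') = wd L * wd L' := by simp [wd]

lemma wd_reverse (L : List (Fin 5)) : wd L.reverse = (wd L)⁻¹ := by
  induction L with
  | nil => simp
  | cons i L ih => simp [ih]

lemma exists_wd (w : W) : ∃ L, w = wd L := by
  induction w using PresentedGroup.induction_on with
  | _ z =>
    induction z using FreeGroup.induction_on with
    | C1 => exact ⟨[], by simp⟩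
    | of i => exact ⟨[i], by simp [t, PresentedGroup.of]⟩
    | inv_of i _ => exact ⟨[i], by rw [map_inv]; exact (t_inv i).trans (by simp)⟩
    | mul x y hx hy =>
      obtain ⟨L, hL⟩ := hx
      obtain ⟨M, hM⟩ := hy
      exact ⟨L ++ M, by rw [map_mul, hL, hM, wd_append]⟩

lemma mk_R_mul_self (i : Fin 5) : ProjGenLinGroup.mk (R i) * ProjGenLinGroup.mk (R i) = 1 := by
  rw [← map_mul, show R i * R i = 1 from Units.ext (A_mul_self i), map_one]

lemma mk_R_comm (i j : Fin 5) (h : Adj i j) :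
    ProjGenLinGroup.mk (R i) * ProjGenLinGroup.mk (R j) =
      ProjGenLinGroup.mk (R j) * ProjGenLinGroup.mk (R i) := by
  rw [← map_mul, ← map_mul, show R i * R j = R j * R i * GeneralLinearGroup.scalar (Fin 2) (-1) from
    Units.ext (by ext a b; simp [A_anticomm h, mul_diagonal])]
  simp

/-- The Coxeter group as a group of fractional linear transformations. -/
def toPGL : W →* PGL(2, ℝ) :=
  lift (fun i => ProjGenLinGroup.mk (R i)) mk_R_mul_self mk_R_comm

instance : MulAction W ℍ := MulAction.compHom ℍ toPGL

lemma t_smul (i : Fin 5) (z : ℍ) : t i • z = R i • z := by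
  change toPGL (t i) • z = _
  simp [toPGL]

end
end PentagonGroup

namespace PentagonGroup

open Matrix UpperHalfPlane MatrixGroups
noncomputable section

/-! ### Half-planes and the exchange property -/

/-- The value at `z` of the linear functional on the hyperboloid given by a traceless matrix `M`,
in terms of the point `z` of the upper half-plane. If `M` has determinant `-1`, its sign tells on
which side of the geodesic fixed by `M` the point `z` lies. -/
def form (M : Matrix (Fin 2) (Fin 2) ℝ) (z : ℍ) : ℝ :=
  (M 0 1 + 2 * M 0 0 * z.re - M 1 0 * (z.re ^ 2 + z.im ^ 2)) / z.im

/-- The signed side of `z` with respect to the `k`-th side of the pentagon. -/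
def wall (k : Fin 5) (z : ℍ) : ℝ := form (A k) z

lemma R_smul_re_im (k : Fin 5) (z : ℍ) :
    let D := (A k 1 0 * z.re - A k 0 0) ^ 2 + (A k 1 0 * z.im) ^ 2
    0 < D ∧ (R k • z).im = z.im / D ∧ (R k • z).re =
      (A k 0 0 * A k 1 0 * (z.re ^ 2 + z.im ^ 2) - A k 0 0 ^ 2 * z.re + A k 0 1 * A k 1 0 * z.re
        - A k 0 1 * A k 0 0) / D := by
  intro D
  have hd := A_det k
  rw [det_fin_two, A_traceless] at hd
  have hD : Complex.normSq (denom (R k) z) = D := by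
    simp [denom, Complex.normSq_apply, A_traceless, D]; ring
  have hpos : 0 < D := hD ▸ normSq_denom_pos _ z.im_ne_zero
  refine ⟨hpos, ?_, ?_⟩
  · rw [im_smul_eq_div_normSq, hD]; simp [A_det]
  · rw [re_smul, Complex.div_re, hD, ← add_div]
    congr 1
    simp [num, denom, A_traceless]; ring

/-- In the hyperboloid model, `R i` is the linear reflection in the unit vector with functional `wall i`,
and `gram` is the Gram matrix of these vectors. -/
lemma wall_R_smul (i j : Fin 5) (z : ℍ) :
    wall j (R i • z) = wall j z - 2 * gram i j * wall i z := by
  obtain ⟨hD, him, hre⟩ := R_smul_re_im i z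
  have h1 := A_form i j
  have h2 := A_form i i
  simp only [gram, if_true, mul_one] at h2
  have hy := z.im_pos
  simp only [wall, form, him, hre, ← h1]
  set D := (A i 1 0 * z.re - A i 0 0) ^ 2 + (A i 1 0 * z.im) ^ 2 with hDdef
  generalize z.re = x at *
  generalize z.im = y at *
  generalize A i 0 0 = a at *
  generalize A i 0 1 = b at *
  generalize A i 1 0 = c at *
  generalize A j 0 0 = a' at *
  generalize A j 0 1 = b' at *
  generalize A j 1 0 = c' at *
  have h3 : a ^ 2 + b * c - 1 = 0 := by linarith
  set X := a * c * (x ^ 2 + y ^ 2) - a ^ 2 * x + b * c * x - b * a with hX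
  have hN : X ^ 2 + y ^ 2 = D * (a ^ 2 * (x ^ 2 + y ^ 2) + 2 * a * b * x + b ^ 2) := by
    rw [hX, hDdef]; linear_combination (-y ^ 2 * (a ^ 2 + b * c + 1)) * h3
  have h4 : (X / D) ^ 2 + (y / D) ^ 2 =
      (a ^ 2 * (x ^ 2 + y ^ 2) + 2 * a * b * x + b ^ 2) / D := by
    rw [div_pow, div_pow, ← add_div, hN]; field_simp
  rw [h4]
  field_simp
  rw [hX, hDdef]
  linear_combination (b' + 2 * a' * x - c' * (x ^ 2 + y ^ 2)) * h3

lemma wall_t_smul (i j : Fin 5) (z : ℍ) :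
    wall j (t i • z) = wall j z - 2 * gram i j * wall i z := by
  rw [t_smul, wall_R_smul]

lemma wall_t_smul_self (i : Fin 5) (z : ℍ) : wall i (t i • z) = -wall i z := by
  rw [wall_t_smul, gram, if_pos rfl]; ring

lemma wall_t_smul_adj {i j : Fin 5} (h : Adj i j) (z : ℍ) : wall j (t i • z) = wall j z := by
  have hij : i ≠ j := by rintro rfl; revert h; fin_cases i <;> decide
  rw [wall_t_smul, gram, if_neg hij, if_pos h]; ring

lemma wall_I_pos (k : Fin 5) : 0 < wall k I := by
  have : 0 < (√2 * s)⁻¹ * (2 * κ) := by have := s_pos; have := κ_pos; positivity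
  simp [wall, form, A] at this ⊢
  linarith

lemma A_off_diag_pos (k : Fin 5) : 0 < A k 0 1 - A k 1 0 := by
  have := wall_I_pos k
  simpa [wall, form] using this

/-- Two sides of the pentagon without a common vertex lie on disjoint geodesics, and the
complementary half-planes are disjoint. -/
lemma wall_pos_of_nonpos {i j : Fin 5} (hij : i ≠ j) (h : ¬ Adj i j) {z : ℍ}
    (hi : wall i z ≤ 0) : 0 < wall j z := by
  by_contra! hj
  have hs : 0 < gram i j * (-1) - 1 := by
    rw [gram, if_neg hij, if_neg h]; linarith [c_gt]
  have hy := z.im_pos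
  have h0 := A_form i j
  have h1 := A_form i i
  have h2 := A_form j j
  have h3 := A_off_diag_pos i
  have h4 := A_off_diag_pos j
  simp only [gram, if_true, mul_one] at h1 h2
  have hi : A i 0 1 + 2 * A i 0 0 * z.re - A i 1 0 * (z.re ^ 2 + z.im ^ 2) ≤ 0 := by
    simpa [wall, form, div_le_iff₀ hy] using hi
  have hj : A j 0 1 + 2 * A j 0 0 * z.re - A j 1 0 * (z.re ^ 2 + z.im ^ 2) ≤ 0 := by
    simpa [wall, form, div_le_iff₀ hy] using hj
  -- The sum of the two functionals is given by a matrix of positive determinant.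
  obtain ⟨a, ha⟩ : ∃ a, a = A i 0 0 + A j 0 0 := ⟨_, rfl⟩
  obtain ⟨b, hb⟩ : ∃ b, b = A i 0 1 + A j 0 1 := ⟨_, rfl⟩
  obtain ⟨c, hc⟩ : ∃ c, c = A i 1 0 + A j 1 0 := ⟨_, rfl⟩
  have hdet : a ^ 2 + b * c < 0 := by rw [ha, hb, hc]; nlinarith
  have hbc : 0 < b - c := by rw [hb, hc]; linarith
  have hq : b + 2 * a * z.re - c * (z.re ^ 2 + z.im ^ 2) ≤ 0 := by rw [ha, hb, hc]; linarith
  have hc0 : c < 0 := by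
    by_contra! h'
    nlinarith [mul_nonneg h' (show 0 ≤ b by linarith), sq_nonneg a]
  nlinarith [sq_nonneg (c * z.re - a), mul_pos_of_neg_of_neg hc0 hc0, sq_nonneg (c * z.im),
    mul_nonneg_of_nonpos_of_nonpos hc0.le hq]

lemma t_smul_eq_self {i : Fin 5} {z : ℍ} (h : wall i z = 0) : t i • z = z := by
  obtain ⟨hD, him, hre⟩ := R_smul_re_im i z
  have h1 := A_form i i
  simp only [gram, if_true, mul_one] at h1
  have h2 : A i 0 1 + 2 * A i 0 0 * z.re - A i 1 0 * (z.re ^ 2 + z.im ^ 2) = 0 := by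
    simpa [wall, form, z.im_ne_zero] using h
  have hD1 : (A i 1 0 * z.re - A i 0 0) ^ 2 + (A i 1 0 * z.im) ^ 2 = 1 := by
    linear_combination h1 / 2 - A i 1 0 * h2
  rw [hD1, div_one] at him hre
  rw [t_smul]
  refine UpperHalfPlane.ext (Complex.ext ?_ him)
  refine hre.trans ?_
  change _ = z.re
  linear_combination z.re * h1 / 2 - A i 0 0 * h2

/-- The closed regular right-angled pentagon centred at `i`. -/
def chamber : Set ℍ := {z | ∀ k, 0 ≤ wall k z}

lemma I_mem_chamber : I ∈ chamber := fun k => (wall_I_pos k).le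

/-- The exchange property: if the image of the chamber under the inverse of a word lies beyond the
`j`-th side, then the word can be shortened at the cost of a final letter `j`. -/
lemma exchange {z : ℍ} (hz : z ∈ chamber) (L : List (Fin 5)) (j : Fin 5)
    (h : wall j ((wd L)⁻¹ • z) < 0) :
    ∃ L' : List (Fin 5), L'.length + 1 ≤ L.length ∧ wd L = wd L' * t j := by
  induction hn : L.length using Nat.strong_induction_on generalizing L j with
  | _ n ih =>
  rcases List.eq_nil_or_concat L with rfl | ⟨M, i, rfl⟩
  · exact absurd (hz j) (by simpa using h)
  · simp only [List.concat_eq_append, List.length_append, List.length_singleton, wd_append,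
      wd_cons, wd_nil, mul_one, _root_.mul_inv_rev, t_inv, mul_smul] at h hn ⊢
    by_cases hij : i = j
    · exact ⟨M, by omega, by rw [hij]⟩
    by_cases hadj : Adj i j
    · rw [wall_t_smul_adj hadj] at h
      obtain ⟨M', hM', e⟩ := ih _ (by omega) M j h rfl
      refine ⟨M' ++ [i], by simp; omega, ?_⟩
      rw [e, wd_append, wd_cons, wd_nil, mul_one, mul_assoc, mul_assoc, t_comm hadj]
    · have h1 : 0 < wall i (t i • (wd M)⁻¹ • z) := by
        refine wall_pos_of_nonpos (Ne.symm hij) (fun h => hadj (Or.symm h)) h.le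
      rw [wall_t_smul_self] at h1
      obtain ⟨M', hM', e⟩ := ih _ (by omega) M i (by linarith) rfl
      have e' : wd M * t i = wd M' := by rw [e, mul_assoc, t_mul_self, mul_one]
      have h2 : wall j ((wd M')⁻¹ • z) < 0 := by
        rw [← e', _root_.mul_inv_rev, t_inv, mul_smul]; exact h
      obtain ⟨M'', hM'', e''⟩ := ih _ (by omega) M' j h2 rfl
      exact ⟨M'', by omega, by rw [e', e'']⟩

/-- A shortest word for an element of the Coxeter group. -/
lemma exists_wd_minimal (w : W) :
    ∃ L, w = wd L ∧ ∀ L', w = wd L' → L.length ≤ L'.length := by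
  obtain ⟨L, hL⟩ := exists_wd w
  have := Nat.lt_wfRel.wf.has_min {n | ∃ L, w = wd L ∧ L.length = n} ⟨_, L, hL, rfl⟩
  obtain ⟨_, ⟨L, hL, rfl⟩, h⟩ := this
  exact ⟨L, hL, fun L' h' => not_lt.1 (h _ ⟨L', h', rfl⟩)⟩

/-- If `w` maps a point of the open chamber to a point of the closed one, then `w` is trivial. -/
lemma eq_one_of_smul_mem {w : W} {z : ℍ} (hz : z ∈ chamber) (h : ∀ k, 0 < wall k (w⁻¹ • z)) :
    w = 1 := by
  obtain ⟨L, rfl, hL⟩ := exists_wd_minimal w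
  rcases List.eq_nil_or_concat L with rfl | ⟨M, i, rfl⟩
  · rfl
  · simp only [List.concat_eq_append, List.length_append, List.length_singleton, wd_append,
      wd_cons, wd_nil, mul_one, _root_.mul_inv_rev, t_inv, mul_smul] at h hL
    have := h i
    rw [wall_t_smul_self] at this
    obtain ⟨M', hM', e⟩ := exchange hz M i (by linarith)
    have := hL M' (by rw [e, mul_assoc, t_mul_self, mul_one])
    omega

/-- The stabilizer of a point of the chamber is generated by the reflections in the sides through
the point. -/
lemma mem_closure_of_smul_eq {w : W} {z : ℍ} (hz : z ∈ chamber) (h : w • z = z) :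
    w ∈ Subgroup.closure {g | ∃ k, wall k z = 0 ∧ g = t k} := by
  obtain ⟨L, rfl⟩ := exists_wd w
  induction hn : L.length using Nat.strong_induction_on generalizing L with
  | _ n ih =>
  rcases List.eq_nil_or_concat L with rfl | ⟨M, i, rfl⟩
  · exact one_mem _
  · simp only [List.concat_eq_append, List.length_append, List.length_singleton, wd_append,
      wd_cons, wd_nil, mul_one, mul_smul] at h hn ⊢
    have hM : (wd M)⁻¹ • z = t i • z := by rw [inv_smul_eq_iff, h]
    rcases (hz i).eq_or_lt with h0 | h0
    · have hi : t i • z = z := t_smul_eq_self h0.symm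
      rw [hi] at h
      exact mul_mem (ih _ (by omega) M h rfl) (Subgroup.subset_closure ⟨i, h0.symm, rfl⟩)
    · obtain ⟨M', hM', e⟩ := exchange hz M i (by rw [hM, wall_t_smul_self]; linarith)
      have e' : wd M * t i = wd M' := by rw [e, mul_assoc, t_mul_self, mul_one]
      rw [e']
      exact ih _ (by omega) M' (by rw [← e', mul_smul, h]) rfl

/-- At most two walls pass through a point of the chamber, and two such walls are adjacent, so the
stabilizer of the point is trivial, of order two, or a Klein four-group. -/
lemma exists_adj_stabilizer {w : W} {z : ℍ} (hz : z ∈ chamber) (h : w • z = z) :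
    w = 1 ∨ (∃ i, w = t i) ∨ ∃ i, w = t i * t (i + 1) := by
  classical
  have hJ : ∀ J : Finset (Fin 5), (∀ i ∈ J, ∀ k ∈ J, i = k ∨ Adj i k) →
      ∃ i, ∀ k ∈ J, k = i ∨ k = i + 1 := by decide
  obtain ⟨i, hi⟩ := hJ {k | wall k z = 0} (fun i hi k hk => by
    simp only [Finset.mem_filter, Finset.mem_univ, true_and] at hi hk
    by_contra! h
    exact (wall_pos_of_nonpos h.1 h.2 hi.le).ne' hk)
  have hc := t_comm (i := i) (j := i + 1) (Or.inr rfl)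
  suffices w = 1 ∨ w = t i ∨ w = t (i + 1) ∨ w = t i * t (i + 1) by
    rcases this with h | h | h | h
    exacts [Or.inl h, Or.inr (Or.inl ⟨_, h⟩), Or.inr (Or.inl ⟨_, h⟩), Or.inr (Or.inr ⟨_, h⟩)]
  have h1 := t_mul_self i
  have h2 := t_mul_self (i + 1)
  have key : ∀ k, wall k z = 0 → ∀ y, (y = 1 ∨ y = t i ∨ y = t (i + 1) ∨ y = t i * t (i + 1)) →
      t k * y = 1 ∨ t k * y = t i ∨ t k * y = t (i + 1) ∨ t k * y = t i * t (i + 1) := by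
    intro k hk y hy
    rcases hi k (by simpa using hk) with rfl | rfl <;> rcases hy with rfl | rfl | rfl | rfl
    · exact .inr (.inl (mul_one _))
    · exact .inl h1
    · exact .inr (.inr (.inr rfl))
    · exact .inr (.inr (.inl (by rw [← mul_assoc, h1, one_mul])))
    · exact .inr (.inr (.inl (mul_one _)))
    · exact .inr (.inr (.inr hc.symm))
    · exact .inl h2
    · exact .inr (.inl (by rw [hc, ← mul_assoc, h2, one_mul]))
  have hw := mem_closure_of_smul_eq hz h
  clear h
  induction hw using Subgroup.closure_induction_left with
  | one => exact Or.inl rfl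
  | mul_left x hx y hy ih =>
    obtain ⟨k, hk, rfl⟩ := hx
    exact key k hk y ih
  | inv_mul_cancel x hx y hy ih =>
    obtain ⟨k, hk, rfl⟩ := hx
    rw [t_inv]
    exact key k hk y ih

end
end PentagonGroup

namespace PentagonGroup

open Matrix UpperHalfPlane MatrixGroups
noncomputable section

/-! ### Discreteness and compactness of the chamber -/

lemma cosh_dist_I (z : ℍ) :
    Real.cosh (dist z I) = (1 + (z.re ^ 2 + z.im ^ 2)) / (2 * z.im) := by
  rw [cosh_dist']; simp; ring

lemma dist_J_smul (z w : ℍ) : dist (UpperHalfPlane.J • z) (UpperHalfPlane.J • w) = dist z w := by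
  have him : ∀ z : ℍ, (UpperHalfPlane.J • z).im = z.im := fun z => by
    have := congrArg Complex.im (coe_J_smul z); simpa using this
  rw [UpperHalfPlane.dist_eq, UpperHalfPlane.dist_eq, him, him, coe_J_smul, coe_J_smul,
    dist_neg_neg, Complex.dist_conj_conj]

lemma dist_R_smul (i : Fin 5) (z w : ℍ) : dist (R i • z) (R i • w) = dist z w := by
  let g : SL(2, ℝ) := ⟨UpperHalfPlane.J.val * A i, by rw [det_mul, A_det]; simp [val_J]⟩
  have hg : ∀ z : ℍ, R i • z = UpperHalfPlane.J • (g • z) := fun z => by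
    rw [MulAction.compHom_smul_def _ g z, ← SemigroupAction.mul_smul]
    congr 1
    apply Units.ext
    change A i = UpperHalfPlane.J.val * (UpperHalfPlane.J.val * A i)
    rw [← mul_assoc, show UpperHalfPlane.J.val * UpperHalfPlane.J.val = 1 by simp [val_J, one_fin_two], one_mul]
  rw [hg, hg, dist_J_smul, dist_smul]

lemma dist_W_smul (g : W) (z w : ℍ) : dist (g • z) (g • w) = dist z w := by
  obtain ⟨L, rfl⟩ := exists_wd g
  induction L with
  | nil => simp
  | cons i L ih => rw [wd_cons, mul_smul, mul_smul, t_smul, t_smul, dist_R_smul, ih]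

instance : IsIsometricSMul W ℍ := ⟨fun g => Isometry.of_dist_eq (dist_W_smul g)⟩

lemma continuous_wall (k : Fin 5) : Continuous (wall k) := by
  have hre : Continuous UpperHalfPlane.re := continuous_re
  have him : Continuous UpperHalfPlane.im := continuous_im
  unfold wall form
  exact Continuous.div (by fun_prop) him fun z => z.im_ne_zero

lemma isClosed_chamber : IsClosed chamber := by
  have : chamber = ⋂ k, {z | 0 ≤ wall k z} := by ext; simp [chamber]
  rw [this]
  exact isClosed_iInter fun k => isClosed_le continuous_const (continuous_wall k)

lemma exists_separation : ∃ ε > 0, ∀ w : W, dist (w • I) I < ε → w = 1 := by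
  have h : ∀ᶠ z in nhds I, ∀ k, 0 < wall k z :=
    Filter.eventually_all.2 fun k =>
      (continuous_wall k).continuousAt.eventually (lt_mem_nhds (wall_I_pos k))
  obtain ⟨ε, hε, h⟩ := Metric.eventually_nhds_iff.1 h
  refine ⟨ε, hε, fun w hw => ?_⟩
  refine inv_eq_one.1 (eq_one_of_smul_mem I_mem_chamber fun k => ?_)
  rw [inv_inv]
  exact h hw k

lemma finite_dist_le (r : ℝ) : {w : W | dist (w • I) I ≤ r}.Finite := by
  obtain ⟨ε, hε, h⟩ := exists_separation
  obtain ⟨T, -, hT, hcov⟩ :=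
    (isCompact_closedBall I r).finite_cover_balls (half_pos hε)
  refine (hT.biUnion (t := fun x => {w : W | dist (w • I) x < ε / 2}) fun x _ => ?_).subset ?_
  · refine Set.Subsingleton.finite fun w hw w' hw' => ?_
    simp only [Set.mem_ofPred_eq] at hw hw'
    refine inv_mul_eq_one.1 (h _ ?_) |>.symm
    rw [mul_smul, ← dist_smul w', smul_inv_smul]
    linarith [dist_triangle_right (w • I) (w' • I) x]
  · intro w hw
    simpa using hcov (Metric.mem_closedBall.2 hw)

lemma finite_smul_inter (r : ℝ) :
    {w : W | ∃ z, dist z I ≤ r ∧ dist (w • z) I ≤ r}.Finite := by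
  refine (finite_dist_le (2 * r)).subset ?_
  rintro w ⟨z, h1, h2⟩
  have := dist_triangle (w • I) (w • z) I
  rw [dist_smul, dist_comm I z] at this
  simp only [Set.mem_ofPred_eq]
  linarith

instance : ProperlyDiscontinuousSMul W ℍ where
  finite_disjoint_inter_image {K L} hK hL := by
    obtain ⟨r, hr⟩ := (hK.union hL).isBounded.subset_closedBall I
    refine (finite_smul_inter r).subset ?_
    rintro w hw
    obtain ⟨_, ⟨z, hz, rfl⟩, hz'⟩ := hw
    exact ⟨z, hr (Or.inl hz), hr (Or.inr hz')⟩

/-- Reflecting a point to the side of a wall that contains the centre brings it closer to the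
centre. -/
lemma dist_t_smul_lt {k : Fin 5} {z : ℍ} (h : wall k z < 0) : dist (t k • z) I < dist z I := by
  rw [← abs_of_nonneg (dist_nonneg (x := t k • z)), ← abs_of_nonneg (dist_nonneg (x := z)),
    ← Real.cosh_lt_cosh, cosh_dist_I, cosh_dist_I, t_smul]
  obtain ⟨hD, him, hre⟩ := R_smul_re_im k z
  have h1 := A_form k k
  simp only [gram, if_true, mul_one] at h1
  have h3 := A_off_diag_pos k
  have hy := z.im_pos
  have hw : A k 0 1 + 2 * A k 0 0 * z.re - A k 1 0 * (z.re ^ 2 + z.im ^ 2) < 0 := by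
    simpa [wall, form, div_lt_iff₀ hy] using h
  rw [him, hre]
  set D := (A k 1 0 * z.re - A k 0 0) ^ 2 + (A k 1 0 * z.im) ^ 2 with hDdef
  generalize z.re = x at *
  generalize z.im = y at *
  generalize A k 0 0 = a at *
  generalize A k 0 1 = b at *
  generalize A k 1 0 = c at *
  set X := a * c * (x ^ 2 + y ^ 2) - a ^ 2 * x + b * c * x - b * a with hX
  have hdet : a ^ 2 + b * c - 1 = 0 := by linarith
  have hN : X ^ 2 + y ^ 2 = D * (a ^ 2 * (x ^ 2 + y ^ 2) + 2 * a * b * x + b ^ 2) := by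
    rw [hX, hDdef]; linear_combination (-y ^ 2 * (a ^ 2 + b * c + 1)) * hdet
  have h4 : (X / D) ^ 2 + (y / D) ^ 2 =
      (a ^ 2 * (x ^ 2 + y ^ 2) + 2 * a * b * x + b ^ 2) / D := by
    rw [div_pow, div_pow, ← add_div, hN]; field_simp
  rw [h4]
  have h5 : (1 + (a ^ 2 * (x ^ 2 + y ^ 2) + 2 * a * b * x + b ^ 2) / D) / (2 * (y / D)) =
      (D + (a ^ 2 * (x ^ 2 + y ^ 2) + 2 * a * b * x + b ^ 2)) / (2 * y) := by
    field_simp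
  rw [h5]
  refine div_lt_div_of_pos_right ?_ (by positivity)
  have h6 : D + (a ^ 2 * (x ^ 2 + y ^ 2) + 2 * a * b * x + b ^ 2) - (1 + (x ^ 2 + y ^ 2)) =
      (b - c) * (b + 2 * a * x - c * (x ^ 2 + y ^ 2)) := by
    rw [hDdef]; linear_combination (1 + x ^ 2 + y ^ 2) * hdet
  nlinarith [mul_neg_of_pos_of_neg h3 hw]

/-- Every point is carried into the chamber by the Coxeter group. -/
lemma exists_smul_mem_chamber (z : ℍ) : ∃ w : W, w • z ∈ chamber := by
  have hfin : {w : W | dist (w • z) I ≤ dist z I}.Finite :=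
    (finite_smul_inter (dist z I)).subset fun w hw => ⟨z, le_rfl, hw⟩
  obtain ⟨w, hw, hmin⟩ := Set.exists_min_image _ (fun w : W => dist (w • z) I) hfin ⟨1, by simp⟩
  refine ⟨w, fun k => ?_⟩
  by_contra! hk
  have h := dist_t_smul_lt hk
  have := hmin (t k * w) (by
    simp only [Set.mem_ofPred_eq, mul_smul] at hw ⊢; linarith)
  rw [mul_smul] at this
  linarith

lemma cos_sin_sideAngle :
    (Real.cos (sideAngle 0) = c ∧ Real.sin (sideAngle 0) = s) ∧
    (Real.cos (sideAngle 1) = -κ ^ 2 ∧ Real.sin (sideAngle 1) = 2 * s * c) ∧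
    (Real.cos (sideAngle 2) = -1 ∧ Real.sin (sideAngle 2) = 0) ∧
    (Real.cos (sideAngle 3) = -κ ^ 2 ∧ Real.sin (sideAngle 3) = -(2 * s * c)) ∧
    (Real.cos (sideAngle 4) = c ∧ Real.sin (sideAngle 4) = -s) := by
  have h0 : sideAngle 0 = Real.pi / 5 := by simp [sideAngle]
  have h1 : sideAngle 1 = Real.pi - 2 * (Real.pi / 5) := by simp [sideAngle]; ring
  have h2 : sideAngle 2 = Real.pi := by simp [sideAngle]; ring
  have h3 : sideAngle 3 = Real.pi + 2 * (Real.pi / 5) := by simp [sideAngle]; ring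
  have h4 : sideAngle 4 = 2 * Real.pi - Real.pi / 5 := by simp [sideAngle]; ring
  rw [h0, h1, h2, h3, h4]
  have e1 : Real.cos (2 * (Real.pi / 5)) = κ ^ 2 := by rw [Real.cos_two_mul', κ_sq, c, s]
  have e2 : Real.sin (2 * (Real.pi / 5)) = 2 * s * c := Real.sin_two_mul _
  refine ⟨⟨rfl, rfl⟩, ⟨?_, ?_⟩, ⟨?_, ?_⟩, ⟨?_, ?_⟩, ?_, ?_⟩
  · rw [Real.cos_pi_sub, e1]
  · rw [Real.sin_pi_sub, e2]
  · exact Real.cos_pi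
  · exact Real.sin_pi
  · rw [add_comm, Real.cos_add_pi, e1]
  · rw [add_comm, Real.sin_add_pi, e2]
  · rw [Real.cos_two_pi_sub, c]
  · rw [Real.sin_two_pi_sub, s]

/-- The chamber is closed and lies in a ball around `i`. -/
lemma isCompact_chamber : IsCompact chamber := by
  refine (isCompact_closedBall I (√(c / (1 - c)))).of_isClosed_subset isClosed_chamber ?_
  intro z hz
  rw [Metric.mem_closedBall]
  refine le_trans (Real.self_le_sinh_iff.2 dist_nonneg) ((Real.sinh_lt_cosh _).le.trans ?_)
  rw [cosh_dist_I]
  have hy := z.im_pos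
  have hs := s_pos
  -- In the hyperboloid model, the inequality of the `k`-th side of the regular pentagon.
  have hv : ∀ k, 0 ≤ κ * (1 + (z.re ^ 2 + z.im ^ 2)) +
      Real.cos (sideAngle k) * (1 - (z.re ^ 2 + z.im ^ 2)) +
      Real.sin (sideAngle k) * (2 * z.re) := by
    intro k
    have h := hz k
    have e : wall k z = (√2 * s)⁻¹ / z.im * (κ * (1 + (z.re ^ 2 + z.im ^ 2)) +
      Real.cos (sideAngle k) * (1 - (z.re ^ 2 + z.im ^ 2)) +
      Real.sin (sideAngle k) * (2 * z.re)) := by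
      simp [wall, form, A]; ring
    rw [e] at h
    exact nonneg_of_mul_nonneg_right h (by positivity)
  obtain ⟨⟨c0, s0⟩, ⟨c1, s1⟩, ⟨c2, s2⟩, ⟨c3, s3⟩, ⟨c4, s4⟩⟩ := cos_sin_sideAngle
  have hκ := κ_sq
  have hcs := c_sq_add_s_sq
  have hc := c_sq
  have hc1 : c < 1 := by nlinarith
  have hkc : κ ^ 2 = c - 1 / 2 := by linarith
  have hs2 : s ^ 2 = 3 / 4 - c / 2 := by linarith
  have v0 := hv 0
  have v1 := hv 1
  have v2 := hv 2
  have v3 := hv 3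
  have v4 := hv 4
  rw [c0, s0] at v0
  rw [c1, s1, hkc] at v1
  rw [c2, s2] at v2
  rw [c3, s3, hkc] at v3
  rw [c4, s4] at v4
  -- The sum of the products over pairs of sides without a common vertex.
  have key := add_nonneg (add_nonneg (add_nonneg (add_nonneg (mul_nonneg v0 v2)
    (mul_nonneg v1 v3)) (mul_nonneg v2 v4)) (mul_nonneg v3 v0)) (mul_nonneg v4 v1)
  have key2 : 0 ≤ 5 * κ ^ 2 * (1 + (z.re ^ 2 + z.im ^ 2)) ^ 2 -
      5 / 2 * c * ((1 + (z.re ^ 2 + z.im ^ 2)) ^ 2 - 4 * z.im ^ 2) := by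
    refine key.trans_eq ?_
    linear_combination (-4 * c * (c + 1) * (2 * z.re) ^ 2) * hs2 +
      (c / 2 * (2 * z.re) ^ 2 - (1 - (z.re ^ 2 + z.im ^ 2)) ^ 2 / 4) * hc
  rw [hkc] at key2
  refine Real.le_sqrt_of_sq_le ?_
  rw [div_pow, div_le_div_iff₀ (by positivity) (by linarith)]
  linarith

end
end PentagonGroup

namespace PentagonGroup

open Matrix UpperHalfPlane MatrixGroups ComplexHyperbolic
noncomputable section

/-! ### The word problem in the Coxeter group -/

/-- The action of the reflections on vectors of five numbers `a + b * φ`, where `φ` is the golden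
ratio, recorded as the pairs `(a, b)`: it describes how the values of the five side functionals
change when a point is reflected. -/
def step (v : Fin 5 → ℤ × ℤ) (i : Fin 5) : Fin 5 → ℤ × ℤ := fun j =>
  if i = j then -v i else if Adj i j then v j else
    ((v j).1 + 2 * (v i).2, (v j).2 + 2 * ((v i).1 + (v i).2))

lemma wall_foldl_step (L : List (Fin 5)) (j : Fin 5) :
    wall j ((wd L)⁻¹ • I) = wall 0 I * (((L.foldl step fun _ => (1, 0)) j).1 +
      ((L.foldl step fun _ => (1, 0)) j).2 * (2 * c)) := by
  induction L using List.reverseRecOn generalizing j with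
  | nil => simp [wall, form, A]; ring
  | append_singleton L i ih =>
    rw [wd_append, wd_cons, wd_nil, mul_one, _root_.mul_inv_rev, t_inv, SemigroupAction.mul_smul,
      wall_t_smul, List.foldl_append, List.foldl_cons, List.foldl_nil]
    generalize L.foldl step _ = v at *
    rw [ih, ih, gram, step]
    have hc := c_sq
    split_ifs with h1 h2
    · subst h1; simp; ring
    · ring
    · push_cast
      linear_combination 2 * wall 0 I * (v i).2 * hc

/-- The word problem in the Coxeter group: words that send the vector `(1, 1, 1, 1, 1)` to itself
represent the neutral element. -/
lemma wd_eq_one {L : List (Fin 5)}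
    (h : (L.foldl step fun _ => (1, 0)) = fun _ => (1, 0)) : wd L = 1 := by
  refine eq_one_of_smul_mem I_mem_chamber fun k => ?_
  rw [wall_foldl_step, h]
  simpa using wall_I_pos 0

lemma wd_eq_wd {L L' : List (Fin 5)}
    (h : ((L ++ L'.reverse).foldl step fun _ => (1, 0)) = fun _ => (1, 0)) : wd L = wd L' := by
  have := wd_eq_one h
  rwa [wd_append, wd_reverse, mul_inv_eq_one] at this

/-! ### The group generated by eight half-turns -/

/-- The product, in the order of the defining relation, of eight elements. -/
lemma reverse_prod_ofFn {M : Type*} [Monoid M] (f : Fin 8 → M) :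
    (List.ofFn f).reverse.prod = f 7 * f 6 * f 5 * f 4 * f 3 * f 2 * f 1 * f 0 := by
  simp [List.ofFn_succ, mul_assoc]

lemma lift_relations {K : Type*} [Group K] {f : Fin 8 → K} (h1 : ∀ i, f i * f i = 1)
    (h2 : f 7 * f 6 * f 5 * f 4 * f 3 * f 2 * f 1 * f 0 = 1) :
    ∀ w ∈ relations 8, FreeGroup.lift f w = 1 := by
  rintro w (⟨i, rfl⟩ | rfl)
  · simp [h1]
  · rw [map_list_prod, List.map_reverse, List.map_ofFn, reverse_prod_ofFn]
    simpa using h2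

/-- The homomorphism from `H 8` given by eight involutions with trivial product. -/
def liftH {K : Type*} [Group K] (f : Fin 8 → K) (h1 : ∀ i, f i * f i = 1)
    (h2 : f 7 * f 6 * f 5 * f 4 * f 3 * f 2 * f 1 * f 0 = 1) : H 8 →* K :=
  PresentedGroup.toGroup (lift_relations h1 h2)

@[simp] lemma liftH_r {K : Type*} [Group K] (f : Fin 8 → K) (h1 : ∀ i, f i * f i = 1)
    (h2 : f 7 * f 6 * f 5 * f 4 * f 3 * f 2 * f 1 * f 0 = 1) (i : Fin 8) :
    liftH f h1 h2 (r i) = f i :=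
  PresentedGroup.toGroup.of _

@[simp] lemma r_mul_self (i : Fin 8) : (r i : H 8) * r i = 1 :=
  PresentedGroup.one_of_mem (rels := relations 8) (Or.inl ⟨i, rfl⟩)

@[simp] lemma r_mul_cancel (i : Fin 8) (h : H 8) : r i * (r i * h) = h := by
  rw [← mul_assoc, r_mul_self, one_mul]

@[simp] lemma r_inv (i : Fin 8) : (r i : H 8)⁻¹ = r i := inv_eq_of_mul_eq_one_left (r_mul_self i)

lemma r_prod : (r 7 * r 6 * r 5 * r 4 * r 3 * r 2 * r 1 * r 0 : H 8) = 1 := by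
  have := PresentedGroup.one_of_mem (rels := relations 8) (Or.inr rfl)
  rw [map_list_prod, List.map_reverse, List.map_ofFn, reverse_prod_ofFn] at this
  exact this

lemma H_induction {p : H 8 → Prop} (one : p 1) (mul : ∀ i h, p h → p (r i * h)) (h : H 8) :
    p h := by
  have key : ∀ h, p h → ∀ g : H 8, p (g * h) := by
    intro h hh g
    induction g using PresentedGroup.induction_on with
    | _ z =>
      induction z using FreeGroup.induction_on generalizing h with
      | C1 => simpa using hh
      | of i => exact mul i h hh
      | inv_of i _ => rw [map_inv]; exact (r_inv i).symm ▸ mul i h hh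
      | mul x y hx hy => rw [map_mul, mul_assoc]; exact hx _ (hy _ hh)
  simpa using key 1 one h

/-- The element of `H 8` spelled by a word. -/
def rd (C : List (Fin 8)) : H 8 := (C.map r).prod

@[simp] lemma rd_nil : rd [] = 1 := rfl

@[simp] lemma rd_cons (i : Fin 8) (C : List (Fin 8)) : rd (i :: C) = r i * rd C := by simp [rd]

@[simp] lemma rd_append (C C' : List (Fin 8)) : rd (C ++ C') = rd C * rd C' := by simp [rd]

lemma rd_reverse (C : List (Fin 8)) : rd C.reverse = (rd C)⁻¹ := by
  induction C with
  | nil => simp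
  | cons i C ih => simp [ih]

/-- The words spelling the eight half-turns. -/
def halfTurnWord : Fin 8 → List (Fin 5) :=
  ![[3, 1, 3, 1, 2, 3, 1, 3], [3, 1, 3, 0, 1, 3, 1, 3], [3, 1, 3, 4, 0, 3, 1, 3],
    [3, 1, 4, 0, 1, 3], [3, 4, 0, 3], [4, 0], [0, 1], [1, 2]]

/-- The homomorphism from `H 8` to the Coxeter group given by the half-turns. -/
def ψ : H 8 →* W :=
  liftH (fun i => wd (halfTurnWord i))
    (fun i => by
      rw [← wd_append]; apply wd_eq_one; revert i; decide +kernel)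
    (by
      simp only [← wd_append]; apply wd_eq_one; decide +kernel)

@[simp] lemma ψ_r (i : Fin 8) : ψ (r i) = wd (halfTurnWord i) := liftH_r _ _ _ _

lemma ψ_rd (C : List (Fin 8)) : ψ (rd C) = wd (C.flatMap halfTurnWord) := by
  induction C with
  | nil => simp
  | cons i C ih => simp [ih]

/-- Words spelling representatives of the left cosets of the image of `ψ`. -/
def cosetWord : Fin 8 → List (Fin 5) :=
  ![[], [0], [3], [3, 0], [1, 3], [1, 3, 0], [3, 1, 3], [3, 1, 3, 0]]

/-- The action of the reflections on the left cosets of the image of `ψ`. -/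
def cosetPerm : Fin 5 → Fin 8 → Fin 8 :=
  ![![1, 0, 3, 2, 5, 4, 7, 6], ![1, 0, 4, 5, 2, 3, 7, 6], ![1, 0, 3, 2, 5, 4, 7, 6],
    ![2, 3, 0, 1, 6, 7, 4, 5], ![1, 0, 3, 2, 5, 4, 7, 6]]

/-- The cocycle of the action on the left cosets: with the coset representatives `u k` one has
`t j * u k = u (cosetPerm j k) * ψ (rd (cocycle j k))`. -/
def cocycle : Fin 5 → Fin 8 → List (Fin 8) :=
  ![![[], [], [5, 4], [4, 5], [5, 4], [4, 5], [5, 4, 3, 2], [2, 3, 4, 5]],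
    ![[6], [6], [], [], [], [], [6, 7, 0], [0, 7, 6]],
    ![[6, 7], [7, 6], [6, 7], [7, 6], [6, 7], [7, 6], [6, 7], [7, 6]],
    ![[], [], [], [], [], [], [], []],
    ![[5], [5], [5], [5], [5, 4, 3], [3, 4, 5], [5, 4, 3], [3, 4, 5]]]

lemma t_mul_cosetWord (j : Fin 5) (k : Fin 8) :
    t j * wd (cosetWord k) = wd (cosetWord (cosetPerm j k)) * ψ (rd (cocycle j k)) := by
  rw [← wd_cons, ψ_rd, ← wd_append]
  apply wd_eq_wd
  revert j k
  decide +kernel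

/-- The image of `ψ` has finite index in the Coxeter group. -/
lemma exists_eq_cosetWord_mul (w : W) : ∃ k h, w = wd (cosetWord k) * ψ h := by
  obtain ⟨L, rfl⟩ := exists_wd w
  induction L with
  | nil => exact ⟨0, 1, by simp [cosetWord]⟩
  | cons j L ih =>
    obtain ⟨k, h, e⟩ := ih
    refine ⟨cosetPerm j k, rd (cocycle j k) * h, ?_⟩
    rw [wd_cons, e, ← mul_assoc, t_mul_cosetWord, map_mul, mul_assoc]

/-- Cancellation of equal neighbours in a word. -/
def cancel : List (Fin 8) → List (Fin 8)
  | [] => []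
  | a :: C => match cancel C with
    | [] => [a]
    | b :: D => if a = b then D else a :: b :: D

lemma rd_cancel (C : List (Fin 8)) : rd (cancel C) = rd C := by
  induction C with
  | nil => rfl
  | cons a C ih =>
    rw [cancel, rd_cons, ← ih]
    rcases cancel C with _ | ⟨b, D⟩
    · simp
    · by_cases h : a = b
      · simp [h]
      · simp [h]

lemma cosetPerm_cosetPerm (j : Fin 5) (k : Fin 8) : cosetPerm j (cosetPerm j k) = k := by
  revert j k; decide

lemma cocycle_cosetPerm (j : Fin 5) (k : Fin 8) :
    cocycle j (cosetPerm j k) = (cocycle j k).reverse := by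
  revert j k; decide

lemma rd_eq_r_one : rd [2, 3, 4, 5, 6, 7, 0] = r 1 := by
  have h := congrArg (·⁻¹) r_prod
  simp only [_root_.mul_inv_rev, r_inv, inv_one] at h
  have h' := congrArg (fun x => r 1 * (r 0 * x) * r 0) h
  simpa [mul_assoc] using h'

/-- The only two instances of the Coxeter relations on cosets that do not follow from
cancellation: they hold because `r 1` and its conjugates are involutions. -/
lemma rd_exceptional :
    rd [2, 3, 4, 5, 6, 7, 0] = rd [0, 7, 6, 5, 4, 3, 2] ∧
      rd [5, 4, 3, 2, 0, 7, 6] = rd [6, 7, 0, 2, 3, 4, 5] := by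
  have h1 := rd_eq_r_one
  have h2 : rd [0, 7, 6, 5, 4, 3, 2] = r 1 := by
    have := rd_reverse [2, 3, 4, 5, 6, 7, 0]
    rwa [h1, r_inv] at this
  refine ⟨h1.trans h2.symm, ?_⟩
  have h3 : rd [5, 4, 3, 2] = rd [6, 7, 0] * r 1 := by rw [← h2]; simp [mul_assoc]
  have h4 : rd [2, 3, 4, 5] = r 1 * rd [0, 7, 6] := by rw [← h1]; simp [mul_assoc]
  change rd ([5, 4, 3, 2] ++ [0, 7, 6]) = rd ([6, 7, 0] ++ [2, 3, 4, 5])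
  rw [rd_append, rd_append, h3, h4, mul_assoc]

lemma rd_cocycle_comm {i j : Fin 5} (h : Adj i j) (k : Fin 8) :
    rd (cocycle i (cosetPerm j k) ++ cocycle j k) =
      rd (cocycle j (cosetPerm i k) ++ cocycle i k) := by
  have key : ∀ i j, Adj i j → ∀ k,
      let C := cancel (cocycle i (cosetPerm j k) ++ cocycle j k)
      let D := cancel (cocycle j (cosetPerm i k) ++ cocycle i k)
      C = D ∨ (C = [2, 3, 4, 5, 6, 7, 0] ∧ D = [0, 7, 6, 5, 4, 3, 2]) ∨
        (D = [2, 3, 4, 5, 6, 7, 0] ∧ C = [0, 7, 6, 5, 4, 3, 2]) ∨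
        (C = [5, 4, 3, 2, 0, 7, 6] ∧ D = [6, 7, 0, 2, 3, 4, 5]) ∨
        (D = [5, 4, 3, 2, 0, 7, 6] ∧ C = [6, 7, 0, 2, 3, 4, 5]) := by
    decide +kernel
  rw [← rd_cancel, ← rd_cancel (cocycle j _ ++ _)]
  rcases key i j h k with e | ⟨e, e'⟩ | ⟨e, e'⟩ | ⟨e, e'⟩ | ⟨e, e'⟩
  · rw [e]
  · rw [e, e', rd_exceptional.1]
  · rw [e, e', rd_exceptional.1]
  · rw [e, e', rd_exceptional.2]
  · rw [e, e', rd_exceptional.2]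

/-- The permutation by which a reflection acts in the representation induced from the regular
representation of `H 8`. -/
def inducedPerm (j : Fin 5) : Equiv.Perm (Fin 8 × H 8) :=
  Function.Involutive.toPerm (fun x => (cosetPerm j x.1, rd (cocycle j x.1) * x.2)) fun x => by
    simp [cosetPerm_cosetPerm, cocycle_cosetPerm, rd_reverse]

lemma inducedPerm_apply (j : Fin 5) (x : Fin 8 × H 8) :
    inducedPerm j x = (cosetPerm j x.1, rd (cocycle j x.1) * x.2) := rfl

lemma cosetPerm_comm {i j : Fin 5} (h : Adj i j) (k : Fin 8) :
    cosetPerm i (cosetPerm j k) = cosetPerm j (cosetPerm i k) := by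
  revert i j k; decide

/-- The permutation representation of the Coxeter group induced from the regular representation
of `H 8`. -/
def inducedAction : W →* Equiv.Perm (Fin 8 × H 8) :=
  lift inducedPerm
    (fun j => Equiv.ext fun x => by
      simp [inducedPerm_apply, cosetPerm_cosetPerm, cocycle_cosetPerm, rd_reverse])
    (fun i j h => Equiv.ext fun x => by
      have h2 := rd_cocycle_comm h x.1
      rw [rd_append, rd_append] at h2
      simp [inducedPerm_apply, ← mul_assoc, cosetPerm_comm h, h2])

/-- The action of a word on the cosets together with the accumulated cocycle. -/
def run (L : List (Fin 5)) (x : Fin 8 × List (Fin 8)) : Fin 8 × List (Fin 8) :=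
  L.foldr (fun j y => (cosetPerm j y.1, cocycle j y.1 ++ y.2)) x

lemma inducedAction_wd (L : List (Fin 5)) (k : Fin 8) (h : H 8) :
    inducedAction (wd L) (k, h) = ((run L (k, [])).1, rd (run L (k, [])).2 * h) := by
  induction L with
  | nil => simp [run]
  | cons j L ih =>
    rw [wd_cons, map_mul, Equiv.Perm.mul_apply, ih]
    simp [inducedAction, inducedPerm_apply, run, mul_assoc]

lemma inducedAction_ψ (h h' : H 8) : inducedAction (ψ h) (0, h') = (0, h * h') := by
  induction h using H_induction with
  | one => simp
  | mul i h ih =>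
    rw [map_mul, map_mul, Equiv.Perm.mul_apply, ih, ψ_r, inducedAction_wd, ← rd_cancel, mul_assoc]
    have h1 : ∀ i, (run (halfTurnWord i) (0, [])).1 = 0 := by decide +kernel
    have h2 : ∀ i, cancel (run (halfTurnWord i) (0, [])).2 =
        if i = 1 then [2, 3, 4, 5, 6, 7, 0] else [i] := by decide +kernel
    rw [h1, h2]
    split_ifs with hi
    · rw [rd_eq_r_one, hi]
    · simp

/-- The half-turns satisfy no further relations: an element `h` of `H 8` is recovered from the action of
`ψ h` on `Fin 8 × H 8`. -/
lemma ψ_injective : Function.Injective ψ := by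
  intro g h e
  have := inducedAction_ψ g 1
  rw [e, inducedAction_ψ] at this
  simpa using this.symm

/-! ### Words of even length -/

lemma mem_G_or (h : H 8) : h ∈ G 8 ∨ r 0 * h ∈ G 8 := by
  have hG : ∀ i j : Fin 8, (r i * r j : H 8) ∈ G 8 := fun i j =>
    Subgroup.subset_closure ⟨(i, j), rfl⟩
  induction h using H_induction with
  | one => exact Or.inl (one_mem _)
  | mul i h ih =>
    rcases ih with ih | ih
    · right
      rw [← mul_assoc]
      exact mul_mem (hG _ _) ih
    · left
      simpa [mul_assoc] using mul_mem (hG i 0) ih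

/-- The permutation by which a reflection acts on the cosets of the image of `G 8`. -/
def parityPerm (j : Fin 5) : Equiv.Perm (Fin 8 × ZMod 2) :=
  Function.Involutive.toPerm (fun x => (cosetPerm j x.1, (cocycle j x.1).length + x.2)) <| by
    unfold Function.Involutive
    revert j
    decide

/-- The action of the Coxeter group on the cosets of the image of `G 8`. -/
def parityAction : W →* Equiv.Perm (Fin 8 × ZMod 2) :=
  lift parityPerm (by decide +kernel) (by decide +kernel)

lemma parityAction_t (j : Fin 5) : parityAction (t j) = parityPerm j := lift_t _ _ _ _

lemma parityAction_wd (L : List (Fin 5)) :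
    parityAction (wd L) = (L.map parityPerm).prod := by
  rw [wd, map_list_prod, List.map_map]
  simp [Function.comp_def, parityAction_t]

lemma parityAction_ψ {g : H 8} (hg : g ∈ G 8) : parityAction (ψ g) (0, 0) = (0, 0) := by
  have key : ∀ i p, parityAction (ψ (r i)) (0, p) = (0, p + 1) := by
    intro i
    rw [ψ_r, parityAction_wd]
    revert i
    decide +kernel
  suffices ∀ p, parityAction (ψ g) (0, p) = (0, p) from this 0
  induction hg using Subgroup.closure_induction with
  | mem x hx =>
    obtain ⟨⟨i, j⟩, rfl⟩ := hx
    intro p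
    rw [map_mul, map_mul, Equiv.Perm.mul_apply, key, key, add_assoc]
    simp [show (1 + 1 : ZMod 2) = 0 from rfl]
  | one => simp
  | mul x y _ _ hx hy => intro p; rw [map_mul, map_mul, Equiv.Perm.mul_apply, hy, hx]
  | inv x _ hx =>
    intro p
    rw [map_inv, map_inv, Equiv.Perm.inv_eq_iff_eq, hx]

/-- The group `G 8` acts freely: the stabilizers in the Coxeter group are generated by one or two
neighbouring reflections, and no nontrivial element of them fixes a coset of `G 8`. -/
lemma eq_one_of_ψ_smul_eq {g : H 8} (hg : g ∈ G 8) {z : ℍ} (h : ψ g • z = z) : g = 1 := by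
  obtain ⟨w, hw⟩ := exists_smul_mem_chamber z
  have h1 : (w * ψ g * w⁻¹) • w • z = w • z := by
    rw [smul_smul, inv_mul_cancel_right, SemigroupAction.mul_smul, h]
  set x := parityAction w (0, 0) with hx
  have h2 : parityAction (w * ψ g * w⁻¹) x = x := by
    simp [hx, parityAction_ψ hg]
  have h3 : ∀ i, ∀ x, parityPerm i x ≠ x := by decide +kernel
  have h4 : ∀ i, ∀ x, parityPerm i (parityPerm (i + 1) x) ≠ x := by decide +kernel
  apply ψ_injective
  rw [map_one]
  rcases exists_adj_stabilizer hw h1 with e | ⟨i, e⟩ | ⟨i, e⟩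
  · rwa [mul_inv_eq_one, mul_eq_left] at e
  · rw [e, parityAction_t] at h2
    exact absurd h2 (h3 i x)
  · rw [e, map_mul, parityAction_t, parityAction_t] at h2
    exact absurd h2 (h4 i x)

end
end PentagonGroup

namespace PentagonGroup

open Matrix UpperHalfPlane MatrixGroups ComplexHyperbolic
noncomputable section

/-! ### The surface -/

instance : MulAction (H 8) ℍ := MulAction.compHom ℍ ψ

lemma H_smul_def (h : H 8) (z : ℍ) : h • z = ψ h • z := rfl

lemma G_smul_def (g : G 8) (z : ℍ) : g • z = ψ g • z := rfl

instance : ContinuousConstSMul (G 8) ℍ := ⟨fun g => continuous_const_smul (ψ g)⟩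

instance : ProperlyDiscontinuousSMul (G 8) ℍ where
  finite_disjoint_inter_image hK hL :=
    (ProperlyDiscontinuousSMul.finite_disjoint_inter_image (Γ := W) hK hL).preimage
      (f := fun g : G 8 => ψ g) (ψ_injective.comp Subtype.val_injective).injOn

instance : IsCancelSMul (G 8) ℍ :=
  isCancelSMul_iff_eq_one_of_smul_eq.2 fun g _ h => Subtype.ext (eq_one_of_ψ_smul_eq g.2 h)

/-- The action of `G 8` on the upper half-plane is cocompact. -/
lemma exists_compact_fundamental_set :
    ∃ K : Set ℍ, IsCompact K ∧ ∀ z, ∃ g : G 8, g • z ∈ K := by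
  refine ⟨⋃ k : Fin 8, (fun z => (wd (cosetWord k))⁻¹ • z) '' chamber ∪
    (fun z => (ψ (r 0) * (wd (cosetWord k))⁻¹) • z) '' chamber, ?_, fun z => ?_⟩
  · exact isCompact_iUnion fun k => (isCompact_chamber.image (continuous_const_smul _)).union
      (isCompact_chamber.image (continuous_const_smul _))
  · obtain ⟨w, hw⟩ := exists_smul_mem_chamber z
    obtain ⟨k, h, rfl⟩ := exists_eq_cosetWord_mul w
    rcases mem_G_or h with hh | hh
    · refine ⟨⟨h, hh⟩, Set.mem_iUnion.2 ⟨k, Or.inl ⟨_, hw, ?_⟩⟩⟩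
      simp [H_smul_def, SemigroupAction.mul_smul]
    · refine ⟨⟨_, hh⟩, Set.mem_iUnion.2 ⟨k, Or.inr ⟨_, hw, ?_⟩⟩⟩
      simp [H_smul_def, SemigroupAction.mul_smul]

/-- The quotient of the upper half-plane by `G 8`. -/
abbrev Surface : Type := MulAction.orbitRel.Quotient (G 8) ℍ

instance : T2Space Surface := t2Space_of_properlyDiscontinuousSMul_of_t2Space

instance : CompactSpace Surface := by
  obtain ⟨K, hK, h⟩ := exists_compact_fundamental_set
  refine ⟨?_⟩
  convert hK.image (f := (Quotient.mk _ : ℍ → Surface)) continuous_quotient_mk'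
  refine (Set.eq_univ_of_forall fun x => ?_).symm
  obtain ⟨z, rfl⟩ := Quotient.mk_surjective x
  obtain ⟨g, hg⟩ := h z
  exact ⟨_, hg, Quotient.sound ⟨g, rfl⟩⟩

instance : ConnectedSpace Surface :=
  Quotient.mk_surjective.connectedSpace (continuous_quotient_mk' (s := MulAction.orbitRel (G 8) ℍ))

lemma nonempty_chartedSpace : Nonempty (ChartedSpace (EuclideanSpace ℝ (Fin 2)) Surface) := by
  let φ : ℂ ≃ₜ EuclideanSpace ℝ (Fin 2) :=
    Complex.orthonormalBasisOneI.repr.toHomeomorph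
  let : ChartedSpace (EuclideanSpace ℝ (Fin 2)) ℂ :=
    φ.toOpenPartialHomeomorph.singletonChartedSpace rfl
  let : ChartedSpace (EuclideanSpace ℝ (Fin 2)) ℍ := ChartedSpace.comp _ ℂ ℍ
  exact ⟨inferInstance⟩

/-- The fundamental group of the surface is the group of the covering by the upper half-plane. -/
def fundamentalGroupSurface (x : Surface) : FundamentalGroup Surface x ≃* G 8 :=
  (isQuotientCoveringMap_quotientMk_of_properlyDiscontinuousSMul.fundamentalGroupEquiv
    ⟨x.out, x.out_eq⟩).trans (MulEquiv.inv' (G 8)).symm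

/-! ### The first homology group -/

/-- The vectors `v i` such that `r i` acts on `ℤ⁶` as the reflection `x ↦ v i - x` in a point. -/
def homologyVector : Fin 8 → Fin (2 * 3) → ℤ :=
  ![![1, 0, 0, 0, 0, 0], ![0, 1, 0, 0, 0, 0], ![0, 0, 1, 0, 0, 0], ![0, 0, 0, 1, 0, 0],
    ![0, 0, 0, 0, 1, 0], ![0, 0, 0, 0, 0, 1], ![-1, 1, -1, 1, -1, 1], 0]

/-- The action of `H 8` on `ℤ⁶` in which the generators act as reflections in points. -/
def homologyAction : H 8 →* Equiv.Perm (Fin (2 * 3) → ℤ) :=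
  liftH (fun i => Equiv.subLeft (homologyVector i))
    (fun i => by ext x : 1; simp)
    (by
      ext x j : 2
      simp only [Equiv.Perm.mul_apply, Equiv.subLeft_apply, Pi.sub_apply, Equiv.Perm.one_apply]
      fin_cases j <;> simp [homologyVector])

lemma homologyAction_apply {g : H 8} (hg : g ∈ G 8) (x : Fin (2 * 3) → ℤ) :
    homologyAction g x = homologyAction g 0 + x := by
  induction hg using Subgroup.closure_induction generalizing x with
  | mem y hy =>
    obtain ⟨⟨i, j⟩, rfl⟩ := hy
    simp [homologyAction]
    abel
  | one => simp
  | mul a b _ _ ha hb =>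
    rw [map_mul, Equiv.Perm.mul_apply, Equiv.Perm.mul_apply, hb x, ha, ha (homologyAction b 0),
      add_assoc]
  | inv a _ ha =>
    rw [map_inv, Equiv.Perm.inv_eq_iff_eq, ha]
    have h := ha ((homologyAction a)⁻¹ 0)
    rw [← Equiv.Perm.mul_apply, mul_inv_cancel, Equiv.Perm.one_apply] at h
    rw [← add_assoc, ← h, zero_add]

/-- The class of an element of `G 8` in `ℤ⁶`. -/
def homologyClass : G 8 →* Multiplicative (Fin (2 * 3) → ℤ) where
  toFun g := Multiplicative.ofAdd (homologyAction g 0)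
  map_one' := by simp
  map_mul' a b := by
    rw [← ofAdd_add, Subgroup.coe_mul, map_mul, Equiv.Perm.mul_apply, homologyAction_apply a.2]

/-- The element `r i * r j` of `G 8`. -/
def rr (i j : Fin 8) : G 8 := ⟨r i * r j, Subgroup.subset_closure ⟨(i, j), rfl⟩⟩

lemma homologyClass_rr (i j : Fin 8) :
    homologyClass (rr i j) = Multiplicative.ofAdd (homologyVector i - homologyVector j) := by
  simp [homologyClass, rr, homologyAction]

lemma rr_mul (i j k : Fin 8) : rr i j * rr j k = rr i k := by
  apply Subtype.ext
  simp [rr, mul_assoc]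

lemma rr_self (i : Fin 8) : rr i i = 1 := Subtype.ext (by simp [rr])

lemma rr_inv (i j : Fin 8) : (rr i j)⁻¹ = rr j i :=
  inv_eq_of_mul_eq_one_right (by rw [rr_mul, rr_self])

lemma rr_prod : rr 7 6 * rr 5 4 * rr 3 2 * rr 1 0 = 1 := by
  apply Subtype.ext
  have := r_prod
  simpa [rr, mul_assoc] using this

lemma G_hom_ext {M : Type*} [Group M] {f g : G 8 →* M} (h : ∀ i, f (rr i 7) = g (rr i 7)) :
    f = g := by
  have h' : ∀ i j, f (rr i j) = g (rr i j) := fun i j => by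
    rw [← rr_mul i 7 j, ← rr_inv j 7, map_mul, map_mul, map_inv, map_inv, h, h]
  ext ⟨x, hx⟩
  induction hx using Subgroup.closure_induction with
  | mem y hy =>
    obtain ⟨⟨i, j⟩, rfl⟩ := hy
    exact h' i j
  | one => exact (map_one f).trans (map_one g).symm
  | mul a b ha hb h1 h2 =>
    exact (map_mul f ⟨a, ha⟩ ⟨b, hb⟩).trans ((congrArg₂ _ h1 h2).trans (map_mul g _ _).symm)
  | inv a ha h1 => exact (map_inv f ⟨a, ha⟩).trans ((congrArg _ h1).trans (map_inv g _).symm)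

/-- The homomorphism from `ℤ⁶` to the abelianization of `G 8` that sends the standard basis to the
classes of `r i * r 7`. -/
def abelianizationOfVector : Multiplicative (Fin (2 * 3) → ℤ) →* Abelianization (G 8) where
  toFun x := ∏ i, Abelianization.of (rr (Fin.castLE (by norm_num) i) 7) ^ x.toAdd i
  map_one' := by simp
  map_mul' x y := by simp only [toAdd_mul, Pi.add_apply, _root_.zpow_add, Finset.prod_mul_distrib]

lemma abelianizationOfVector_apply (x : Multiplicative (Fin (2 * 3) → ℤ)) :
    abelianizationOfVector x =
      Abelianization.of (rr 0 7) ^ x.toAdd 0 * Abelianization.of (rr 1 7) ^ x.toAdd 1 *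
      Abelianization.of (rr 2 7) ^ x.toAdd 2 * Abelianization.of (rr 3 7) ^ x.toAdd 3 *
      Abelianization.of (rr 4 7) ^ x.toAdd 4 * Abelianization.of (rr 5 7) ^ x.toAdd 5 := by
  simp only [abelianizationOfVector, MonoidHom.coe_mk, OneHom.coe_mk]
  exact Fin.prod_univ_six _

lemma of_rr_six : Abelianization.of (rr 6 7) =
    (Abelianization.of (rr 0 7))⁻¹ * Abelianization.of (rr 1 7) *
    (Abelianization.of (rr 2 7))⁻¹ * Abelianization.of (rr 3 7) *
    (Abelianization.of (rr 4 7))⁻¹ * Abelianization.of (rr 5 7) := by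
  have h := congrArg Abelianization.of rr_prod
  rw [← rr_mul 5 7 4, ← rr_mul 3 7 2, ← rr_mul 1 7 0, ← rr_inv 6 7, ← rr_inv 4 7, ← rr_inv 2 7,
    ← rr_inv 0 7] at h
  simp only [map_mul, map_inv, map_one] at h
  generalize Abelianization.of (rr 0 7) = a0 at *
  generalize Abelianization.of (rr 1 7) = a1 at *
  generalize Abelianization.of (rr 2 7) = a2 at *
  generalize Abelianization.of (rr 3 7) = a3 at *
  generalize Abelianization.of (rr 4 7) = a4 at *
  generalize Abelianization.of (rr 5 7) = a5 at *
  generalize Abelianization.of (rr 6 7) = a6 at *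
  rw [mul_assoc, mul_assoc, inv_mul_eq_one] at h
  rw [h]
  simp only [mul_left_comm, mul_comm]

/-- The abelianization of `G 8` is free of rank six. -/
def abelianizationG : Abelianization (G 8) ≃* Multiplicative (Fin (2 * 3) → ℤ) :=
  MonoidHom.toMulEquiv (Abelianization.lift homologyClass) abelianizationOfVector
    (by
      apply Abelianization.hom_ext
      apply G_hom_ext
      intro i
      have h6 := of_rr_six
      simp only [MonoidHom.comp_apply, Abelianization.lift_apply_of, homologyClass_rr,
        abelianizationOfVector_apply, toAdd_ofAdd, MonoidHom.id_apply]
      fin_cases i <;> simp [homologyVector, h6, rr_self])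
    (by
      refine MonoidHom.ext fun x => ?_
      apply Multiplicative.toAdd.injective
      simp only [MonoidHom.comp_apply, abelianizationOfVector_apply,
        map_mul, map_zpow, Abelianization.lift_apply_of, homologyClass_rr, toAdd_mul, toAdd_zpow,
        toAdd_ofAdd, MonoidHom.id_apply]
      ext j
      fin_cases j <;> simp [homologyVector])

lemma isClosedSurface : IsClosedSurfaceOfGenus 3 Surface where
  t2 := inferInstance
  compact := inferInstance
  connected := inferInstance
  manifold := nonempty_chartedSpace
  homology x := ⟨(fundamentalGroupSurface x).abelianizationCongr.trans abelianizationG⟩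

end
end PentagonGroup

namespace PentagonGroup

open Matrix UpperHalfPlane MatrixGroups ComplexHyperbolic
noncomputable section

/-! ### Displacement and traces -/

/-- By cocompactness, the displacements of the nontrivial elements of `G 8` are bounded below. -/
lemma exists_le_displacement :
    ∃ ε > 0, ∀ g ∈ G 8, g ≠ 1 → ∀ z : ℍ, ε ≤ dist (ψ g • z) z := by
  obtain ⟨K, hK, hKz⟩ := exists_compact_fundamental_set
  obtain ⟨r, hr⟩ := hK.isBounded.subset_closedBall I
  have hev : ∀ᶠ ε : ℝ in nhdsWithin 0 (Set.Ioi 0), ∀ w ∈ {w : W | ∃ z, dist z I ≤ r + 1 ∧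
      dist (w • z) I ≤ r + 1}, ∀ g ∈ G 8, g ≠ 1 → ψ g = w → ∀ z ∈ K, ε ≤ dist (w • z) z := by
    refine (Filter.eventually_all_finite (finite_smul_inter (r + 1))).2 fun w _ => ?_
    by_cases hw : ∃ g ∈ G 8, g ≠ 1 ∧ ψ g = w
    · obtain ⟨g, hg, hg1, rfl⟩ := hw
      rcases K.eq_empty_or_nonempty with rfl | hne
      · exact Filter.Eventually.of_forall fun _ _ _ _ _ z hz => hz.elim
      obtain ⟨z₀, -, hmin⟩ := hK.exists_isMinOn hne
        (f := fun z => dist (ψ g • z) z)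
        ((continuous_const_smul (ψ g)).dist continuous_id).continuousOn
      have hpos : 0 < dist (ψ g • z₀) z₀ := dist_pos.2 fun h => hg1 (eq_one_of_ψ_smul_eq hg h)
      filter_upwards [nhdsWithin_le_nhds (gt_mem_nhds hpos)] with ε hε _ _ _ _ z hz
      exact hε.le.trans (hmin hz)
    · exact Filter.Eventually.of_forall fun _ g hg hg1 e => (hw ⟨g, hg, hg1, e⟩).elim
  have hlt : ∀ᶠ ε : ℝ in nhdsWithin 0 (Set.Ioi 0), ε < 1 :=
    nhdsWithin_le_nhds (gt_mem_nhds one_pos)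
  have hpos : ∀ᶠ ε : ℝ in nhdsWithin 0 (Set.Ioi 0), 0 < ε := self_mem_nhdsWithin
  obtain ⟨ε, h, hε1, hε⟩ := (hev.and (hlt.and hpos)).exists
  refine ⟨ε, hε, fun g hg hg1 z => ?_⟩
  obtain ⟨k, hk⟩ := hKz z
  -- Conjugation by `k` moves the point into the compact set.
  have hconj : dist (ψ g • z) z = dist (ψ ((k : H 8) * g * (k : H 8)⁻¹) • k • z) (k • z) := by
    rw [G_smul_def, smul_smul, ← map_mul, inv_mul_cancel_right, map_mul,
      SemigroupAction.mul_smul, dist_smul]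
  rw [hconj]
  have hmem : ((k : H 8) * g * (k : H 8)⁻¹) ∈ G 8 := mul_mem (mul_mem k.2 hg) (inv_mem k.2)
  have hne : ((k : H 8) * g * (k : H 8)⁻¹) ≠ 1 := by simpa [mul_inv_eq_one] using hg1
  by_contra! hlt
  have hI : dist (k • z) I ≤ r := hr hk
  have := h _ ⟨k • z, by linarith, by
    linarith [dist_triangle (ψ ((k : H 8) * g * (k : H 8)⁻¹) • k • z) (k • z) I]⟩
    _ hmem hne rfl _ hk
  linarith

lemma cosh_displacement (M : SL(2, ℝ)) (z : ℍ) :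
    Real.cosh (dist (M • z) z) = 1 +
      Complex.normSq (M 1 0 * (z : ℂ) ^ 2 + (M 1 1 - M 0 0) * z - M 0 1) / (2 * z.im ^ 2) := by
  have hd : ((M 1 0 : ℂ) * z + M 1 1) ≠ 0 := denom_ne_zero M z
  have hcoe : ((M • z : ℍ) : ℂ) = (M 0 0 * z + M 0 1) / (M 1 0 * z + M 1 1) := by
    simpa using coe_specialLinearGroup_apply M z
  have him : (M • z).im = z.im / Complex.normSq (M 1 0 * z + M 1 1) := by
    have := im_smul_eq_div_normSq (SpecialLinearGroup.mapGL ℝ M) z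
    simpa [denom] using! this
  rw [cosh_dist, him, hcoe, Complex.dist_eq, ← Complex.normSq_eq_norm_sq,
    div_sub' hd, Complex.normSq_div]
  have hn := Complex.normSq_pos.2 hd
  have hy := z.im_pos
  congr 1
  rw [show (M 1 0 * (z : ℂ) ^ 2 + (M 1 1 - M 0 0) * z - M 0 1) =
    -((M 0 0 * z + M 0 1) - (M 1 0 * z + M 1 1) * z) by ring, Complex.normSq_neg]
  generalize Complex.normSq (_ + _) = n at *
  field_simp

/-- Elliptic and parabolic transformations have arbitrarily small displacement. -/
lemma exists_displacement_lt {M : SL(2, ℝ)} (hM : |M 0 0 + M 1 1| ≤ 2) {ε : ℝ} (hε : 0 < ε) :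
    ∃ z : ℍ, dist (M • z) z < ε := by
  suffices ∀ η > 0, ∃ z : ℍ, Real.cosh (dist (M • z) z) < 1 + η by
    obtain ⟨z, hz⟩ := this (Real.cosh ε - 1) (by linarith [Real.one_lt_cosh.2 hε.ne'])
    refine ⟨z, ?_⟩
    rwa [add_sub_cancel, Real.cosh_lt_cosh, abs_of_nonneg dist_nonneg, abs_of_pos hε] at hz
  intro η hη
  have hdet := M.2
  rw [det_fin_two] at hdet
  simp only [cosh_displacement, add_lt_add_iff_left]
  change M 0 0 * M 1 1 - M 0 1 * M 1 0 = 1 at hdet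
  generalize M 0 0 = a at *
  generalize M 0 1 = b at *
  generalize M 1 0 = c at *
  generalize M 1 1 = d at *
  have hsq : (a + d) ^ 2 ≤ 4 := by
    have := sq_le_sq' (abs_le.1 hM).1 (abs_le.1 hM).2
    linarith
  by_cases hc : c = 0
  · subst hc
    have had : a = d := by
      have : (a - d) ^ 2 ≤ 0 := by nlinarith
      nlinarith [pow_eq_zero_iff (two_ne_zero) |>.1 (le_antisymm this (sq_nonneg _))]
    subst had
    -- A translation by `b` is small high up in the half-plane.
    refine ⟨⟨⟨0, √((b ^ 2 + 1) / η)⟩, Real.sqrt_pos.2 (by positivity)⟩, ?_⟩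
    have hs : √((b ^ 2 + 1) / η) ^ 2 = (b ^ 2 + 1) / η := Real.sq_sqrt (by positivity)
    simp only [UpperHalfPlane.im, hs]
    rw [div_lt_iff₀ (by positivity)]
    simp [Complex.normSq_apply]
    field_simp
    nlinarith [sq_nonneg b]
  · -- The point lies on the geodesic through the fixed points or above the fixed point on the axis.
    set y := √((1 - (a + d) ^ 2 / 4 + η) / c ^ 2) with hy
    have hpos : 0 < (1 - (a + d) ^ 2 / 4 + η) / c ^ 2 := by
      apply div_pos _ (by positivity); linarith
    have hys : y ^ 2 = (1 - (a + d) ^ 2 / 4 + η) / c ^ 2 := Real.sq_sqrt hpos.le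
    refine ⟨⟨⟨(a - d) / (2 * c), y⟩, Real.sqrt_pos.2 hpos⟩, ?_⟩
    have hval : ((c : ℂ) * ((⟨(a - d) / (2 * c), y⟩ : ℂ)) ^ 2 +
        (d - a) * (⟨(a - d) / (2 * c), y⟩ : ℂ) - b) = ((-η / c : ℝ) : ℂ) := by
      have hy2 : y * y = (1 - (a + d) ^ 2 / 4 + η) / c ^ 2 := by rw [← sq, hys]
      apply Complex.ext
      · simp [sq, hy2]
        field_simp
        nlinarith
      · simp [sq]
        field_simp
        ring
    change Complex.normSq ((c : ℂ) * ((⟨(a - d) / (2 * c), y⟩ : ℂ)) ^ 2 +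
        (d - a) * (⟨(a - d) / (2 * c), y⟩ : ℂ) - b) / (2 * y ^ 2) < η
    rw [hval, Complex.normSq_ofReal, hys, div_lt_iff₀ (by positivity),
      show -η / c * (-η / c) = η * η / c ^ 2 by ring,
      show η * (2 * ((1 - (a + d) ^ 2 / 4 + η) / c ^ 2)) =
        η * (2 * (1 - (a + d) ^ 2 / 4 + η)) / c ^ 2 by ring]
    exact div_lt_div_of_pos_right (by nlinarith) (by positivity)

/-- The nontrivial elements of `G 8` act as hyperbolic translations. -/
lemma two_lt_abs_trace {g : H 8} (hg : g ∈ G 8) (hg1 : g ≠ 1) {M : SL(2, ℝ)}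
    (hM : ∀ z : ℍ, M • z = ψ g • z) : 2 < |M 0 0 + M 1 1| := by
  by_contra! h
  obtain ⟨ε, hε, hd⟩ := exists_le_displacement
  obtain ⟨z, hz⟩ := exists_displacement_lt h hε
  rw [hM] at hz
  exact hz.not_ge (hd g hg hg1 z)

end
end PentagonGroup

namespace PentagonGroup

open Matrix ComplexHyperbolic
noncomputable section

/-! ### The complex geodesic and its reflections -/

/-- The polar vector of the complex geodesic. -/
def e : V := ![1, 0, 0]

/-- The coordinates on `V` in which the orthogonal complement of `e` is `ℂ²` with the hermitian form
`2i (u₀ w̄₁ - u₁ w̄₀)`. This form is preserved by `SL(2, ℝ)`, and the points `z` of the upper half-plane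
correspond to the negative vectors `(z, 1)`. -/
def emb (x : ℂ) (u : Fin 2 → ℂ) : V :=
  ![x, u 0 - Complex.I * u 1, u 0 + Complex.I * u 1]

/-- The inverse coordinates on the orthogonal complement of `e`. -/
def crd (v : V) : Fin 2 → ℂ := ![(v 1 + v 2) / 2, Complex.I * (v 1 - v 2) / 2]

@[simp] lemma emb_crd (v : V) : emb (v 0) (crd v) = v := by
  ext i
  fin_cases i
  · rfl
  · change (v 1 + v 2) / 2 - Complex.I * (Complex.I * (v 1 - v 2) / 2) = v 1
    linear_combination (-(v 1 - v 2) / 2) * Complex.I_mul_I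
  · change (v 1 + v 2) / 2 + Complex.I * (Complex.I * (v 1 - v 2) / 2) = v 2
    linear_combination ((v 1 - v 2) / 2) * Complex.I_mul_I

@[simp] lemma crd_emb (x : ℂ) (u : Fin 2 → ℂ) : crd (emb x u) = u := by
  ext i
  fin_cases i
  · simp [emb, crd]
  · simp [emb, crd]; linear_combination (-(u 1)) * Complex.I_mul_I

@[simp] lemma emb_zero (x : ℂ) (u : Fin 2 → ℂ) : emb x u 0 = x := rfl

lemma exists_emb (v : V) : ∃ x u, v = emb x u := ⟨_, _, (emb_crd v).symm⟩

lemma emb_add (x y : ℂ) (u w : Fin 2 → ℂ) : emb (x + y) (u + w) = emb x u + emb y w := by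
  ext i; fin_cases i <;> simp [emb] <;> ring

lemma emb_smul (a x : ℂ) (u : Fin 2 → ℂ) : emb (a * x) (a • u) = a • emb x u := by
  ext i; fin_cases i <;> simp [emb] <;> ring

lemma emb_one_zero : emb 1 0 = e := by
  ext i; fin_cases i <;> simp [emb, e]

lemma herm_emb (x y : ℂ) (u w : Fin 2 → ℂ) :
    herm (emb x u) (emb y w) = x * conj y + 2 * Complex.I * (u 0 * conj (w 1) - u 1 * conj (w 0)) := by
  simp [herm, emb]; ring

/-! ### Elementary properties of the hermitian form -/

lemma herm_conj (v w : V) : conj (herm v w) = herm w v := by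
  simp [herm]; ring

lemma herm_smul_left (a : ℂ) (v w : V) : herm (a • v) w = a * herm v w := by
  simp [herm]; ring

lemma herm_smul_right (a : ℂ) (v w : V) : herm v (a • w) = conj a * herm v w := by
  simp [herm]; ring

lemma herm_sub_left (u v w : V) : herm (u - v) w = herm u w - herm v w := by
  simp [herm]; ring

lemma herm_sub_right (u v w : V) : herm u (v - w) = herm u v - herm u w := by
  simp [herm]; ring

/-- The antiunitary involution of `V` that fixes `e` and acts on its complex geodesic as the
reflection in the `k`-th side of the pentagon. -/
def S (k : Fin 5) (v : V) : V :=
  emb (conj (v 0)) ((A k).map Complex.ofRealHom *ᵥ star (crd v))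

lemma S_emb (k : Fin 5) (x : ℂ) (u : Fin 2 → ℂ) :
    S k (emb x u) = emb (conj x) ((A k).map Complex.ofRealHom *ᵥ star u) := by
  simp [S]

lemma star_map_mulVec (M : Matrix (Fin 2) (Fin 2) ℝ) (u : Fin 2 → ℂ) :
    star (M.map Complex.ofRealHom *ᵥ u) = M.map Complex.ofRealHom *ᵥ star u := by
  ext i; fin_cases i <;> simp [mulVec, dotProduct, Fin.sum_univ_two]

lemma S_S (k : Fin 5) (v : V) : S k (S k v) = v := by
  obtain ⟨x, u, rfl⟩ := exists_emb v
  rw [S_emb, S_emb, star_map_mulVec, star_star, mulVec_mulVec, ← Matrix.map_mul, A_mul_self]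
  simp

lemma S_add (k : Fin 5) (v w : V) : S k (v + w) = S k v + S k w := by
  obtain ⟨x, u, rfl⟩ := exists_emb v
  obtain ⟨y, u', rfl⟩ := exists_emb w
  rw [← emb_add, S_emb, S_emb, S_emb, ← emb_add, star_add, mulVec_add, map_add]

lemma S_smul (k : Fin 5) (a : ℂ) (v : V) : S k (a • v) = conj a • S k v := by
  obtain ⟨x, u, rfl⟩ := exists_emb v
  rw [← emb_smul, S_emb, S_emb, ← emb_smul, star_smul, mulVec_smul, map_mul]
  rfl

lemma S_sub (k : Fin 5) (v w : V) : S k (v - w) = S k v - S k w := by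
  rw [eq_sub_iff_add_eq, ← S_add, sub_add_cancel]

lemma S_e (k : Fin 5) : S k e = e := by
  rw [← emb_one_zero, S_emb]; simp

lemma herm_S (k : Fin 5) (v w : V) : herm (S k v) (S k w) = conj (herm v w) := by
  obtain ⟨x, u, rfl⟩ := exists_emb v
  obtain ⟨y, u', rfl⟩ := exists_emb w
  have hd := congrArg (fun r : ℝ => (r : ℂ)) (A_det k)
  rw [det_fin_two] at hd
  push_cast at hd
  rw [S_emb, S_emb, herm_emb, herm_emb]
  simp [mulVec, dotProduct, Fin.sum_univ_two, Complex.conj_ofNat]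
  linear_combination (2 * Complex.I * (conj (u 0) * u' 1 - conj (u 1) * u' 0)) * hd

lemma Q_S (k : Fin 5) (q v : V) : Q e (S k q) (S k v) = S k (Q e q v) := by
  have h : ∀ v, herm (S k v) e = conj (herm v e) := fun v => by
    rw [← herm_S k v e, S_e]
  simp only [Q, herm_S, S_sub, S_smul, S_e, h, map_mul, map_div₀, map_ofNat]
  have : conj (herm e e) = herm e e := herm_conj e e
  rw [this]

/-! ### Points of the configuration -/

/-- The unit complex number of a given argument. -/
def E (θ : ℝ) : ℂ := Complex.exp (θ * Complex.I)

lemma E_re_im (θ : ℝ) : E θ = Real.cos θ + Real.sin θ * Complex.I := by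
  rw [E, Complex.exp_mul_I, Complex.ofReal_cos, Complex.ofReal_sin]

lemma E_add (θ θ' : ℝ) : E (θ + θ') = E θ * E θ' := by
  rw [E, E, E, ← Complex.exp_add]; push_cast; ring_nf

lemma E_zero : E 0 = 1 := by simp [E]

lemma conj_E (θ : ℝ) : conj (E θ) = E (-θ) := by
  rw [E, E, ← Complex.exp_conj]; simp

lemma E_mul_E_neg (θ : ℝ) : E θ * E (-θ) = 1 := by rw [← E_add, add_neg_cancel, E_zero]

/-- The point of the complex geodesic with coordinate `a * exp (i θ) / b` in the unit disc. -/
def disc (a θ b : ℝ) : V := ![0, a * E θ, b]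

lemma herm_disc (a θ b a' θ' b' : ℝ) :
    herm (disc a θ b) (disc a' θ' b') = a * a' * E (θ - θ') - b * b' := by
  simp [herm, disc, conj_E, sub_eq_add_neg, E_add]; ring

lemma herm_disc_e (a θ b : ℝ) : herm (disc a θ b) e = 0 := by simp [herm, disc, e]

/-- The argument of the vertex `q (6 + k)`. -/
def vertexAngle (k : ℕ) : ℝ := 2 * k * Real.pi / 5

/-- The vertices of the right-angled pentagon: `vertex k` stands for `q (6 + k)`. -/
def vertex (k : ℕ) : V := disc κ (vertexAngle k) (c + s)

lemma sc_ne : (s : ℂ) ≠ 0 ∧ ((c : ℂ) + s) ≠ 0 := by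
  have := s_pos
  have := c_pos
  constructor
  · exact_mod_cast s_pos.ne'
  · exact_mod_cast (add_pos c_pos s_pos).ne'

lemma κ_sq_complex : (κ : ℂ) ^ 2 = (c : ℂ) ^ 2 - (s : ℂ) ^ 2 := by exact_mod_cast κ_sq

lemma c_sq_add_s_sq_complex : (c : ℂ) ^ 2 + (s : ℂ) ^ 2 = 1 := by exact_mod_cast c_sq_add_s_sq

/-- The factor that makes the determinants of the matrices `A k` equal to `-1`. -/
def g₀ : ℝ := (√2 * s)⁻¹

lemma g₀_ne : (g₀ : ℂ) ≠ 0 := by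
  have := s_pos
  exact_mod_cast (by rw [g₀]; positivity : g₀ ≠ 0)

lemma two_s_sq_g₀_sq : 2 * (s : ℂ) ^ 2 * (g₀ : ℂ) ^ 2 = 1 := by
  have := s_pos
  have h2 := Real.sq_sqrt (show (0 : ℝ) ≤ 2 by norm_num)
  have : 2 * s ^ 2 * g₀ ^ 2 = 1 := by
    rw [g₀, inv_pow, mul_pow, h2]; field_simp
  exact_mod_cast this

lemma A_eq (k : Fin 5) : A k = g₀ • !![Real.sin (sideAngle k), Real.cos (sideAngle k) + κ;
    Real.cos (sideAngle k) - κ, -Real.sin (sideAngle k)] := by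
  rw [A, g₀]
  try rfl

lemma S_eq (k : Fin 5) (v : V) : S k v = ![conj (v 0),
    -Complex.I * g₀ * (E (sideAngle k) * conj (v 1) - κ * conj (v 2)),
    -Complex.I * g₀ * (κ * conj (v 1) - E (-sideAngle k) * conj (v 2))] := by
  ext i
  have hI := Complex.I_mul_I
  fin_cases i
  · simp [S]
  · simp [S, emb, crd, A_eq, mulVec, dotProduct, Fin.sum_univ_two, E_re_im, Complex.conj_ofNat]
    ring_nf
    simp only [Complex.I_sq]
    ring_nf
    try simp only [Complex.I_sq, Complex.I_pow_three]
    try ring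
  · simp [S, emb, crd, A_eq, mulVec, dotProduct, Fin.sum_univ_two, E_re_im, Complex.conj_ofNat]
    ring_nf
    simp only [Complex.I_sq]
    ring_nf
    try simp only [Complex.I_sq, Complex.I_pow_three]
    try ring

/-- A point at distance `π / 5` from the direction of the `k`-th side, in the position of a vertex
of the pentagon, is fixed by the reflection in this side. -/
lemma S_disc {k : Fin 5} {θ : ℝ} (hc : Real.cos (sideAngle k - θ) = c)
    (hs : Real.sin (sideAngle k - θ) ^ 2 = s ^ 2) :
    ∃ a : ℂ, a ≠ 0 ∧ S k (disc κ θ (c + s)) = a • disc κ θ (c + s) := by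
  obtain ⟨ε, hε, hεs⟩ : ∃ ε : ℝ, ε ^ 2 = 1 ∧ Real.sin (sideAngle k - θ) = ε * s := by
    rcases sq_eq_sq_iff_eq_or_eq_neg.1 hs with h | h
    · exact ⟨1, by norm_num, by rw [h, one_mul]⟩
    · exact ⟨-1, by norm_num, by rw [h, neg_one_mul]⟩
  have hE : E (sideAngle k - θ) = c + ε * s * Complex.I := by
    rw [E_re_im, hc, hεs]; push_cast; ring
  have hE1 : E (sideAngle k) = (c + ε * s * Complex.I) * E θ := by
    rw [← hE, ← E_add, sub_add_cancel]
  have hE2 : E (-sideAngle k) = (c - ε * s * Complex.I) * E (-θ) := by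
    rw [show -sideAngle k = -(sideAngle k - θ) + -θ by ring, E_add, ← conj_E, hE]
    simp [sub_eq_add_neg]
  have hθ := E_mul_E_neg θ
  have hκ := κ_sq_complex
  refine ⟨-Complex.I * g₀ * s * (ε * Complex.I - 1) * E (-θ), ?_, ?_⟩
  · have h1 : E (-θ) ≠ 0 := right_ne_zero_of_mul_eq_one hθ
    have h2 : ((ε : ℂ) * Complex.I - 1) ≠ 0 := fun h => by
      have := congrArg Complex.re h; simp at this
    simp only [mul_ne_zero_iff, neg_ne_zero]
    exact ⟨⟨⟨⟨Complex.I_ne_zero, g₀_ne⟩, sc_ne.1⟩, h2⟩, h1⟩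
  · rw [S_eq, hE1, hE2]
    ext i
    fin_cases i
    · simp [disc]
    · simp [disc, conj_E]
      linear_combination (Complex.I * g₀ * κ * (c + s)) * hθ
    · simp [disc, conj_E]
      linear_combination (Complex.I * g₀ * E (-θ)) * hκ

/-- The half-turn at a vertex of the pentagon, up to a factor the product of the reflections in the
two adjacent sides. -/
lemma Q_vertex {k l : Fin 5} {θ : ℝ} (hk : E (sideAngle k) = (c + s * Complex.I) * E θ)
    (hl : E (sideAngle l) = (c - s * Complex.I) * E θ) (x : ℂ) (u : Fin 2 → ℂ) :
    Q e (disc κ θ (c + s)) (emb x u) =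
      emb (-x) (Complex.I • ((A l * A k).map Complex.ofRealHom *ᵥ u)) := by
  have hSS : S l (S k (emb x u)) = emb x ((A l * A k).map Complex.ofRealHom *ᵥ u) := by
    rw [S_emb, S_emb, star_map_mulVec, star_star, mulVec_mulVec, ← Matrix.map_mul, Complex.conj_conj]
  have hR : emb (-x) (Complex.I • ((A l * A k).map Complex.ofRealHom *ᵥ u)) =
      ![-x, Complex.I * S l (S k (emb x u)) 1, Complex.I * S l (S k (emb x u)) 2] := by
    rw [hSS]
    ext i; fin_cases i <;> simp [emb] <;> ring
  rw [hR]
  generalize hv : emb x u = v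
  have hx : x = v 0 := by rw [← hv]; rfl
  have hk' : E (-sideAngle k) = (c - s * Complex.I) * E (-θ) := by
    rw [← conj_E, hk, map_mul, conj_E]; simp [sub_eq_add_neg]
  have hl' : E (-sideAngle l) = (c + s * Complex.I) * E (-θ) := by
    rw [← conj_E, hl, map_mul, conj_E]; simp
  have hθ := E_mul_E_neg θ
  have hκ := κ_sq_complex
  have hg := two_s_sq_g₀_sq
  obtain ⟨hs, hcs⟩ := sc_ne
  have hqq : herm (disc κ θ (c + s)) (disc κ θ (c + s)) = -2 * s * (c + s) := by
    rw [herm_disc, sub_self, E_zero]; push_cast; linear_combination hκ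
  have hvq : herm v (disc κ θ (c + s)) = v 1 * κ * E (-θ) - v 2 * (c + s) := by
    simp [herm, disc, conj_E]; ring
  have hve : herm v e = v 0 := by simp [herm, e]
  have hee : herm e e = 1 := by simp [herm, e]
  rw [S_eq l, S_eq k, hk, hl, hk', hl', Q, hqq, hvq, hve, hee, hx]
  obtain ⟨M, hM⟩ : ∃ M, M = 2 * ((v 1 * κ * E (-θ) - v 2 * (c + s)) / (-2 * s * (c + s))) := ⟨_, rfl⟩
  rw [← hM]
  have hM' : M * (s * (c + s)) = -(v 1 * κ * E (-θ) - v 2 * (c + s)) := by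
    rw [hM]; field_simp
  have hI := Complex.I_mul_I
  have hne := mul_ne_zero hs hcs
  ext i
  fin_cases i
  · change v 0 - M * 0 - 2 * (v 0 / 1) * 1 = -v 0
    ring
  · simp [disc, e, conj_E, vecHead, vecTail]
    refine mul_left_cancel₀ hne ?_
    linear_combination (-κ * E θ) * hM' + v 1 * κ ^ 2 * hθ + v 1 * hκ
      - s * (c + s) * Complex.I * g₀ ^ 2 * (c - s * Complex.I) ^ 2 * v 1 * hθ
      + s * (c + s) * Complex.I * g₀ ^ 2 * v 1 * hκ
      + (c + s) * (κ * E θ * v 2 - c * v 1) * hg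
      + s * (c + s) * g₀ ^ 2 * (2 * c * s * v 1 - Complex.I * s ^ 2 * v 1
        - 2 * s * κ * E θ * v 2) * hI
      + s * (c + s) * g₀ ^ 2 * Complex.I * (((c - s * Complex.I) ^ 2 * E θ * E (-θ) - κ ^ 2) * v 1
        + 2 * s * Complex.I * κ * E θ * v 2) * hI
  · simp [disc, e, conj_E, vecHead, vecTail]
    refine mul_left_cancel₀ hne ?_
    linear_combination (-(c + s) : ℂ) * hM'
      - s * (c + s) * Complex.I * g₀ ^ 2 * (c + s * Complex.I) ^ 2 * v 2 * hθ
      + s * (c + s) * Complex.I * g₀ ^ 2 * v 2 * hκ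
      + (c + s) * (c * v 2 - κ * E (-θ) * v 1) * hg
      + s * (c + s) * g₀ ^ 2 * (-2 * c * s * v 2 - Complex.I * s ^ 2 * v 2
        + 2 * s * κ * E (-θ) * v 1) * hI
      + s * (c + s) * g₀ ^ 2 * Complex.I * (((c + s * Complex.I) ^ 2 * E θ * E (-θ) - κ ^ 2) * v 2
        - 2 * s * Complex.I * κ * E (-θ) * v 1) * hI

end
end PentagonGroup

namespace PentagonGroup

open Matrix ComplexHyperbolic
noncomputable section

/-! ### The configuration of four pentagons -/

lemma re_ofReal_add_ofReal_mul_I (x y : ℝ) : ((x : ℂ) + y * Complex.I).re = x := by simp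

lemma herm_direction {a : V} (ha : herm a a ≠ 0) (b d : V) :
    herm (direction a b) (direction a d) =
      herm a b * herm d a * (herm b d - herm b a * herm a d / herm a a) := by
  rw [direction, direction, herm_smul_left, herm_smul_right, herm_sub_left, herm_sub_right,
    herm_sub_right, herm_smul_left, herm_smul_left, herm_smul_right, herm_smul_right, map_neg,
    herm_conj, map_div₀, herm_conj, herm_conj]
  field_simp
  ring

lemma angle_eq_pi_div_five {a b d : V} {x y : ℝ} (hx : 0 < x) (hy : 0 < y)
    (hb : (herm (direction a b) (direction a b)).re = x ^ 2)
    (hd : (herm (direction a d) (direction a d)).re = y ^ 2)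
    (h : (herm (direction a b) (direction a d)).re = c * (x * y)) :
    angle a b d = Real.pi / 5 := by
  rw [angle, hb, hd, h, Real.sqrt_sq hx.le, Real.sqrt_sq hy.le,
    mul_div_cancel_right₀ _ (mul_pos hx hy).ne', c,
    Real.arccos_cos (by positivity) (by linarith [Real.pi_pos])]

/-- The products of a centre, an endpoint and a midpoint of a side of the pentagon with angles `2π / 5`
determine the angles of their triangle. The sign `ε` is the orientation of the triangle. -/
lemma isPentagonTriangle_of {C P M : V} {ε : ℝ} (hε : ε ^ 2 = 1) (hCC : herm C C = -1)
    (hPP : herm P P = -2 * s ^ 2) (hMM : herm M M = -2 * s * (c + s)) (hCP : herm C P = -1)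
    (hCM : herm C M = -(c + s))
    (hPM : herm P M = -(s * (c + s)) * ((c + s) + ε * (c - s) * Complex.I)) :
    IsPentagonTriangle C P M := by
  have hs := s_pos
  have hc := c_pos
  have hκ := κ_pos
  have hκ2 := κ_sq
  have h1 := c_sq_add_s_sq
  have hs' := sc_ne.1
  have hcs := sc_ne.2
  have hPC : herm P C = -1 := by rw [← herm_conj, hCP]; simp
  have hMC : herm M C = -(c + s) := by rw [← herm_conj, hCM]; simp
  have hMP : herm M P = -(s * (c + s)) * ((c + s) - ε * (c - s) * Complex.I) := by
    rw [← herm_conj, hPM]; simp [sub_eq_add_neg]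
  have h2 := Real.sq_sqrt (show (0 : ℝ) ≤ 2 by norm_num)
  have hg : 2 * s ^ 2 * g₀ ^ 2 = 1 := by exact_mod_cast two_s_sq_g₀_sq
  have hg1 : g₀ * (√2 * s) = 1 := inv_mul_cancel₀ (by positivity)
  have hI := Complex.I_mul_I
  have hε' : (ε : ℂ) ^ 2 = 1 := by exact_mod_cast hε
  have h1' := c_sq_add_s_sq_complex
  have hz : herm P M * herm M P = 2 * s ^ 2 * (c + s) ^ 2 := by
    rw [hPM, hMP]
    linear_combination ((s : ℂ) ^ 2 * (c + s) ^ 2) * (-(ε : ℂ) ^ 2 * (c - s) ^ 2 * hI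
      + (c - s) ^ 2 * hε' + 2 * h1')
  have hCC0 : herm C C ≠ 0 := by rw [hCC]; norm_num
  have hPP0 : herm P P ≠ 0 := by rw [hPP]; simp [hs']
  have hMM0 : herm M M ≠ 0 := by rw [hMM]; simp [hs', hcs]
  refine ⟨angle_eq_pi_div_five (x := κ) (y := (c + s) * κ) hκ (by positivity) ?_ ?_ ?_,
    angle_eq_pi_div_five (x := κ * g₀) (y := √2 * s * ((c + s) * κ)) ?_ (by positivity) ?_ ?_ ?_, ?_⟩
  · rw [herm_direction hCC0, hCP, hPC, hPP, hCC]
    have : (-1 * -1 * (-2 * (s : ℂ) ^ 2 - -1 * -1 / -1) : ℂ) = ((1 - 2 * s ^ 2 : ℝ) : ℂ) := by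
      push_cast; ring
    rw [this, Complex.ofReal_re]
    linear_combination -hκ2 - h1
  · rw [herm_direction hCC0, hCM, hMC, hMM, hCC]
    have : (-((c : ℂ) + s) * -(c + s) * (-2 * s * (c + s) - -(c + s) * -(c + s) / -1) : ℂ) =
        (((c + s) ^ 3 * (c - s) : ℝ) : ℂ) := by
      push_cast; ring
    rw [this, Complex.ofReal_re]
    linear_combination -(c + s) ^ 2 * hκ2
  · rw [herm_direction hCC0, hCP, hMC, hPM, hPC, hCM, hCC]
    have : (-1 * -((c : ℂ) + s) * (-(s * (c + s)) * (c + s + ε * (c - s) * Complex.I) -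
        -1 * -(c + s) / -1) : ℂ) = (((c + s) ^ 2 * (1 - s * (c + s)) : ℝ) : ℂ)
          + ((-(s * (c + s) ^ 2) * ε * (c - s) : ℝ) : ℂ) * Complex.I := by
      push_cast; ring
    rw [this, re_ofReal_add_ofReal_mul_I]
    linear_combination -c * (c + s) * hκ2 - (c + s) ^ 2 * h1
  · have : (0 : ℝ) < g₀ := by rw [g₀]; positivity
    positivity
  · rw [herm_direction hPP0, hCP, hPC, hPP, hCC]
    have : (-1 * -1 * (-1 - -1 * -1 / (-2 * (s : ℂ) ^ 2)) : ℂ) = ((g₀ ^ 2 - 1 : ℝ) : ℂ) := by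
      have hg' : (g₀ : ℂ) ^ 2 = 1 / (2 * (s : ℂ) ^ 2) := by
        rw [eq_div_iff (by simp [hs'])]; linear_combination two_s_sq_g₀_sq
      push_cast
      rw [hg']; field_simp; ring
    rw [this, Complex.ofReal_re]
    linear_combination -g₀ ^ 2 * hκ2 - g₀ ^ 2 * h1 + hg
  · rw [herm_direction hPP0, hz, mul_comm (herm M P), hz, hMM, hPP]
    have : (2 * (s : ℂ) ^ 2 * (c + s) ^ 2 * (-2 * s * (c + s) -
        2 * s ^ 2 * (c + s) ^ 2 / (-2 * s ^ 2)) : ℂ) =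
        ((2 * s ^ 2 * (c + s) ^ 3 * (c - s) : ℝ) : ℂ) := by
      push_cast; field_simp; ring
    rw [this, Complex.ofReal_re]
    linear_combination -(2 * s ^ 2 * (c + s) ^ 2) * hκ2 - s ^ 2 * (c + s) ^ 2 * κ ^ 2 * h2
  · rw [herm_direction hPP0, hPC, hCM, hCP, hPP]
    have : (-1 * herm M P * (-(c + s) - -1 * herm P M / (-2 * (s : ℂ) ^ 2)) : ℂ) =
        (((c + s) ^ 2 * (1 - s * (c + s)) : ℝ) : ℂ)
          + ((s * (c + s) ^ 2 * ε * (c - s) : ℝ) : ℂ) * Complex.I := by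
      have : (-1 * herm M P * (-(c + s) - -1 * herm P M / (-2 * (s : ℂ) ^ 2)) : ℂ) =
        (c + s) * herm M P + (herm P M * herm M P) / (2 * s ^ 2) := by field_simp; ring
      rw [this, hz, hMP]
      push_cast; field_simp; ring
    rw [this, re_ofReal_add_ofReal_mul_I]
    linear_combination -c * (c + s) * hκ2 - (c + s) ^ 2 * h1 - c * (c + s) * κ ^ 2 * hg1
  · rw [angle, herm_direction hMM0 C P, hMC, hCP, hCM, hMM]
    have : (-(c + s) * herm P M * (-1 - -(c + s) * herm M P / (-2 * (s : ℂ) * (c + s))) : ℂ) =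
        ((0 : ℝ) : ℂ) + ((-(s * (c + s) ^ 2) * ε * (c - s) : ℝ) : ℂ) * Complex.I := by
      have : (-(c + s) * herm P M * (-1 - -(c + s) * herm M P / (-2 * (s : ℂ) * (c + s))) : ℂ) =
        (c + s) * herm P M + (c + s) * (herm P M * herm M P) / (2 * s) := by field_simp; ring
      rw [this, hz, hPM]
      push_cast; field_simp; ring
    rw [this, re_ofReal_add_ofReal_mul_I, zero_div, Real.arccos_zero]

/-- The endpoints of the sides of the pentagon with angles `2π / 5`: `corner k` stands for
`p (5 + k)`. -/
def corner (k : ℕ) : V := disc κ ((2 * k - 1) * Real.pi / 5) 1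

/-- The centre of the pentagon. -/
def centre : V := disc 0 0 1

lemma E_pi_div_five : E (Real.pi / 5) = c + s * Complex.I := by rw [E_re_im]; rfl

lemma E_neg_pi_div_five : E (-(Real.pi / 5)) = c - s * Complex.I := by
  rw [← conj_E, E_pi_div_five]; simp [sub_eq_add_neg]

lemma E_add_int_mul_two_pi (θ : ℝ) (n : ℤ) : E (θ + n * (2 * Real.pi)) = E θ := by
  rw [E_re_im, E_re_im, Real.cos_add_int_mul_two_pi, Real.sin_add_int_mul_two_pi]

lemma herm_corner_vertex (k : ℕ) :
    herm (corner k) (vertex k) = -(s * (c + s)) * ((c + s) + (c - s) * Complex.I) := by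
  have h : (2 * k - 1) * Real.pi / 5 - vertexAngle k = -(Real.pi / 5) := by
    rw [vertexAngle]; ring
  rw [corner, vertex, herm_disc, h, E_neg_pi_div_five]
  push_cast
  linear_combination (c - s * Complex.I) * κ_sq_complex + (c + s) * c_sq_add_s_sq_complex

lemma herm_corner_succ_vertex (k : ℕ) :
    herm (corner ((k + 1) % 5)) (vertex k) =
      -(s * (c + s)) * ((c + s) - (c - s) * Complex.I) := by
  have h : E ((2 * ((k + 1) % 5 : ℕ) - 1) * Real.pi / 5 - vertexAngle k) = E (Real.pi / 5) := by
    have h5 : ((k + 1 : ℕ) : ℝ) = 5 * ((k + 1) / 5 : ℕ) + ((k + 1) % 5 : ℕ) := by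
      exact_mod_cast (Nat.div_add_mod (k + 1) 5).symm
    generalize (k + 1) / 5 = m at h5
    rw [← E_add_int_mul_two_pi (Real.pi / 5) (-m), vertexAngle]
    congr 1
    push_cast at h5 ⊢
    linear_combination (-2 * Real.pi / 5) * h5
  rw [corner, vertex, herm_disc, h, E_pi_div_five]
  push_cast
  linear_combination (c + s * Complex.I) * κ_sq_complex + (c + s) * c_sq_add_s_sq_complex

lemma herm_centre_centre : herm centre centre = -1 := by
  simp [centre, herm, disc]

lemma herm_corner_corner (k : ℕ) : herm (corner k) (corner k) = -2 * s ^ 2 := by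
  rw [corner, herm_disc, sub_self, E_zero]
  push_cast
  linear_combination κ_sq_complex + c_sq_add_s_sq_complex

lemma herm_vertex_vertex (k : ℕ) : herm (vertex k) (vertex k) = -2 * s * (c + s) := by
  rw [vertex, herm_disc, sub_self, E_zero]; push_cast; linear_combination κ_sq_complex

lemma herm_centre_corner (k : ℕ) : herm centre (corner k) = -1 := by
  simp [centre, corner, herm_disc]

lemma herm_centre_vertex (k : ℕ) : herm centre (vertex k) = -(c + s) := by
  simp [centre, vertex, herm_disc]

lemma isPentagonTriangle (k : ℕ) : IsPentagonTriangle centre (corner k) (vertex k) :=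
  isPentagonTriangle_of (ε := 1) (by norm_num) herm_centre_centre (herm_corner_corner k)
    (herm_vertex_vertex k) (herm_centre_corner k) (herm_centre_vertex k)
    (by rw [herm_corner_vertex]; simp)

lemma isPentagonTriangle_succ (k : ℕ) :
    IsPentagonTriangle centre (corner ((k + 1) % 5)) (vertex k) :=
  isPentagonTriangle_of (ε := -1) (by norm_num) herm_centre_centre (herm_corner_corner _)
    (herm_vertex_vertex k) (herm_centre_corner _) (herm_centre_vertex k)
    (by rw [herm_corner_succ_vertex]; push_cast; ring)

lemma oppositeSides_vertex (k : ℕ) :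
    OppositeSides centre (vertex k) (corner k) (corner ((k + 1) % 5)) := by
  have h : 0 < (c + s) * (s * (c + s) * (c - s)) :=
    mul_pos (add_pos c_pos s_pos) (mul_pos (mul_pos s_pos (add_pos c_pos s_pos))
      (sub_pos.2 s_lt_c))
  have hMC : herm (vertex k) centre = -(c + s) := by
    rw [← herm_conj, herm_centre_vertex]; simp
  have h1 : side centre (vertex k) (corner k) = -((c + s) * (s * (c + s) * (c - s))) := by
    rw [side, herm_centre_corner, herm_corner_vertex, hMC]; simp; ring
  have h2 : side centre (vertex k) (corner ((k + 1) % 5)) = (c + s) * (s * (c + s) * (c - s)) := by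
    rw [side, herm_centre_corner, herm_corner_succ_vertex, hMC]; simp; ring
  rw [OppositeSides, h1, h2]
  nlinarith

lemma oppositeSides_corner (k : ℕ) :
    OppositeSides centre (corner ((k + 1) % 5)) (vertex k) (vertex ((k + 1) % 5)) := by
  have h : 0 < (c + s) * (s * (c + s) * (c - s)) :=
    mul_pos (add_pos c_pos s_pos) (mul_pos (mul_pos s_pos (add_pos c_pos s_pos))
      (sub_pos.2 s_lt_c))
  have hPC (k) : herm (corner k) centre = -1 := by
    rw [← herm_conj, herm_centre_corner]; simp
  have h1 : side centre (corner ((k + 1) % 5)) (vertex k) =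
      -((c + s) * (s * (c + s) * (c - s))) := by
    rw [side, herm_centre_vertex, ← herm_conj, herm_corner_succ_vertex, hPC]; simp; ring
  have h2 : side centre (corner ((k + 1) % 5)) (vertex ((k + 1) % 5)) =
      (c + s) * (s * (c + s) * (c - s)) := by
    rw [side, herm_centre_vertex, ← herm_conj, herm_corner_vertex, hPC]; simp; ring
  rw [OppositeSides, h1, h2]
  nlinarith

lemma side_S (k : Fin 5) (a b x : V) : side (S k a) (S k b) (S k x) = -side a b x := by
  rw [side, herm_S, herm_S, herm_S, ← map_mul, ← map_mul, Complex.conj_im, side]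

lemma side_smul (α β : ℂ) (a b x : V) :
    side (α • a) (β • b) x = Complex.normSq α * Complex.normSq β * side a b x := by
  have : herm (α • a) x * herm x (β • b) * herm (β • b) (α • a) =
      ((Complex.normSq α * Complex.normSq β : ℝ) : ℂ) * (herm a x * herm x b * herm b a) := by
    rw [herm_smul_left, herm_smul_right, herm_smul_left, herm_smul_right, Complex.ofReal_mul,
      Complex.normSq_eq_conj_mul_self, Complex.normSq_eq_conj_mul_self]
    ring
  rw [side, this, Complex.im_ofReal_mul, side]

lemma oppositeSides_S {a b x y : V} (k : Fin 5) (h : OppositeSides a b x y) :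
    OppositeSides (S k a) (S k b) (S k x) (S k y) := by
  rw [OppositeSides, side_S, side_S, neg_mul_neg]; exact h

/-- The reflection in a side moves the points on one side of it to the other side. -/
lemma oppositeSides_reflection {a b x y : V} {k : Fin 5} {α β : ℂ} (hα : α ≠ 0) (hβ : β ≠ 0)
    (ha : S k a = α • a) (hb : S k b = β • b) (hx : 0 < side a b x) (hy : 0 < side a b y) :
    OppositeSides a b x (S k y) := by
  have h1 := Complex.normSq_pos.2 hα
  have h2 := Complex.normSq_pos.2 hβ
  have h3 : Complex.normSq α * Complex.normSq β * side a b (S k y) = -side a b y := by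
    rw [← side_smul, ← ha, ← hb, side_S]
  have h4 : side a b (S k y) < 0 := by
    by_contra! h
    have := mul_nonneg (mul_pos h1 h2).le h
    linarith
  exact mul_neg_of_pos_of_neg hx h4

lemma side_vertex (i j k : ℕ) :
    side (vertex i) (vertex j) (vertex k) = (κ ^ 2) * (c + s) ^ 2 * (κ ^ 2 + (c + s) ^ 2) *
      (Real.sin (vertexAngle i - vertexAngle k) + Real.sin (vertexAngle k - vertexAngle j) +
        Real.sin (vertexAngle j - vertexAngle i)) := by
  have h3 : vertexAngle j - vertexAngle i =
    -((vertexAngle i - vertexAngle k) + (vertexAngle k - vertexAngle j)) := by ring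
  rw [side, vertex, vertex, vertex, herm_disc, herm_disc, herm_disc, h3]
  generalize vertexAngle i - vertexAngle k = α
  generalize vertexAngle k - vertexAngle j = β
  rw [E_re_im, E_re_im, E_re_im, Real.cos_neg, Real.sin_neg]
  have h1 := Real.sin_sq_add_cos_sq α
  have h2 := Real.sin_sq_add_cos_sq β
  rw [Real.sin_add, Real.cos_add]
  generalize Real.sin α = x at *
  generalize Real.sin β = y at *
  generalize Real.cos α = z at *
  generalize Real.cos β = w at *
  simp
  linear_combination (κ ^ 4 * (c + s) ^ 2) * (y * h1 + x * h2)

lemma herm_vertex (i j : ℕ) : herm (vertex i) (vertex j) =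
    κ ^ 2 * E (vertexAngle i - vertexAngle j) - (c + s) ^ 2 := by
  rw [vertex, vertex, herm_disc]; push_cast; ring

lemma hdist_vertex {i j i' j' : ℕ} (h : Real.cos (vertexAngle i - vertexAngle j) =
    Real.cos (vertexAngle i' - vertexAngle j')) :
    hdist (vertex i) (vertex j) = hdist (vertex i') (vertex j') := by
  have key (i j : ℕ) : herm (vertex i) (vertex j) * herm (vertex j) (vertex i) =
      ((κ ^ 4 - 2 * κ ^ 2 * (c + s) ^ 2 * Real.cos (vertexAngle i - vertexAngle j)
        + (c + s) ^ 4 : ℝ) : ℂ) := by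
    have h1 := Real.sin_sq_add_cos_sq (vertexAngle i - vertexAngle j)
    rw [herm_vertex, herm_vertex, ← neg_sub (vertexAngle i), E_re_im, E_re_im,
      Real.cos_neg, Real.sin_neg]
    have h1' : ((Real.sin (vertexAngle i - vertexAngle j) : ℝ) : ℂ) ^ 2 +
      ((Real.cos (vertexAngle i - vertexAngle j) : ℝ) : ℂ) ^ 2 = 1 := by exact_mod_cast h1
    simp only [Complex.ofReal_add, Complex.ofReal_sub, Complex.ofReal_mul, Complex.ofReal_pow,
      Complex.ofReal_neg, Complex.ofReal_ofNat]
    linear_combination (κ : ℂ) ^ 4 * h1' - (κ : ℂ) ^ 4 *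
      ((Real.sin (vertexAngle i - vertexAngle j) : ℝ) : ℂ) ^ 2 * Complex.I_mul_I
  simp only [hdist, key, herm_vertex_vertex, h]

lemma hdist_S (k : Fin 5) (v w : V) : hdist (S k v) (S k w) = hdist v w := by
  simp only [hdist, herm_S, ← map_mul, Complex.conj_re]

lemma hdist_smul {α β : ℂ} (hα : α ≠ 0) (hβ : β ≠ 0) (v w : V) :
    hdist (α • v) (β • w) = hdist v w := by
  have h1 : herm (α • v) (β • w) * herm (β • w) (α • v) =
      ((Complex.normSq α * Complex.normSq β : ℝ) : ℂ) * (herm v w * herm w v) := by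
    rw [herm_smul_left, herm_smul_right, herm_smul_left, herm_smul_right, Complex.ofReal_mul,
      Complex.normSq_eq_conj_mul_self, Complex.normSq_eq_conj_mul_self]
    ring
  have h2 (α : ℂ) (v : V) : (herm (α • v) (α • v)).re = Complex.normSq α * (herm v v).re := by
    rw [herm_smul_left, herm_smul_right, ← mul_assoc, mul_comm α,
      ← Complex.normSq_eq_conj_mul_self, Complex.re_ofReal_mul]
  have h3 := (Complex.normSq_pos.2 hα).ne'
  have h4 := (Complex.normSq_pos.2 hβ).ne'
  rw [hdist, h1, h2, h2, Complex.re_ofReal_mul, hdist]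
  congr 3
  rw [mul_mul_mul_comm, mul_div_mul_left _ _ (mul_ne_zero h3 h4)]

/-- A pentagon is congruent to the right-angled one if, up to scalar factors, its vertices are the
images of the vertices of the latter, in an order that does not change the distances, under an isometry. -/
lemma congruentPentagons {P : Fin 5 → V} {F : V → V} (hF : ∀ v w, hdist (F v) (F w) = hdist v w)
    (τ : Fin 5 → ℕ) (hP : ∀ i, ∃ α : ℂ, α ≠ 0 ∧ α • P i = F (vertex (τ i)))
    (hτ : ∀ i j : Fin 5, Real.cos (vertexAngle i - vertexAngle j) =
      Real.cos (vertexAngle (τ i) - vertexAngle (τ j))) :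
    CongruentPentagons ![vertex 0, vertex 1, vertex 2, vertex 3, vertex 4] P := by
  intro i j
  have h (i : Fin 5) : ![vertex 0, vertex 1, vertex 2, vertex 3, vertex 4] i = vertex i := by
    fin_cases i <;> rfl
  obtain ⟨α, hα, h1⟩ := hP i
  obtain ⟨β, hβ, h2⟩ := hP j
  rw [h, h, hdist_vertex (hτ i j), ← hF, ← h1, ← h2, hdist_smul hα hβ]

/-- Reversing the cyclic order of the vertices preserves the differences of their arguments up to sign. -/
lemma cos_vertexAngle_reflect {τ : Fin 5 → ℕ} {m : ℕ} (h : ∀ i, (τ i + i) % 5 = m) (i j : Fin 5) :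
    Real.cos (vertexAngle i - vertexAngle j) =
      Real.cos (vertexAngle (τ i) - vertexAngle (τ j)) := by
  have h5 (i : Fin 5) : ((τ i : ℕ) : ℝ) + i = 5 * ((τ i + i) / 5 : ℕ) + m := by
    rw [← h i]; exact_mod_cast (Nat.div_add_mod (τ i + i) 5).symm
  have hi := h5 i
  have hj := h5 j
  generalize (τ i + i) / 5 = m at hi
  generalize (τ j + j) / 5 = n at hj
  rw [← Real.cos_neg, ← Real.cos_add_int_mul_two_pi _ (m - n)]
  congr 1
  rw [vertexAngle, vertexAngle, vertexAngle, vertexAngle]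
  push_cast
  linear_combination (-2 * Real.pi / 5) * (hi - hj)

lemma cos_vertexAngle_sub_sideAngle {k : Fin 5} {i : ℕ} (h : i = k ∨ i = k + 1) :
    Real.cos (sideAngle k - vertexAngle i) = c ∧ Real.sin (sideAngle k - vertexAngle i) ^ 2 = s ^ 2 := by
  rcases h with rfl | rfl
  · rw [show sideAngle k - vertexAngle k = Real.pi / 5 by rw [sideAngle, vertexAngle]; ring]
    exact ⟨rfl, rfl⟩
  · rw [show sideAngle k - vertexAngle (k + 1) = -(Real.pi / 5) by
      rw [sideAngle, vertexAngle]; push_cast; ring, Real.cos_neg, Real.sin_neg, neg_sq]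
    exact ⟨rfl, rfl⟩

/-- The reflection in a side of the pentagon fixes its two endpoints. -/
lemma S_vertex {k : Fin 5} {i : ℕ} (h : i = k ∨ i = k + 1) :
    ∃ a : ℂ, a ≠ 0 ∧ S k (vertex i) = a • vertex i :=
  S_disc (cos_vertexAngle_sub_sideAngle h).1 (cos_vertexAngle_sub_sideAngle h).2

lemma sin_two_pi_div_five : Real.sin (2 * Real.pi / 5) = 2 * s * c := by
  rw [show 2 * Real.pi / 5 = 2 * (Real.pi / 5) by ring, Real.sin_two_mul]; rfl

lemma sin_four_pi_div_five : Real.sin (4 * Real.pi / 5) = s := by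
  rw [show 4 * Real.pi / 5 = Real.pi - Real.pi / 5 by ring, Real.sin_pi_sub]; rfl

lemma sin_six_pi_div_five : Real.sin (6 * Real.pi / 5) = -s := by
  rw [show 6 * Real.pi / 5 = Real.pi / 5 + Real.pi by ring, Real.sin_add_pi]; rfl

lemma sin_eight_pi_div_five : Real.sin (8 * Real.pi / 5) = -(2 * s * c) := by
  rw [← sin_two_pi_div_five, show 8 * Real.pi / 5 = 2 * Real.pi - 2 * Real.pi / 5 by ring,
    Real.sin_two_pi_sub]

lemma side_vertex_pos {i j k : ℕ} (h : 0 < Real.sin (vertexAngle i - vertexAngle k) +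
      Real.sin (vertexAngle k - vertexAngle j) + Real.sin (vertexAngle j - vertexAngle i)) :
    0 < side (vertex i) (vertex j) (vertex k) := by
  have := κ_pos
  have := c_pos
  have := s_pos
  rw [side_vertex]
  positivity

lemma side_vertex_three_four_zero : 0 < side (vertex 3) (vertex 4) (vertex 0) := by
  apply side_vertex_pos
  have h1 : vertexAngle 3 - vertexAngle 0 = 6 * Real.pi / 5 := by simp [vertexAngle]; ring
  have h2 : vertexAngle 0 - vertexAngle 4 = -(8 * Real.pi / 5) := by simp [vertexAngle]; ring
  have h3 : vertexAngle 4 - vertexAngle 3 = 2 * Real.pi / 5 := by simp [vertexAngle]; ring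
  rw [h1, h2, h3, Real.sin_neg, sin_six_pi_div_five, sin_eight_pi_div_five, sin_two_pi_div_five]
  nlinarith [s_pos, c_gt]

lemma side_vertex_three_four_one : 0 < side (vertex 3) (vertex 4) (vertex 1) := by
  apply side_vertex_pos
  have h1 : vertexAngle 3 - vertexAngle 1 = 4 * Real.pi / 5 := by simp [vertexAngle]; ring
  have h2 : vertexAngle 1 - vertexAngle 4 = -(6 * Real.pi / 5) := by simp [vertexAngle]; ring
  have h3 : vertexAngle 4 - vertexAngle 3 = 2 * Real.pi / 5 := by simp [vertexAngle]; ring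
  rw [h1, h2, h3, Real.sin_neg, sin_six_pi_div_five, sin_four_pi_div_five, sin_two_pi_div_five]
  nlinarith [s_pos, c_gt]

lemma side_vertex_one_two_zero : 0 < side (vertex 1) (vertex 2) (vertex 0) := by
  apply side_vertex_pos
  have h1 : vertexAngle 1 - vertexAngle 0 = 2 * Real.pi / 5 := by simp [vertexAngle]
  have h2 : vertexAngle 0 - vertexAngle 2 = -(4 * Real.pi / 5) := by simp [vertexAngle]; ring
  have h3 : vertexAngle 2 - vertexAngle 1 = 2 * Real.pi / 5 := by simp [vertexAngle]; ring
  rw [h1, h2, h3, Real.sin_neg, sin_four_pi_div_five, sin_two_pi_div_five]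
  nlinarith [s_pos, c_gt]

/-- The point `q n`. -/
def centrePoint : ℕ → V
  | 1 => S 3 (S 1 (S 3 (vertex 2)))
  | 2 => S 3 (S 1 (S 3 (vertex 1)))
  | 3 => S 3 (S 1 (S 3 (vertex 0)))
  | 4 => S 3 (S 1 (vertex 0))
  | 5 => S 3 (vertex 0)
  | 11 => S 3 (vertex 1)
  | 12 => S 3 (vertex 2)
  | 13 => S 3 (S 1 (vertex 3))
  | 14 => S 3 (S 1 (vertex 4))
  | n => vertex (n - 6)

lemma centrePoint_six_add {k : ℕ} (hk : k < 5) : centrePoint (6 + k) = vertex k := by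
  interval_cases k <;> rfl

/-- The vectors orthogonal to `e` that are negative. -/
def IsPoint (v : V) : Prop := herm v e = 0 ∧ IsNegative v

lemma isPoint_S {v : V} (k : Fin 5) (h : IsPoint v) : IsPoint (S k v) := by
  refine ⟨?_, ?_⟩
  · rw [← S_e k, herm_S, h.1, map_zero]
  · rw [IsNegative, herm_S, Complex.conj_re]; exact h.2

lemma isPoint_vertex (k : ℕ) : IsPoint (vertex k) := by
  refine ⟨herm_disc_e _ _ _, ?_⟩
  have : herm (vertex k) (vertex k) = ((-2 * s * (c + s) : ℝ) : ℂ) := by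
    rw [herm_vertex_vertex]; push_cast; ring
  rw [IsNegative, this, Complex.ofReal_re]
  nlinarith [s_pos, c_pos]

lemma isPoint_corner (k : ℕ) : IsPoint (corner k) := by
  refine ⟨herm_disc_e _ _ _, ?_⟩
  have : herm (corner k) (corner k) = ((-2 * s ^ 2 : ℝ) : ℂ) := by
    rw [herm_corner_corner]; push_cast; ring
  rw [IsNegative, this, Complex.ofReal_re]
  nlinarith [s_pos]

lemma isPoint_centre : IsPoint centre := by
  refine ⟨herm_disc_e _ _ _, ?_⟩
  rw [IsNegative, herm_centre_centre]; simp

lemma isPoint_centrePoint (n : ℕ) : IsPoint (centrePoint n) := by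
  unfold centrePoint
  split <;> repeat' first | with_reducible exact isPoint_vertex _ | with_reducible apply isPoint_S

/-- The configuration of four right-angled pentagons. Each of them is the image of the preceding one
under the reflection in their common side. -/
def configuration : PentagonConfiguration where
  e := e
  c := centre
  p i := corner (i - 5)
  q := centrePoint
  e_pos := by simp [herm, e]
  c_mem := isPoint_centre
  p_mem i _ := isPoint_corner _
  q_mem i _ := isPoint_centrePoint _
  triangle k hk := by
    rw [centrePoint_six_add hk, Nat.add_sub_cancel_left]; exact isPentagonTriangle k
  triangle' k hk := by
    rw [centrePoint_six_add hk, Nat.add_sub_cancel_left]; exact isPentagonTriangle_succ k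
  opposite k hk := by
    rw [centrePoint_six_add hk, Nat.add_sub_cancel_left, Nat.add_sub_cancel_left]
    exact oppositeSides_vertex k
  opposite' k hk := by
    rw [centrePoint_six_add hk, centrePoint_six_add (Nat.mod_lt _ (by norm_num)),
      Nat.add_sub_cancel_left]
    exact oppositeSides_corner k
  copy₂ := by
    obtain ⟨a, ha, ha'⟩ := S_vertex (k := 3) (i := 3) (Or.inl rfl)
    obtain ⟨b, hb, hb'⟩ := S_vertex (k := 3) (i := 4) (Or.inr rfl)
    refine congruentPentagons (F := S 3) (hdist_S 3) ![0, 4, 3, 2, 1] (fun i => ?_)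
      (cos_vertexAngle_reflect (m := 0) (by decide))
    fin_cases i
    exacts [⟨1, one_ne_zero, one_smul _ _⟩, ⟨b, hb, hb'.symm⟩, ⟨a, ha, ha'.symm⟩,
      ⟨1, one_ne_zero, one_smul _ _⟩, ⟨1, one_ne_zero, one_smul _ _⟩]
  copy₃ := by
    obtain ⟨a, ha, ha'⟩ := S_vertex (k := 1) (i := 1) (Or.inl rfl)
    obtain ⟨b, hb, hb'⟩ := S_vertex (k := 1) (i := 2) (Or.inr rfl)
    have hne {a : ℂ} (ha : a ≠ 0) : conj a ≠ 0 := by simpa using ha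
    refine congruentPentagons (F := S 3 ∘ S 1) (fun v w => ?_) ![0, 1, 2, 3, 4] (fun i => ?_)
      (fun i j => ?_)
    · rw [Function.comp, Function.comp, hdist_S, hdist_S]
    · fin_cases i
      exacts [⟨1, one_ne_zero, one_smul _ _⟩,
        ⟨_, hne ha, by rw [Function.comp]; exact (S_smul 3 a _).symm.trans (congrArg _ ha'.symm)⟩,
        ⟨_, hne hb, by rw [Function.comp]; exact (S_smul 3 b _).symm.trans (congrArg _ hb'.symm)⟩,
        ⟨1, one_ne_zero, one_smul _ _⟩, ⟨1, one_ne_zero, one_smul _ _⟩]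
    · fin_cases i <;> fin_cases j <;> rfl
  copy₄ := by
    obtain ⟨a, ha, ha'⟩ := S_vertex (k := 3) (i := 3) (Or.inl rfl)
    obtain ⟨b, hb, hb'⟩ := S_vertex (k := 3) (i := 4) (Or.inr rfl)
    refine congruentPentagons (F := S 3 ∘ S 1 ∘ S 3) (fun v w => ?_) ![2, 1, 0, 4, 3] (fun i => ?_)
      (cos_vertexAngle_reflect (m := 2) (by decide))
    · simp only [Function.comp, hdist_S]
    · have h {a : ℂ} {v : V} (h : S 3 v = a • v) : a • S 3 (S 1 v) = S 3 (S 1 (S 3 v)) := by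
        rw [h, S_smul, S_smul, Complex.conj_conj]
      fin_cases i
      exacts [⟨1, one_ne_zero, one_smul _ _⟩, ⟨1, one_ne_zero, one_smul _ _⟩,
        ⟨1, one_ne_zero, one_smul _ _⟩, ⟨b, hb, h hb'⟩, ⟨a, ha, h ha'⟩]
  opposite₁₂ := by
    obtain ⟨a, ha, ha'⟩ := S_vertex (k := 3) (i := 3) (Or.inl rfl)
    obtain ⟨b, hb, hb'⟩ := S_vertex (k := 3) (i := 4) (Or.inr rfl)
    exact oppositeSides_reflection ha hb ha' hb' side_vertex_three_four_one
      side_vertex_three_four_zero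
  opposite₂₃ := by
    obtain ⟨a, ha, ha'⟩ := S_vertex (k := 1) (i := 1) (Or.inl rfl)
    obtain ⟨b, hb, hb'⟩ := S_vertex (k := 1) (i := 2) (Or.inr rfl)
    exact oppositeSides_S 3 (oppositeSides_reflection ha hb ha' hb' side_vertex_one_two_zero
      side_vertex_one_two_zero)
  opposite₃₄ := by
    obtain ⟨a, ha, ha'⟩ := S_vertex (k := 3) (i := 3) (Or.inl rfl)
    obtain ⟨b, hb, hb'⟩ := S_vertex (k := 3) (i := 4) (Or.inr rfl)
    exact oppositeSides_S 3 (oppositeSides_S 1 (oppositeSides_reflection ha hb ha' hb'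
      side_vertex_three_four_zero side_vertex_three_four_one))

end
end PentagonGroup

namespace PentagonGroup

open Matrix ComplexHyperbolic MatrixGroups
noncomputable section

/-! ### The representation in `SU(2,1)` -/

/-- The matrix of the linear map that multiplies `e` by `x` and acts on the orthogonal complement of `e`
as `N` does in the coordinates `emb`. -/
def block (x : ℂ) (N : Matrix (Fin 2) (Fin 2) ℂ) : Matrix (Fin 3) (Fin 3) ℂ :=
  !![x, 0, 0;
    0, (N 0 0 + N 1 1 + Complex.I * (N 0 1 - N 1 0)) / 2,
      (N 0 0 - N 1 1 - Complex.I * (N 0 1 + N 1 0)) / 2;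
    0, (N 0 0 - N 1 1 + Complex.I * (N 0 1 + N 1 0)) / 2,
      (N 0 0 + N 1 1 - Complex.I * (N 0 1 - N 1 0)) / 2]

lemma block_mulVec_emb (x y : ℂ) (N : Matrix (Fin 2) (Fin 2) ℂ) (u : Fin 2 → ℂ) :
    block x N *ᵥ emb y u = emb (x * y) (N *ᵥ u) := by
  have hI := Complex.I_mul_I
  ext i
  fin_cases i
  · simp [block, emb, mulVec, dotProduct, Fin.sum_univ_three]
  · simp [block, emb, mulVec, dotProduct, Fin.sum_univ_three]
    linear_combination (-(N 0 1 - N 1 0) / 2 * u 1 - (N 0 1 + N 1 0) / 2 * u 1) * hI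
  · simp [block, emb, mulVec, dotProduct, Fin.sum_univ_three]
    linear_combination (-(N 0 1 - N 1 0) / 2 * u 1 - (N 0 1 + N 1 0) / 2 * u 1) * hI

lemma det_block (x : ℂ) (N : Matrix (Fin 2) (Fin 2) ℂ) : (block x N).det = x * N.det := by
  rw [det_fin_three, det_fin_two]
  simp [block]
  linear_combination (x / 4 * (-(N 0 1 - N 1 0) ^ 2 + (N 0 1 + N 1 0) ^ 2)) * Complex.I_mul_I

lemma herm_mul_map (M : SL(2, ℝ)) (x y : ℂ) (u w : Fin 2 → ℂ) :
    herm (emb x (M.1.map Complex.ofRealHom *ᵥ u)) (emb y (M.1.map Complex.ofRealHom *ᵥ w)) =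
      herm (emb x u) (emb y w) := by
  have hd := congrArg (fun r : ℝ => (r : ℂ)) M.2
  rw [det_fin_two] at hd
  push_cast at hd
  rw [herm_emb, herm_emb]
  simp [mulVec, dotProduct, Fin.sum_univ_two]
  linear_combination (u 0 * conj (w 1) - u 1 * conj (w 0)) * hd

/-- The element of `SU(2,1)` that multiplies `e` by `a²` and acts on the orthogonal complement of `e` as
`a • M` does in the coordinates `emb`. -/
def element (a : ℂ) (ha : a ^ 4 = 1) (M : SL(2, ℝ)) : SU21 :=
  ⟨⟨block (a ^ 2) (a • M.1.map Complex.ofRealHom), by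
    have h : (M.1.map Complex.ofRealHom).det = 1 := by
      rw [← RingHom.mapMatrix_apply, ← RingHom.map_det, M.2, map_one]
    rw [det_block, det_smul, h, Fintype.card_fin]; linear_combination ha⟩, by
    intro v w
    obtain ⟨x, u, rfl⟩ := exists_emb v
    obtain ⟨y, u', rfl⟩ := exists_emb w
    have hn : a * conj a = 1 := by
      have h1 : ‖a‖ = 1 := (pow_eq_one_iff_of_nonneg (norm_nonneg a) (by norm_num)).1
        (by rw [← norm_pow, ha, norm_one] : ‖a‖ ^ 4 = 1)
      rw [Complex.mul_conj', h1]; simp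
    change herm (block _ _ *ᵥ _) (block _ _ *ᵥ _) = _
    rw [block_mulVec_emb, block_mulVec_emb, smul_mulVec, smul_mulVec, pow_two, mul_assoc,
      mul_assoc, emb_smul, emb_smul, herm_smul_left, herm_smul_right, ← mul_assoc, hn, one_mul,
      herm_mul_map, herm_emb, herm_emb, map_mul]
    linear_combination x * conj y * hn⟩

lemma element_mulVec (a : ℂ) (ha : a ^ 4 = 1) (M : SL(2, ℝ)) (x : ℂ) (u : Fin 2 → ℂ) :
    (element a ha M).1.1 *ᵥ emb x u =
      emb (a ^ 2 * x) (a • (M.1.map Complex.ofRealHom *ᵥ u)) := by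
  rw [← smul_mulVec]
  exact block_mulVec_emb _ _ _ _

lemma SU21_ext {g h : SU21} (hgh : ∀ x u, g.1.1 *ᵥ emb x u = h.1.1 *ᵥ emb x u) : g = h := by
  refine Subtype.ext (Subtype.ext ?_)
  refine Matrix.ext_of_mulVec_single fun i => ?_
  obtain ⟨x, u, h⟩ := exists_emb (Pi.single i 1)
  rw [h, hgh]

lemma element_mul (a b : ℂ) (ha : a ^ 4 = 1) (hb : b ^ 4 = 1) (M N : SL(2, ℝ)) :
    element a ha M * element b hb N = element (a * b) (by rw [mul_pow, ha, hb, one_mul]) (M * N) := by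
  apply SU21_ext
  intro x u
  change ((element a ha M).1.1 * (element b hb N).1.1) *ᵥ _ = _
  rw [← mulVec_mulVec, element_mulVec, element_mulVec, element_mulVec, mulVec_smul, mulVec_mulVec,
    ← Matrix.map_mul, smul_smul]
  congr 1
  ring

lemma element_neg (a : ℂ) (ha : a ^ 4 = 1) (M : SL(2, ℝ)) :
    element (-a) (by rw [neg_pow, ha]; norm_num) (-M) = element a ha M := by
  apply SU21_ext
  intro x u
  rw [element_mulVec, element_mulVec]
  congr 1
  · ring
  · have : (-M).1.map Complex.ofRealHom = -(M.1.map Complex.ofRealHom) := by ext i j; simp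
    rw [this, neg_mulVec, smul_neg, neg_smul, neg_neg]

lemma element_one : element 1 (one_pow 4) 1 = 1 := by
  apply SU21_ext
  intro x u
  rw [element_mulVec]
  simp

lemma element_congr {a b : ℂ} {ha : a ^ 4 = 1} {hb : b ^ 4 = 1} {M N : SL(2, ℝ)} (h : a = b)
    (hMN : M = N) : element a ha M = element b hb N := by
  subst h hMN; rfl

/-! ### The half-turns -/

/-- The product of the matrices `A k` over a word. -/
def prodA (L : List (Fin 5)) : Matrix (Fin 2) (Fin 2) ℝ := (L.map A).prod

/-- The involution at the point `q` is multiplication by `-1` on `e`, and by `μ • B` in the coordinates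
`emb`. -/
def IsHalfTurn (q : V) (μ : ℂ) (B : Matrix (Fin 2) (Fin 2) ℝ) : Prop :=
  ∀ x u, Q e q (emb x u) = emb (-x) (μ • (B.map Complex.ofRealHom *ᵥ u))

lemma IsHalfTurn.reflect {q : V} {μ : ℂ} {L : List (Fin 5)} (h : IsHalfTurn q μ (prodA L))
    (k : Fin 5) : IsHalfTurn (S k q) (conj μ) (prodA (k :: L ++ [k])) := by
  intro x u
  have h1 : prodA (k :: L ++ [k]) = A k * (prodA L * A k) := by simp [prodA]
  rw [← S_S k (emb x u), Q_S, S_emb, h, S_emb, star_smul, star_map_mulVec, star_map_mulVec,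
    star_star, mulVec_smul, mulVec_mulVec, mulVec_mulVec, ← Matrix.map_mul, ← Matrix.map_mul, h1,
    map_neg, Complex.conj_conj, mul_assoc]
  rfl

lemma isHalfTurn_vertex {k l : Fin 5} (h : l = k + 1) :
    IsHalfTurn (vertex l) Complex.I (prodA [k, l]) := by
  have h1 : prodA [k, l] = A k * A l := by simp [prodA]
  intro x u
  rw [h1]
  refine Q_vertex ?_ ?_ x u
  · rw [← E_pi_div_five, ← E_add]
    congr 1
    rw [sideAngle, vertexAngle]; ring
  · rw [← E_neg_pi_div_five, ← E_add]
    obtain ⟨n, hn⟩ : ∃ n : ℤ, ((k : ℕ) : ℤ) + 1 + 5 * n = (l : ℕ) := by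
      subst h
      fin_cases k
      exacts [⟨0, by decide⟩, ⟨0, by decide⟩, ⟨0, by decide⟩, ⟨0, by decide⟩, ⟨-1, by decide⟩]
    replace hn : ((k : ℕ) : ℝ) + 1 + 5 * n = (l : ℕ) := by exact_mod_cast hn
    rw [← E_add_int_mul_two_pi _ n]
    congr 1
    rw [sideAngle, vertexAngle]
    linear_combination (2 * Real.pi / 5) * hn

/-- The scalar that accompanies the real matrix of the half-turn at `q (i + 1)`. It is conjugated by
each reflection. -/
def factor : Fin 8 → ℂ :=
  ![-Complex.I, -Complex.I, -Complex.I, Complex.I, -Complex.I, Complex.I, Complex.I, Complex.I]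

lemma factor_sq (i : Fin 8) : factor i * factor i = -1 := by
  fin_cases i <;> simp [factor]

lemma factor_pow_four (i : Fin 8) : factor i ^ 4 = 1 := by
  linear_combination (factor i * factor i - 1) * factor_sq i

lemma isHalfTurn_centrePoint (i : Fin 8) :
    IsHalfTurn (centrePoint (i + 1)) (factor i) (prodA (halfTurnWord i)) := by
  have h0 := isHalfTurn_vertex (k := 4) (l := 0) rfl
  have h1 := isHalfTurn_vertex (k := 0) (l := 1) rfl
  have h2 := isHalfTurn_vertex (k := 1) (l := 2) rfl
  have aux {q : V} {L : List (Fin 5)} (h : IsHalfTurn q Complex.I (prodA L)) (k : Fin 5) :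
      IsHalfTurn (S k q) (-Complex.I) (prodA (k :: L ++ [k])) := by
    rw [← Complex.conj_I]; exact h.reflect k
  have aux' {q : V} {L : List (Fin 5)} (h : IsHalfTurn q (-Complex.I) (prodA L)) (k : Fin 5) :
      IsHalfTurn (S k q) Complex.I (prodA (k :: L ++ [k])) := by
    have := h.reflect k
    rwa [map_neg, Complex.conj_I, neg_neg] at this
  fin_cases i
  exacts [aux (aux' (aux h2 3) 1) 3, aux (aux' (aux h1 3) 1) 3, aux (aux' (aux h0 3) 1) 3,
    aux' (aux h0 1) 3, aux h0 3, h0, h1, h2]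

lemma A_swap {i j : Fin 5} (h : Adj i j) (x : Matrix (Fin 2) (Fin 2) ℝ) :
    A i * (A j * x) = -(A j * (A i * x)) := by
  rw [← mul_assoc, A_anticomm h, neg_mul, mul_assoc]

lemma A_cancel (i : Fin 5) (x : Matrix (Fin 2) (Fin 2) ℝ) : A i * (A i * x) = x := by
  rw [← mul_assoc, A_mul_self, one_mul]

lemma A_swap_two {i j k : Fin 5} (h : Adj j k) (h' : Adj i k) (x : Matrix (Fin 2) (Fin 2) ℝ) :
    A i * (A j * (A k * x)) = A k * (A i * (A j * x)) := by
  rw [A_swap h, mul_neg, A_swap h', neg_neg]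

lemma prodA_append (L L' : List (Fin 5)) : prodA (L ++ L') = prodA L * prodA L' := by
  simp [prodA]

lemma prodA_mul_reverse (L : List (Fin 5)) : prodA L * prodA L.reverse = 1 := by
  induction L with
  | nil => simp [prodA]
  | cons i L ih =>
    rw [List.reverse_cons, ← List.singleton_append, prodA_append, prodA_append, mul_assoc,
      ← mul_assoc (prodA L), ih, one_mul]
    simp [prodA, A_mul_self]

lemma exists_halfTurnWord_eq (i : Fin 8) :
    ∃ L k l, Adj k l ∧ halfTurnWord i = L ++ [k, l] ++ L.reverse := by
  fin_cases i
  exacts [⟨[3, 1, 3], 1, 2, by decide, rfl⟩, ⟨[3, 1, 3], 0, 1, by decide, rfl⟩,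
    ⟨[3, 1, 3], 4, 0, by decide, rfl⟩, ⟨[3, 1], 4, 0, by decide, rfl⟩,
    ⟨[3], 4, 0, by decide, rfl⟩, ⟨[], 4, 0, by decide, rfl⟩, ⟨[], 0, 1, by decide, rfl⟩,
    ⟨[], 1, 2, by decide, rfl⟩]

lemma prodA_sq (i : Fin 8) : prodA (halfTurnWord i) * prodA (halfTurnWord i) = -1 := by
  obtain ⟨L, k, l, h, hL⟩ := exists_halfTurnWord_eq i
  have h1 := mul_eq_one_comm.1 (prodA_mul_reverse L)
  have h2 : prodA [k, l] * prodA [k, l] = -1 := by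
    simp [prodA, mul_assoc, A_swap h, A_cancel, A_mul_self]
  rw [hL, prodA_append, prodA_append]
  calc _ = prodA L * (prodA [k, l] * (prodA L.reverse * prodA L) * prodA [k, l]) *
        prodA L.reverse := by simp only [mul_assoc]
    _ = -1 := by rw [h1, mul_one, h2, mul_neg_one, neg_mul, prodA_mul_reverse]

/-- The relation `r 7 * ⋯ * r 0 = 1` holds for the real matrices of the half-turns without a sign. -/
lemma prodA_all : prodA (halfTurnWord 7) * (prodA (halfTurnWord 6) * (prodA (halfTurnWord 5) *
    (prodA (halfTurnWord 4) * (prodA (halfTurnWord 3) * (prodA (halfTurnWord 2) *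
      (prodA (halfTurnWord 1) * prodA (halfTurnWord 0))))))) = 1 := by
  have h10 := A_swap (i := 1) (j := 0) (by decide)
  have h21 := A_swap (i := 2) (j := 1) (by decide)
  have h32 := A_swap (i := 3) (j := 2) (by decide)
  have h40 := A_swap (i := 4) (j := 0) (by decide)
  have h312 := A_swap_two (i := 3) (j := 1) (k := 2) (by decide) (by decide)
  have h423 := A_swap_two (i := 4) (j := 2) (k := 3) (by decide) (by decide)
  simp only [← prodA_append]
  change (([1, 2, 0, 1, 4, 0, 3, 4, 0, 3, 3, 1, 4, 0, 1, 3, 3, 1, 3, 4, 0, 3, 1, 3,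
    3, 1, 3, 0, 1, 3, 1, 3, 3, 1, 3, 1, 2, 3, 1, 3] : List (Fin 5)).map A).prod = 1
  simp only [List.map_cons, List.map_nil, List.prod_cons, List.prod_nil, A_cancel, h10, h21, h32,
    h40, h312, h423, mul_neg, neg_neg]

end
end PentagonGroup

namespace PentagonGroup

open Matrix ComplexHyperbolic MatrixGroups UpperHalfPlane
noncomputable section

/-- The real matrix of the half-turn at `q (i + 1)`. -/
def halfTurn (i : Fin 8) : SL(2, ℝ) := ⟨prodA (halfTurnWord i), by
  have h : (prodA (halfTurnWord i)).det = (-1) ^ (halfTurnWord i).length := by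
    rw [prodA]
    induction halfTurnWord i with
    | nil => simp
    | cons k L ih => rw [List.map_cons, List.prod_cons, det_mul, ih, A_det, List.length_cons, pow_succ']
  have h2 : Even (halfTurnWord i).length := by fin_cases i <;> decide
  rw [h, h2.neg_one_pow]⟩

/-- The representation of `H 8` by the half-turns at the points `q 1, …, q 8`. -/
def σ : H 8 →* SU21 :=
  liftH (fun i => element (factor i) (factor_pow_four i) (halfTurn i))
    (fun i => by
      have h : halfTurn i * halfTurn i = -1 := by
        exact Subtype.ext (prodA_sq i)
      rw [element_mul, ← element_neg, ← element_one]
      exact element_congr (by rw [factor_sq, neg_neg]) (by rw [h, neg_neg]))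
    (by
      have h : halfTurn 7 * halfTurn 6 * halfTurn 5 * halfTurn 4 * halfTurn 3 * halfTurn 2 *
          halfTurn 1 * halfTurn 0 = 1 := by
        simp only [mul_assoc]
        exact Subtype.ext prodA_all
      simp only [element_mul]
      rw [← element_one]
      refine element_congr ?_ h
      have hI := Complex.I_mul_I
      simp [factor]
      )

lemma σ_r (i : Fin 8) : σ (r i) = element (factor i) (factor_pow_four i) (halfTurn i) := liftH_r _ _ _ _

lemma σ_r_mulVec (i : Fin 8) (v : V) : (σ (r i)).1.1 *ᵥ v = Q e (centrePoint (i + 1)) v := by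
  obtain ⟨x, u, rfl⟩ := exists_emb v
  rw [σ_r, element_mulVec, isHalfTurn_centrePoint]
  congr 1
  linear_combination x * factor_sq i

lemma halfTurn_smul (i : Fin 8) (z : ℍ) : halfTurn i • z = ψ (r i) • z := by
  have h (L : List (Fin 5)) : (L.map R).prod • z = wd L • z := by
    induction L with
    | nil => simp
    | cons k L ih => rw [wd_cons, SemigroupAction.mul_smul, t_smul, ← ih, List.map_cons,
        List.prod_cons, SemigroupAction.mul_smul]
  have h2 : ((halfTurn i : SL(2, ℝ)) : GL (Fin 2) ℝ) = ((halfTurnWord i).map R).prod := by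
    apply Units.ext
    have h3 : (((halfTurnWord i).map R).prod).1 = (((halfTurnWord i).map R).map
        (Units.coeHom _)).prod := map_list_prod (Units.coeHom _) _
    rw [h3, List.map_map]
    rfl
  rw [ψ_r, ← h, ← h2]
  rfl

lemma neg_smul_upperHalfPlane (M : SL(2, ℝ)) (z : ℍ) : -M • z = M • z := by
  ext
  rw [coe_specialLinearGroup_apply, coe_specialLinearGroup_apply]
  simp only [SpecialLinearGroup.coe_neg, Matrix.neg_apply, map_neg, Complex.ofReal_neg, neg_mul,
    ← neg_add, neg_div_neg_eq]

lemma exists_element (h : H 8) : ∃ (a : ℂ) (ha : a ^ 4 = 1) (M : SL(2, ℝ)),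
    σ h = element a ha M ∧ ∀ z : ℍ, M • z = ψ h • z := by
  induction h using H_induction with
  | one => exact ⟨1, one_pow 4, 1, by rw [map_one, element_one], fun z => by simp⟩
  | mul i h ih =>
    obtain ⟨a, ha, M, h1, h2⟩ := ih
    refine ⟨_, _, halfTurn i * M, by rw [map_mul, σ_r, h1, element_mul], fun z => ?_⟩
    rw [SemigroupAction.mul_smul, h2, halfTurn_smul, map_mul, SemigroupAction.mul_smul]

/-- On words of even length the product of the factors is `1` or `-1`, and the sign is absorbed in `M`. -/
lemma exists_element_of_mem {g : H 8} (hg : g ∈ G 8) : ∃ M : SL(2, ℝ),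
    σ g = element 1 (one_pow 4) M ∧ ∀ z : ℍ, M • z = ψ g • z := by
  induction hg using Subgroup.closure_induction with
  | mem g hg =>
    obtain ⟨⟨i, j⟩, rfl⟩ := hg
    have h := factor_sq i
    have h' : factor i * factor j = 1 ∨ factor i * factor j = -1 := by
      rw [← mul_self_eq_one_iff]
      linear_combination factor j ^ 2 * factor_sq i - factor_sq j
    rcases h' with h' | h'
    · refine ⟨halfTurn i * halfTurn j, ?_, fun z => ?_⟩
      · rw [map_mul, σ_r, σ_r, element_mul]
        exact element_congr h' rfl
      · rw [SemigroupAction.mul_smul, halfTurn_smul, halfTurn_smul, map_mul, SemigroupAction.mul_smul]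
    · refine ⟨-(halfTurn i * halfTurn j), ?_, fun z => ?_⟩
      · rw [map_mul, σ_r, σ_r, element_mul, ← element_neg]
        exact element_congr (by rw [h', neg_neg]) rfl
      · refine (neg_smul_upperHalfPlane _ z).trans ?_
        rw [SemigroupAction.mul_smul, halfTurn_smul, halfTurn_smul, map_mul,
          SemigroupAction.mul_smul]
  | one => exact ⟨1, by rw [map_one, element_one], fun z => by simp⟩
  | mul g g' _ _ ih ih' =>
    obtain ⟨M, h1, h2⟩ := ih
    obtain ⟨M', h1', h2'⟩ := ih'
    refine ⟨M * M', ?_, fun z => ?_⟩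
    · rw [map_mul, h1, h1', element_mul]
      exact element_congr (one_mul 1) rfl
    · rw [SemigroupAction.mul_smul, h2', h2, map_mul, SemigroupAction.mul_smul]
  | inv g _ ih =>
    obtain ⟨M, h1, h2⟩ := ih
    refine ⟨M⁻¹, ?_, fun z => ?_⟩
    · rw [map_inv, h1, inv_eq_iff_mul_eq_one, element_mul, ← element_one]
      exact element_congr (one_mul 1) (mul_inv_cancel M)
    · rw [inv_smul_eq_iff, h2, map_inv, smul_inv_smul]

/-- The numerator of the function `wall k` at the point of the upper half-plane that is represented by
the vector `v` of the complex geodesic. -/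
def wallNumerator (k : Fin 5) (v : V) : ℝ :=
  A k 0 1 * Complex.normSq (crd v 1) + 2 * A k 0 0 * (crd v 0 * conj (crd v 1)).re
    - A k 1 0 * Complex.normSq (crd v 0)

lemma continuous_wallNumerator (k : Fin 5) : Continuous (wallNumerator k) := by
  have h (i : Fin 2) : Continuous fun v : V => crd v i := by
    fin_cases i <;> simp only [crd] <;> fun_prop
  unfold wallNumerator
  have := Complex.continuous_normSq
  fun_prop

/-- The base point `i` of the upper half-plane. -/
def base : V := emb 0 ![Complex.I, 1]

/-- The numerators are continuous, so by this formula an element near the identity maps the base point into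
the open chamber. -/
lemma wallNumerator_element (k : Fin 5) {a : ℂ} (ha : a ^ 4 = 1) (M : SL(2, ℝ)) :
    wallNumerator k ((element a ha M).1.1 *ᵥ base) = wall k (M • I) := by
  have hn : Complex.normSq a = 1 := by
    have h1 : ‖a‖ = 1 := (pow_eq_one_iff_of_nonneg (norm_nonneg a) (by norm_num)).1
      (by rw [← norm_pow, ha, norm_one] : ‖a‖ ^ 4 = 1)
    rw [Complex.normSq_eq_norm_sq, h1, one_pow]
  have hu : crd ((element a ha M).1.1 *ᵥ base) =
      a • ![M 0 0 * Complex.I + M 0 1, M 1 0 * Complex.I + M 1 1] := by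
    rw [base, element_mulVec, crd_emb]
    congr 1
    ext i; fin_cases i <;> simp [mulVec, dotProduct, Fin.sum_univ_two]
  have hdet := M.2
  rw [det_fin_two] at hdet
  change M 0 0 * M 1 1 - M 0 1 * M 1 0 = 1 at hdet
  have hz : ((M • I : ℍ) : ℂ) = (M 0 0 * Complex.I + M 0 1) / (M 1 0 * Complex.I + M 1 1) :=
    coe_specialLinearGroup_apply M I
  have hre := congrArg Complex.re hz
  have him := congrArg Complex.im hz
  rw [wallNumerator, hu, wall, form]
  rw [UpperHalfPlane.coe_re, Complex.div_re] at hre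
  rw [UpperHalfPlane.coe_im, Complex.div_im] at him
  have hc : (a * (M 0 0 * Complex.I + M 0 1) * conj (a * (M 1 0 * Complex.I + M 1 1))).re =
      M 0 0 * M 1 0 + M 0 1 * M 1 1 := by
    have : a * (M 0 0 * Complex.I + M 0 1) * conj (a * (M 1 0 * Complex.I + M 1 1)) =
        (Complex.normSq a : ℂ) * ((M 0 0 * Complex.I + M 0 1) *
          conj (M 1 0 * Complex.I + M 1 1)) := by
      rw [map_mul, Complex.normSq_eq_conj_mul_self]; ring
    rw [this, hn]
    simp
    ring
  simp only [Pi.smul_apply, smul_eq_mul, cons_val_zero, cons_val_one, map_mul, hn, one_mul]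
  rw [← map_mul, hc, hre, him]
  have h1 : Complex.normSq (M 1 0 * Complex.I + M 1 1) = M 1 0 ^ 2 + M 1 1 ^ 2 := by
    simp [Complex.normSq_apply]; ring
  have h2 : Complex.normSq (M 0 0 * Complex.I + M 0 1) = M 0 0 ^ 2 + M 0 1 ^ 2 := by
    simp [Complex.normSq_apply]; ring
  rw [h1, h2]
  have hD : 0 < M 1 0 ^ 2 + M 1 1 ^ 2 := by
    by_contra! h
    have h3 : M 1 0 = 0 := by nlinarith [sq_nonneg (M 1 0), sq_nonneg (M 1 1)]
    have h4 : M 1 1 = 0 := by nlinarith [sq_nonneg (M 1 0), sq_nonneg (M 1 1)]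
    rw [h3, h4] at hdet
    norm_num at hdet
  simp
  generalize M 0 0 = p at *
  generalize M 0 1 = q at *
  generalize M 1 0 = r at *
  generalize M 1 1 = t at *
  have e1 : q * t / (r ^ 2 + t ^ 2) + p * r / (r ^ 2 + t ^ 2) = (p * r + q * t) / (r ^ 2 + t ^ 2) := by
    ring
  have e2 : p * t / (r ^ 2 + t ^ 2) - q * r / (r ^ 2 + t ^ 2) = 1 / (r ^ 2 + t ^ 2) := by
    rw [← hdet]; ring
  rw [e1, e2]
  field_simp
  linear_combination (-A k 1 0 * (p * t - q * r + 1)) * hdet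

lemma eq_one_of_wallNumerator_pos {h : H 8} (hh : ∀ k, 0 < wallNumerator k ((σ h).1.1 *ᵥ base)) :
    h = 1 := by
  obtain ⟨a, ha, M, h1, h2⟩ := exists_element h
  have h3 : (ψ h)⁻¹ = 1 := by
    refine eq_one_of_smul_mem I_mem_chamber fun k => ?_
    rw [inv_inv, ← h2, ← wallNumerator_element k ha, ← h1]
    exact hh k
  exact ψ_injective (by rw [map_one, ← inv_eq_one, h3])

lemma wallNumerator_base_pos (k : Fin 5) : 0 < wallNumerator k base := by
  have h := wallNumerator_element k (one_pow 4) 1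
  rw [element_one] at h
  have h2 : (1 : SU21).1.1 *ᵥ base = base := one_mulVec _
  rw [h2, one_smul] at h
  rw [h]
  exact wall_I_pos k

lemma σ_injective : Function.Injective σ := by
  rw [injective_iff_map_eq_one]
  intro h hh
  refine eq_one_of_wallNumerator_pos fun k => ?_
  have h2 : (1 : SU21).1.1 *ᵥ base = base := one_mulVec _
  rw [hh, h2]
  exact wallNumerator_base_pos k

/-- Near the identity, an element of `SU(2,1)` moves the base point so little that its image
stays in the interior of the fundamental chamber. -/
lemma isDiscrete_range : IsDiscrete σ.range := by
  refine discreteTopology_of_isOpen_singleton_one ?_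
  have hc (k : Fin 5) : Continuous fun g : σ.range => wallNumerator k (g.1.1.1 *ᵥ base) := by
    refine (continuous_wallNumerator k).comp ?_
    refine Continuous.matrix_mulVec ?_ continuous_const
    have h1 : Continuous fun g : Matrix.SpecialLinearGroup (Fin 3) ℂ => g.1 := continuous_subtype_val
    have h2 : Continuous fun g : SU21 => g.1 := continuous_subtype_val
    have h3 : Continuous fun g : σ.range => g.1 := continuous_subtype_val
    exact h1.comp (h2.comp h3)
  have hU : IsOpen (⋂ k, {g : σ.range | 0 < wallNumerator k (g.1.1.1 *ᵥ base)}) :=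
    isOpen_iInter_of_finite fun k => isOpen_lt continuous_const (hc k)
  convert hU
  ext ⟨g, h, rfl⟩
  simp only [Set.mem_singleton_iff, Set.mem_iInter, Set.mem_ofPred_eq]
  constructor
  · intro hg k
    have h2 : (1 : SU21).1.1 *ᵥ base = base := one_mulVec _
    rw [Subtype.ext_iff] at hg
    change σ h = 1 at hg
    rw [hg, h2]
    exact wallNumerator_base_pos k
  · intro hg
    refine Subtype.ext ?_
    change σ h = 1
    rw [eq_one_of_wallNumerator_pos hg, map_one]

lemma isDiscrete_mono {K L : Subgroup SU21} (h : K ≤ L) (hL : IsDiscrete L) : IsDiscrete K :=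
  DiscreteTopology.of_subset hL h

lemma smul_mk_eq (g : SU21) {v : V} (hv : v ≠ 0) (hgv : g.1.1 *ᵥ v ≠ 0) :
    g • Projectivization.mk ℂ v hv = Projectivization.mk ℂ (g.1.1 *ᵥ v) hgv := rfl

lemma mulVec_ne_zero (g : SU21) {v : V} (hv : v ≠ 0) : g.1.1 *ᵥ v ≠ 0 := by
  have := (smul_ne_zero_iff_ne g).2 hv
  exact this

lemma mem_submodule_smul {g : SU21} {x : ℙ ℂ V} {v : V} (hv : v ∈ x.submodule) :
    g.1.1 *ᵥ v ∈ (g • x).submodule := by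
  induction x using Projectivization.ind with
  | h w hw =>
    rw [smul_mk_eq g hw (mulVec_ne_zero g hw), Projectivization.submodule_mk,
      Submodule.mem_span_singleton]
    rw [Projectivization.submodule_mk, Submodule.mem_span_singleton] at hv
    obtain ⟨a, rfl⟩ := hv
    exact ⟨a, by rw [mulVec_smul]⟩

lemma herm_mulVec (g : SU21) (v w : V) : herm (g.1.1 *ᵥ v) (g.1.1 *ᵥ w) = herm v w := g.2 v w

lemma smul_mem_H2C (g : SU21) {x : ℙ ℂ V} (hx : x ∈ H2C) : g • x ∈ H2C := by
  obtain ⟨v, hv, hn⟩ := hx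
  exact ⟨_, mem_submodule_smul hv, by rwa [IsNegative, herm_mulVec]⟩

lemma leavesInvariant_of {K : Subgroup SU21} {X : Set (ℙ ℂ V)} (h : ∀ g ∈ K, ∀ x ∈ X, g • x ∈ X) :
    LeavesInvariant K X := by
  intro g hg
  refine Set.Subset.antisymm (Set.image_subset_iff.2 (h g hg)) fun x hx => ?_
  exact ⟨g⁻¹ • x, h _ (inv_mem hg) x hx, smul_inv_smul g x⟩

/-- The invariant complex geodesic consists of the negative points orthogonal to `e`. -/
lemma isCFuchsian_of_le {K : Subgroup SU21} (hK : K ≤ σ.range) : IsCFuchsian K := by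
  refine ⟨LinearMap.ker (LinearMap.proj 0 : V →ₗ[ℂ] ℂ), ?_, ⟨base, rfl, ?_⟩, ?_⟩
  · have h := LinearMap.finrank_range_add_finrank_ker (LinearMap.proj 0 : V →ₗ[ℂ] ℂ)
    rw [LinearMap.range_eq_top.2 (LinearMap.proj_surjective 0), finrank_top,
      Module.finrank_self, Module.finrank_fin_fun] at h
    change 1 + Module.finrank ℂ (LinearMap.ker (LinearMap.proj 0 : V →ₗ[ℂ] ℂ)) = 3 at h
    lia
  · rw [IsNegative, base, herm_emb]
    simp
  · refine leavesInvariant_of fun g hg x ⟨hx, hx'⟩ => ⟨smul_mem_H2C g hx, ?_⟩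
    obtain ⟨h, rfl⟩ := hK hg
    obtain ⟨a, ha, M, h1, -⟩ := exists_element h
    induction x using Projectivization.ind with
    | h w hw =>
      rw [Projectivization.submodule_mk, Submodule.span_singleton_le_iff_mem] at hx'
      rw [smul_mk_eq _ hw (mulVec_ne_zero _ hw), Projectivization.submodule_mk,
        Submodule.span_singleton_le_iff_mem]
      obtain ⟨x, u, rfl⟩ := exists_emb w
      have hx0 : x = 0 := hx'
      rw [h1, element_mulVec, hx0, mul_zero]
      rfl

end
end PentagonGroup

namespace PentagonGroup

open Matrix ComplexHyperbolic MatrixGroups 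
noncomputable section

/-! ### Eigenvectors of the elements of the surface group -/

/-- The element of `SU(2,1)` that fixes `e` and acts on the orthogonal complement of `e` as the real
matrix `M`. -/
def lin (M : SL(2, ℝ)) : SU21 := element 1 (one_pow 4) M

lemma lin_mulVec (M : SL(2, ℝ)) (x : ℂ) (u : Fin 2 → ℂ) :
    (lin M).1.1 *ᵥ emb x u = emb x (M.1.map Complex.ofRealHom *ᵥ u) := by
  rw [lin, element_mulVec, one_pow, one_mul, one_smul]

lemma lin_mul (M N : SL(2, ℝ)) : lin M * lin N = lin (M * N) := by
  rw [lin, lin, element_mul]; exact element_congr (one_mul 1) rfl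

lemma lin_one : lin 1 = 1 := element_one

lemma lin_pow (M : SL(2, ℝ)) (n : ℕ) : lin M ^ n = lin (M ^ n) := by
  induction n with
  | zero => rw [pow_zero, pow_zero, lin_one]
  | succ n ih => rw [pow_succ, ih, lin_mul, pow_succ]

lemma lin_inv (M : SL(2, ℝ)) : (lin M)⁻¹ = lin M⁻¹ := by
  rw [inv_eq_iff_mul_eq_one, lin_mul, mul_inv_cancel, lin_one]

lemma lin_injective : Function.Injective lin := by
  intro M N h
  ext i j
  have h1 := congrArg (fun g : SU21 => g.1.1 *ᵥ emb 0 (Pi.single j 1)) h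
  simp only [lin_mulVec] at h1
  have h2 := congrFun (congrArg crd h1) i
  simpa using h2

/-- The complex vector with given real coordinates. -/
def cplx (u : Fin 2 → ℝ) : Fin 2 → ℂ := fun i => u i

lemma map_mulVec_cplx (M : Matrix (Fin 2) (Fin 2) ℝ) (u : Fin 2 → ℝ) :
    M.map Complex.ofRealHom *ᵥ cplx u = cplx (M *ᵥ u) := by
  ext i; simp [cplx, mulVec, dotProduct, Fin.sum_univ_two]

/-- `a` and `b` are independent eigenvectors of `M` with the eigenvalues `ε * s⁻¹` and `ε * s`. -/
structure IsAxis (M : SL(2, ℝ)) (s ε : ℝ) (a b : Fin 2 → ℝ) : Prop where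
  s_pos : 0 < s
  ε_sq : ε ^ 2 = 1
  left : M.1 *ᵥ a = (s⁻¹ * ε) • a
  right : M.1 *ᵥ b = (s * ε) • b
  indep : a 0 * b 1 - a 1 * b 0 ≠ 0

lemma isAxis_one : IsAxis 1 1 1 ![1, 0] ![0, 1] := ⟨by simp, by simp, by simp, by simp, by simp⟩

lemma IsAxis.inv {M : SL(2, ℝ)} {s ε : ℝ} {a b : Fin 2 → ℝ} (h : IsAxis M s ε a b) :
    IsAxis M⁻¹ s ε b a := by
  have key {x : ℝ} {u : Fin 2 → ℝ} (hx : x ≠ 0) (hu : M.1 *ᵥ u = x • u) :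
      M⁻¹.1 *ᵥ u = x⁻¹ • u := by
    have h1 : M⁻¹.1 * M.1 = 1 := congrArg Subtype.val (inv_mul_cancel M)
    rw [eq_inv_smul_iff₀ hx, ← mulVec_smul, ← hu, mulVec_mulVec, h1, one_mulVec]
  have hs := h.s_pos.ne'
  have hε : ε ≠ 0 := fun h0 => by simpa [h0] using h.ε_sq
  have hε' : ε⁻¹ = ε := inv_eq_of_mul_eq_one_left (by rw [← pow_two, h.ε_sq])
  refine ⟨h.s_pos, h.ε_sq, ?_, ?_, fun h0 => h.indep (by linarith)⟩
  · rw [key (mul_ne_zero hs hε) h.right, mul_inv, hε']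
  · rw [key (mul_ne_zero (inv_ne_zero hs) hε) h.left, mul_inv, hε', inv_inv]

/-- A real matrix of determinant one with `|tr| > 2` has two real eigenvectors. -/
lemma exists_isAxis {M : SL(2, ℝ)} (hM : 2 < |M 0 0 + M 1 1|) :
    ∃ s ε a b, 1 < s ∧ IsAxis M s ε a b := by
  obtain ⟨ε, hε, ht⟩ : ∃ ε : ℝ, ε ^ 2 = 1 ∧ 2 < ε * (M 0 0 + M 1 1) := by
    rcases lt_abs.1 hM with h | h
    · exact ⟨1, by norm_num, by linarith⟩
    · exact ⟨-1, by norm_num, by linarith⟩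
  obtain ⟨s, hs1, hs⟩ : ∃ s : ℝ, 1 < s ∧ s ^ 2 - ε * (M 0 0 + M 1 1) * s + 1 = 0 := by
    generalize ε * (M 0 0 + M 1 1) = t at ht
    have h4 : 0 ≤ t ^ 2 - 4 := by nlinarith
    have h := Real.sq_sqrt h4
    have h0 := Real.sqrt_nonneg (t ^ 2 - 4)
    exact ⟨(t + √(t ^ 2 - 4)) / 2, by linarith, by linear_combination h / 4⟩
  have hs0 : s ≠ 0 := by positivity
  have hdet := M.2
  rw [det_fin_two] at hdet
  have eig (x : ℝ) (hx : x ^ 2 - (M 0 0 + M 1 1) * x + 1 = 0) :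
      ∃ u ≠ (0 : Fin 2 → ℝ), M.1 *ᵥ u = x • u := by
    obtain ⟨u, hu, hu'⟩ := (Matrix.exists_mulVec_eq_zero_iff (M := M.1 - x • 1)).2 (by
      rw [det_fin_two]
      simp
      linear_combination hx + hdet)
    refine ⟨u, hu, ?_⟩
    rw [sub_mulVec, smul_mulVec, one_mulVec, sub_eq_zero] at hu'
    exact hu'
  obtain ⟨a, ha, ha'⟩ := eig (s⁻¹ * ε) (by
    field_simp
    linear_combination hs + hε * (1 - (M 0 0 + M 1 1) * 0))
  obtain ⟨b, hb, hb'⟩ := eig (s * ε) (by linear_combination hs + s ^ 2 * hε)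
  refine ⟨s, ε, a, b, hs1, by positivity, hε, ha', hb', fun h0 => ?_⟩
  have ha0 := congrFun ha' 0
  have ha1 := congrFun ha' 1
  have hb0 := congrFun hb' 0
  have hb1 := congrFun hb' 1
  simp [mulVec, dotProduct, Fin.sum_univ_two] at ha0 ha1 hb0 hb1
  have hd : s⁻¹ * ε - s * ε ≠ 0 := by
    intro h
    have h1 : ε * (s * s⁻¹ - s ^ 2) = 0 := by linear_combination s * h
    rw [mul_inv_cancel₀ hs0, mul_eq_zero] at h1
    rcases h1 with h1 | h1
    · simp [h1] at hε
    · nlinarith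
  have h00 : a 0 * b 0 = 0 := by
    refine (mul_eq_zero.1 (?_ : (s⁻¹ * ε - s * ε) * _ = 0)).resolve_left hd
    linear_combination -b 0 * ha0 + a 0 * hb0 - M 0 1 * h0
  have h11 : a 1 * b 1 = 0 := by
    refine (mul_eq_zero.1 (?_ : (s⁻¹ * ε - s * ε) * _ = 0)).resolve_left hd
    linear_combination -b 1 * ha1 + a 1 * hb1 + M 1 0 * h0
  have h01 : a 0 * b 1 = 0 := by
    refine (mul_eq_zero.1 (?_ : (s⁻¹ * ε - s * ε) * _ = 0)).resolve_left hd
    linear_combination -b 1 * ha0 + a 1 * hb0 + (M 0 0 - s * ε) * h0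
  have h10 : a 1 * b 0 = 0 := by linear_combination h01 - h0
  have : (a 0 = 0 ∧ a 1 = 0) ∨ (b 0 = 0 ∧ b 1 = 0) := by
    rcases mul_eq_zero.1 h00 with h | h <;> rcases mul_eq_zero.1 h11 with h' | h' <;>
    rcases mul_eq_zero.1 h01 with h'' | h'' <;> rcases mul_eq_zero.1 h10 with h''' | h''' <;> tauto
  rcases this with ⟨h, h'⟩ | ⟨h, h'⟩
  · exact ha (by ext i; fin_cases i; exacts [h, h'])
  · exact hb (by ext i; fin_cases i; exacts [h, h'])

lemma exists_lin {g : H 8} (hg : g ∈ G 8) : ∃ M, σ g = lin M ∧ (g ≠ 1 → 2 < |M 0 0 + M 1 1|) := by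
  obtain ⟨M, h1, h2⟩ := exists_element_of_mem hg
  exact ⟨M, h1, fun hg1 => two_lt_abs_trace hg hg1 h2⟩

/-- The basis of `V` formed by `e` and two eigenvectors in its orthogonal complement. -/
lemma IsAxis.exists_basis {M : SL(2, ℝ)} {s ε : ℝ} {a b : Fin 2 → ℝ} (h : IsAxis M s ε a b) :
    ∃ B : Module.Basis (Fin 3) ℂ V, (B 0 = e ∧ B 1 = emb 0 (cplx a) ∧ B 2 = emb 0 (cplx b)) ∧
      ∀ i, (lin M).1.1 *ᵥ B i = ![(1 : ℂ), (s : ℂ)⁻¹ * ε, s * ε] i • B i := by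
  have hli : LinearIndependent ℂ ![e, emb 0 (cplx a), emb 0 (cplx b)] := by
    rw [Fintype.linearIndependent_iff]
    intro x hx
    rw [Fin.sum_univ_three] at hx
    have hx' : emb (x 0) (x 1 • cplx a + x 2 • cplx b) = 0 := by
      rw [← hx]
      change _ = x 0 • e + x 1 • emb 0 (cplx a) + x 2 • emb 0 (cplx b)
      rw [← emb_one_zero, ← emb_smul, ← emb_smul, ← emb_smul, ← emb_add, ← emb_add]
      simp
    have h0 : x 0 = 0 := congrFun hx' 0
    have hc := congrArg crd hx'
    rw [crd_emb] at hc
    have h1 := congrFun hc 0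
    have h2 := congrFun hc 1
    simp [crd, cplx] at h1 h2
    have hi : (a 0 * b 1 - a 1 * b 0 : ℂ) ≠ 0 := by exact_mod_cast h.indep
    have h3 : x 1 = 0 := by
      refine (mul_eq_zero.1 (?_ : (a 0 * b 1 - a 1 * b 0 : ℂ) * _ = 0)).resolve_left hi
      linear_combination b 1 * h1 - b 0 * h2
    have h4 : x 2 = 0 := by
      refine (mul_eq_zero.1 (?_ : (a 0 * b 1 - a 1 * b 0 : ℂ) * _ = 0)).resolve_left hi
      linear_combination a 0 * h2 - a 1 * h1
    intro i
    fin_cases i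
    exacts [h0, h3, h4]
  refine ⟨basisOfLinearIndependentOfCardEqFinrank hli (by simp), ⟨by simp, by simp, by simp⟩,
    fun i => ?_⟩
  rw [coe_basisOfLinearIndependentOfCardEqFinrank]
  fin_cases i
  · change (lin M).1.1 *ᵥ e = (1 : ℂ) • e
    rw [← emb_one_zero, lin_mulVec, mulVec_zero, one_smul]
  · change (lin M).1.1 *ᵥ emb 0 (cplx a) = ((s : ℂ)⁻¹ * ε) • emb 0 (cplx a)
    rw [lin_mulVec, map_mulVec_cplx, h.left, ← emb_smul, mul_zero]
    congr 1
    ext i; simp [cplx]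
  · change (lin M).1.1 *ᵥ emb 0 (cplx b) = ((s : ℂ) * ε) • emb 0 (cplx b)
    rw [lin_mulVec, map_mulVec_cplx, h.right, ← emb_smul, mul_zero]
    congr 1
    ext i; simp [cplx]

lemma herm_emb_cplx (a : Fin 2 → ℝ) : herm (emb 0 (cplx a)) (emb 0 (cplx a)) = 0 := by
  rw [herm_emb]; simp [cplx]; ring_nf

lemma herm_emb_e (u : Fin 2 → ℂ) : herm (emb 0 u) e = 0 := by simp [herm, emb, e]

lemma toMatrix_eq_diagonal {B : Module.Basis (Fin 3) ℂ V} {g : SU21} {d : Fin 3 → ℂ}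
    (h : ∀ i, g.1.1 *ᵥ B i = d i • B i) :
    LinearMap.toMatrix B B (Matrix.toLin' g.1.1) = Matrix.diagonal d := by
  ext i j
  rw [LinearMap.toMatrix_apply, toLin'_apply, h, map_smul, Module.Basis.repr_self,
    Matrix.diagonal_apply]
  simp only [Finsupp.smul_apply, Finsupp.single_apply, smul_eq_mul, mul_ite, mul_one, mul_zero]
  rcases eq_or_ne i j with rfl | hij
  · simp
  · simp [hij, hij.symm]

lemma diagonal_form {g : SU21} (hg : ∃ h ∈ G 8, σ h = g) :
    ∃ (b : Module.Basis (Fin 3) ℂ V) (s ε : ℝ), b 0 = e ∧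
      herm (b 1) e = 0 ∧ herm (b 1) (b 1) = 0 ∧ herm (b 2) e = 0 ∧ herm (b 2) (b 2) = 0 ∧
      0 < s ∧ (ε = 1 ∨ ε = -1) ∧ LinearMap.toMatrix b b (Matrix.toLin' g.1.1) =
        Matrix.diagonal ![(1 : ℂ), (s : ℂ)⁻¹ * ε, s * ε] := by
  obtain ⟨h, hh, rfl⟩ := hg
  obtain ⟨M, hM, htr⟩ := exists_lin hh
  obtain ⟨s, ε, a, b, hax⟩ : ∃ s ε a b, IsAxis M s ε a b := by
    by_cases h1 : h = 1
    · have : M = 1 := lin_injective (by rw [← hM, h1, map_one, lin_one])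
      exact ⟨_, _, _, _, this ▸ isAxis_one⟩
    · obtain ⟨s, ε, a, b, -, h2⟩ := exists_isAxis (htr h1)
      exact ⟨s, ε, a, b, h2⟩
  obtain ⟨B, ⟨h0, h1, h2⟩, hB⟩ := hax.exists_basis
  refine ⟨B, s, ε, h0, ?_, ?_, ?_, ?_, hax.s_pos, mul_self_eq_one_iff.1 (by rw [← pow_two, hax.ε_sq]), ?_⟩
  · rw [h1, herm_emb_e]
  · rw [h1, herm_emb_cplx]
  · rw [h2, herm_emb_e]
  · rw [h2, herm_emb_cplx]
  · rw [hM]; exact toMatrix_eq_diagonal hB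

/-! ### Loxodromic elements -/

/-- If a basis consists of eigenvectors with distinct eigenvalues, every eigenvector is a multiple of
an element of the basis. -/
lemma exists_smul_of_eigenvector {B : Module.Basis (Fin 3) ℂ V} {g : SU21} {d : Fin 3 → ℂ}
    (h : ∀ i, g.1.1 *ᵥ B i = d i • B i) (hd : Function.Injective d) {v : V} (hv : v ≠ 0) {μ : ℂ}
    (hμ : g.1.1 *ᵥ v = μ • v) : ∃ i, ∃ x : ℂ, μ = d i ∧ x ≠ 0 ∧ v = x • B i := by
  have key (i) : (d i - μ) * B.repr v i = 0 := by
    have h1 : g.1.1 *ᵥ v = ∑ j, (B.repr v j * d j) • B j := by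
      conv_lhs => rw [← B.sum_repr v, mulVec_sum]
      refine Finset.sum_congr rfl fun j _ => ?_
      rw [mulVec_smul, h, smul_smul]
    have h2 := congrArg (fun w => B.repr w i) hμ
    simp only [h1, map_sum, map_smul, Finsupp.coe_finsetSum, Finset.sum_apply, Finsupp.smul_apply,
      Module.Basis.repr_self, smul_eq_mul, Finsupp.single_apply, mul_ite, mul_one, mul_zero,
      Finset.sum_ite_eq', Finset.mem_univ, if_true] at h2
    linear_combination h2
  obtain ⟨i, hi⟩ : ∃ i, B.repr v i ≠ 0 := by
    by_contra! h0
    exact hv (B.repr.map_eq_zero_iff.1 (Finsupp.ext h0))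
  have hμi : d i = μ := sub_eq_zero.1 ((mul_eq_zero.1 (key i)).resolve_right hi)
  refine ⟨i, B.repr v i, hμi.symm, hi, ?_⟩
  conv_lhs => rw [← B.sum_repr v]
  refine Finset.sum_eq_single i (fun j _ hj => ?_) (fun hj => absurd (Finset.mem_univ i) hj)
  have : d j - μ ≠ 0 := fun h0 => hj (hd (by rw [hμi, sub_eq_zero.1 h0]))
  rw [(mul_eq_zero.1 (key j)).resolve_left this, zero_smul]

/-- A fixed point of the projective action is an eigenline. -/
lemma exists_eigenvector {g : SU21} {x : ℙ ℂ V} (h : g • x = x) :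
    ∃ v, ∃ hv : v ≠ 0, x = Projectivization.mk ℂ v hv ∧ ∃ μ : ℂ, g.1.1 *ᵥ v = μ • v := by
  induction x using Projectivization.ind with
  | h v hv =>
    rw [smul_mk_eq g hv (mulVec_ne_zero g hv), Projectivization.mk_eq_mk_iff'] at h
    obtain ⟨μ, hμ⟩ := h
    exact ⟨v, hv, rfl, μ, hμ.symm⟩

lemma smul_mk_eq_self {g : SU21} {v : V} (hv : v ≠ 0) {μ : ℂ} (hμ : g.1.1 *ᵥ v = μ • v) :
    g • Projectivization.mk ℂ v hv = Projectivization.mk ℂ v hv := by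
  rw [smul_mk_eq g hv (mulVec_ne_zero g hv), Projectivization.mk_eq_mk_iff']
  exact ⟨μ, hμ.symm⟩

lemma mk_mem_H2C {v : V} (hv : v ≠ 0) : Projectivization.mk ℂ v hv ∈ H2C ↔ IsNegative v := by
  constructor
  · rintro ⟨w, hw, hn⟩
    rw [Projectivization.submodule_mk, Submodule.mem_span_singleton] at hw
    obtain ⟨a, rfl⟩ := hw
    rw [IsNegative, herm_smul_left, herm_smul_right, ← mul_assoc, mul_comm a,
      ← Complex.normSq_eq_conj_mul_self, Complex.re_ofReal_mul] at hn
    exact neg_of_mul_neg_right hn (Complex.normSq_nonneg a)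
  · intro h
    exact ⟨v, by rw [Projectivization.submodule_mk]; exact Submodule.mem_span_singleton_self v, h⟩

lemma mk_mem_boundaryH2C {v : V} (hv : v ≠ 0) :
    Projectivization.mk ℂ v hv ∈ boundaryH2C ↔ herm v v = 0 := by
  constructor
  · rintro ⟨w, hw, hw0, hn⟩
    rw [Projectivization.submodule_mk, Submodule.mem_span_singleton] at hw
    obtain ⟨a, rfl⟩ := hw
    have ha : a ≠ 0 := fun h => hw0 (by rw [h, zero_smul])
    rw [herm_smul_left, herm_smul_right] at hn
    simpa [ha] using hn
  · intro h
    exact ⟨v, by rw [Projectivization.submodule_mk]; exact Submodule.mem_span_singleton_self v, hv, h⟩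

lemma herm_e_e : herm e e = 1 := by simp [herm, e]

/-- With distinct eigenvalues `1`, `s⁻¹`, `s` the fixed points are the three eigenlines, of which the
first is positive and the other two are isotropic. -/
lemma isHyperbolic_lin {M : SL(2, ℝ)} {s : ℝ} {a b : Fin 2 → ℝ} (hs : 1 < s)
    (h : IsAxis M s 1 a b) : IsHyperbolic (lin M) := by
  obtain ⟨B, ⟨h0, h1, h2⟩, hB⟩ := h.exists_basis
  have hs' : s⁻¹ < 1 := inv_lt_one_of_one_lt₀ hs
  have hd : (![(1 : ℂ), (s : ℂ)⁻¹ * (1 : ℝ), s * (1 : ℝ)]) = fun i => ((![1, s⁻¹, s] i : ℝ) : ℂ) := by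
    ext i; fin_cases i <;> simp
  rw [hd] at hB
  have hinj : Function.Injective fun i => ((![1, s⁻¹, s] i : ℝ) : ℂ) := by
    intro i j hij
    have hij' : ![1, s⁻¹, s] i = ![1, s⁻¹, s] j := Complex.ofReal_injective hij
    fin_cases i <;> fin_cases j <;> simp at hij' ⊢ <;> linarith
  have hBi (i : Fin 3) (hi : i ≠ 0) : herm (B i) (B i) = 0 := by
    fin_cases i
    · exact absurd rfl hi
    · change herm (B 1) (B 1) = 0; rw [h1, herm_emb_cplx]
    · change herm (B 2) (B 2) = 0; rw [h2, herm_emb_cplx]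
  refine ⟨⟨fun x hx hfix => ?_, ?_⟩, 1, fun μ hμ => ?_⟩
  · obtain ⟨v, hv, rfl, μ, hμ⟩ := exists_eigenvector hfix
    obtain ⟨i, y, -, -, rfl⟩ := exists_smul_of_eigenvector hB hinj hv hμ
    rw [mk_mem_H2C, IsNegative, herm_smul_left, herm_smul_right, ← mul_assoc, mul_comm y,
      ← Complex.normSq_eq_conj_mul_self, Complex.re_ofReal_mul] at hx
    have hy := Complex.normSq_nonneg y
    by_cases hi : i = 0
    · rw [hi, h0, herm_e_e, Complex.one_re] at hx
      linarith
    · rw [hBi i hi, Complex.zero_re] at hx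
      linarith
  · have : {x ∈ boundaryH2C | lin M • x = x} =
        {Projectivization.mk ℂ (B 1) (B.ne_zero 1), Projectivization.mk ℂ (B 2) (B.ne_zero 2)} := by
      ext x
      simp only [Set.mem_ofPred_eq, Set.mem_insert_iff, Set.mem_singleton_iff]
      constructor
      · rintro ⟨hx, hfix⟩
        obtain ⟨v, hv, rfl, μ, hμ⟩ := exists_eigenvector hfix
        obtain ⟨i, y, -, hy, rfl⟩ := exists_smul_of_eigenvector hB hinj hv hμ
        have hmk : Projectivization.mk ℂ (y • B i) hv = Projectivization.mk ℂ (B i) (B.ne_zero i) :=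
          (Projectivization.mk_eq_mk_iff' _ _ _ _ _).2 ⟨y, rfl⟩
        rw [hmk] at hx ⊢
        rw [mk_mem_boundaryH2C] at hx
        fin_cases i
        · change herm (B 0) (B 0) = 0 at hx
          rw [h0, herm_e_e] at hx
          exact absurd hx one_ne_zero
        · exact Or.inl rfl
        · exact Or.inr rfl
      · rintro (rfl | rfl)
        · exact ⟨(mk_mem_boundaryH2C _).2 (hBi 1 (by decide)), smul_mk_eq_self _ (hB 1)⟩
        · exact ⟨(mk_mem_boundaryH2C _).2 (hBi 2 (by decide)), smul_mk_eq_self _ (hB 2)⟩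
    rw [this, Set.ncard_pair]
    intro heq
    obtain ⟨y, hy⟩ := (Projectivization.mk_eq_mk_iff' _ _ _ _ _).1 heq
    have := congrArg (fun w => B.repr w 1) hy
    simp at this
  · obtain ⟨v, hv⟩ := hμ.exists_hasEigenvector
    have hv1 : (lin M).1.1 *ᵥ v = μ • v := by simpa using hv.apply_eq_smul
    obtain ⟨i, y, hi, -, -⟩ := exists_smul_of_eigenvector hB hinj hv.2 hv1
    have := h.s_pos
    refine ⟨![1, s⁻¹, s] i, ?_, by rw [hi, one_mul]⟩
    fin_cases i <;> simp [this]

/-- The elements `lin M` and `lin (-M)` differ by the elliptic element `diag(1, -1, -1)`, the reflection in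
the complex geodesic up to sign. -/
lemma hasEllipticPartOfOrderTwo_lin {M : SL(2, ℝ)} (h : IsHyperbolic (lin (-M))) :
    HasEllipticPartOfOrderTwo (lin M) := by
  have hE4 : (-1 : ℂ) ^ 4 = 1 := by norm_num
  have hE (x : ℂ) (u : Fin 2 → ℂ) : (element (-1) hE4 1).1.1 *ᵥ emb x u = emb x (-u) := by
    rw [element_mulVec]; simp
  have hbase : IsNegative base := by rw [IsNegative, base, herm_emb]; simp
  have hbase0 : base ≠ 0 := fun h0 => by simp [IsNegative, h0, herm] at hbase
  have hc (a b : SU21) (ha : a = lin (-M)) (hb : b = element (-1) hE4 1) : a * b = b * a := by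
    rw [ha, hb, lin, element_mul, element_mul]
    exact element_congr (mul_comm _ _) (by simp)
  refine ⟨lin (-M), element (-1) hE4 1, h, ⟨_, (mk_mem_H2C hbase0).2 hbase,
    smul_mk_eq_self (μ := -1) hbase0 ?_⟩, hc _ _ rfl rfl, ?_, fun x _ => ?_,
    Projectivization.mk ℂ (emb 1 ![Complex.I, 1]) (fun h0 => one_ne_zero (congrFun h0 0)), ?_, ?_⟩
  · rw [base, hE, ← emb_smul]; simp
  · rw [lin, lin, element_mul, ← element_neg]
    exact element_congr (by simp) (by simp)
  · rw [← SemigroupAction.mul_smul, element_mul]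
    have : element (-1 * -1) (by norm_num) (1 * 1) = 1 := by
      rw [← element_one]; exact element_congr (by simp) (by simp)
    rw [this, one_smul]
  · rw [mk_mem_H2C, IsNegative, herm_emb]
    simp
    norm_num
  · intro hfix
    rw [smul_mk_eq _ _ (mulVec_ne_zero _ (fun h0 => one_ne_zero (congrFun h0 0))),
      Projectivization.mk_eq_mk_iff'] at hfix
    obtain ⟨y, hy⟩ := hfix
    rw [hE] at hy
    have h0 := congrFun hy 0
    have h1 := congrFun (congrArg crd hy) 1
    rw [← emb_smul, crd_emb, crd_emb] at h1
    simp at h0 h1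
    simp [h0] at h1
    norm_num at h1

lemma loxodromicCondition {K : Subgroup SU21} (hK : ∀ g ∈ K, ∃ h ∈ G 8, σ h = g) :
    LoxodromicCondition K := by
  intro g hg hlox
  obtain ⟨h, hh, rfl⟩ := hK g hg
  obtain ⟨M, hM, htr⟩ := exists_lin hh
  have h1 : h ≠ 1 := by
    rintro rfl
    have hbase : IsNegative base := by rw [IsNegative, base, herm_emb]; simp
    have hbase0 : base ≠ 0 := fun h0 => by simp [IsNegative, h0, herm] at hbase
    exact hlox.1 _ ((mk_mem_H2C hbase0).2 hbase) (by rw [map_one, one_smul])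
  obtain ⟨s, ε, a, b, hs, hax⟩ := exists_isAxis (htr h1)
  rw [hM]
  have hε : ε * ε = 1 := by rw [← pow_two, hax.ε_sq]
  rcases mul_self_eq_one_iff.1 hε with rfl | rfl
  · exact Or.inl (isHyperbolic_lin hs hax)
  · refine Or.inr (hasEllipticPartOfOrderTwo_lin (isHyperbolic_lin (s := s) (a := a) (b := b) hs ?_))
    have hneg (u : Fin 2 → ℝ) : (-M).1 *ᵥ u = -(M.1 *ᵥ u) := by
      rw [SpecialLinearGroup.coe_neg, neg_mulVec]
    exact ⟨hax.s_pos, by norm_num, by rw [hneg, hax.left]; simp, by rw [hneg, hax.right]; simp,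
      hax.indep⟩

end
end PentagonGroup

namespace PentagonGroup

open Matrix ComplexHyperbolic MatrixGroups Filter Topology
noncomputable section

/-! ### Two elements without common fixed points -/

lemma r_mul_r_mem (i j : Fin 8) : r i * r j ∈ G 8 := Subgroup.subset_closure ⟨(i, j), rfl⟩

lemma σ_r_mul_r {i j : Fin 8} (h : factor i * factor j = -1) :
    σ (r i * r j) = lin (-(halfTurn i * halfTurn j)) := by
  rw [map_mul, σ_r, σ_r, element_mul, lin, ← element_neg]
  exact element_congr (by rw [h, neg_neg]) rfl

/-- The product of the half-turns at `q 6` and `q 7`, the translation along the side of the pentagon with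
index `0`. -/
def M₁ : SL(2, ℝ) := -(halfTurn 5 * halfTurn 6)

/-- The product of the half-turns at `q 7` and `q 8`, the translation along the side of the pentagon with
index `1`. -/
def M₂ : SL(2, ℝ) := -(halfTurn 6 * halfTurn 7)

lemma coe_M₁ : M₁.1 = -(A 4 * A 1) := by
  have : M₁.1 = -(prodA [4, 0] * prodA [0, 1]) := rfl
  rw [this]
  simp [prodA, mul_assoc, A_cancel]

lemma coe_M₂ : M₂.1 = -(A 0 * A 2) := by
  have : M₂.1 = -(prodA [0, 1] * prodA [1, 2]) := rfl
  rw [this]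
  simp [prodA, mul_assoc, A_cancel]

lemma commute_M₁ : Commute (A 0) M₁.1 := by
  have h1 := A_anticomm (i := 0) (j := 4) (by decide)
  have h2 := A_anticomm (i := 0) (j := 1) (by decide)
  rw [coe_M₁, Commute, SemiconjBy, mul_neg, neg_mul, ← mul_assoc, h1, neg_mul, mul_assoc, h2, mul_neg,
    neg_neg, mul_assoc]

lemma commute_M₂ : Commute (A 1) M₂.1 := by
  have h1 := A_anticomm (i := 1) (j := 0) (by decide)
  have h2 := A_anticomm (i := 1) (j := 2) (by decide)
  rw [coe_M₂, Commute, SemiconjBy, mul_neg, neg_mul, ← mul_assoc, h1, neg_mul, mul_assoc, h2, mul_neg,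
    neg_neg, mul_assoc]

lemma coe_pow_eq (M : SL(2, ℝ)) (n : ℕ) : (M ^ n).1 = M.1 ^ n := Matrix.SpecialLinearGroup.coe_pow M n

lemma pow_mulVec_eq {M : SL(2, ℝ)} {y : Fin 2 → ℝ} {z : ℝ} (h : M.1 *ᵥ y = z • y) (n : ℕ) :
    (M ^ n).1 *ᵥ y = z ^ n • y := by
  rw [coe_pow_eq]
  induction n with
  | zero => simp
  | succ k ih => rw [pow_succ, ← mulVec_mulVec, h, mulVec_smul, ih, smul_smul, pow_succ']

lemma σ_r_five_mul_r_six : σ (r 5 * r 6) = lin M₁ := σ_r_mul_r (by simp [factor])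

lemma σ_r_six_mul_r_seven : σ (r 6 * r 7) = lin M₂ := σ_r_mul_r (by simp [factor])

lemma trace_A_mul (i j : Fin 5) : (A i * A j).trace = 2 * gram i j := by
  have h := congrArg Matrix.trace (A_mul_add i j)
  rw [trace_add, trace_mul_comm (A j), trace_smul, trace_one] at h
  simp at h
  linarith

lemma trace_M₁ : 2 < |M₁ 0 0 + M₁ 1 1| := by
  have h : M₁ 0 0 + M₁ 1 1 = M₁.1.trace := (trace_fin_two _).symm
  have hg : gram 4 1 = -2 * c := by rw [gram, if_neg (by decide), if_neg (by decide)]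
  rw [h, coe_M₁, trace_neg, trace_A_mul, hg, abs_of_pos] <;> linarith [c_gt]

lemma trace_M₂ : 2 < |M₂ 0 0 + M₂ 1 1| := by
  have h : M₂ 0 0 + M₂ 1 1 = M₂.1.trace := (trace_fin_two _).symm
  have hg : gram 0 2 = -2 * c := by rw [gram, if_neg (by decide), if_neg (by decide)]
  rw [h, coe_M₂, trace_neg, trace_A_mul, hg, abs_of_pos] <;> linarith [c_gt]

lemma eq_smul_of_det_eq_zero {u w : Fin 2 → ℂ} (hu : u ≠ 0) (h : u 0 * w 1 - u 1 * w 0 = 0) :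
    ∃ x : ℂ, w = x • u := by
  by_cases h0 : u 0 = 0
  · have h1 : u 1 ≠ 0 := fun h1 => hu (by ext i; fin_cases i; exacts [h0, h1])
    refine ⟨w 1 / u 1, ?_⟩
    ext i
    fin_cases i
    · have : w 0 = 0 := by simpa [h0, h1] using h
      simp [this, h0]
    · simp [h1]
  · refine ⟨w 0 / u 0, ?_⟩
    ext i
    fin_cases i
    · simp [h0]
    · simp
      field_simp
      linear_combination h

/-- The eigenspaces of a real matrix with `|tr| > 2` and determinant `1` have dimension one. -/
lemma eq_smul_of_eigenvector {M : SL(2, ℝ)} (hM : 2 < |M 0 0 + M 1 1|) {u w : Fin 2 → ℂ} {μ : ℂ}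
    (hu : u ≠ 0) (h : M.1.map Complex.ofRealHom *ᵥ u = μ • u)
    (h' : M.1.map Complex.ofRealHom *ᵥ w = μ • w) : ∃ x : ℂ, w = x • u := by
  refine eq_smul_of_det_eq_zero hu ?_
  by_contra hD
  have hu0 := congrFun h 0
  have hu1 := congrFun h 1
  have hw0 := congrFun h' 0
  have hw1 := congrFun h' 1
  simp [mulVec, dotProduct, Fin.sum_univ_two] at hu0 hu1 hw0 hw1
  have h01 : (M 0 1 : ℂ) = 0 := by
    refine (mul_eq_zero.1 (?_ : (u 0 * w 1 - u 1 * w 0) * _ = 0)).resolve_left hD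
    linear_combination -w 0 * hu0 + u 0 * hw0
  have h10 : (M 1 0 : ℂ) = 0 := by
    refine (mul_eq_zero.1 (?_ : (u 0 * w 1 - u 1 * w 0) * _ = 0)).resolve_left hD
    linear_combination w 1 * hu1 - u 1 * hw1
  have h0 : (M 0 0 : ℂ) - M 1 1 = 0 := by
    refine (mul_eq_zero.1 (?_ : (u 0 * w 1 - u 1 * w 0) * _ = 0)).resolve_left hD
    linear_combination w 1 * hu0 - u 1 * hw0 + w 0 * hu1 - u 0 * hw1
  have hdet := M.2
  rw [det_fin_two] at hdet
  change M 0 0 * M 1 1 - M 0 1 * M 1 0 = 1 at hdet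
  have e01 : M 0 1 = 0 := by exact_mod_cast h01
  have e00 : M 0 0 = M 1 1 := by exact_mod_cast sub_eq_zero.1 h0
  rw [e01, e00, zero_mul, sub_zero] at hdet
  rw [e00] at hM
  rcases mul_self_eq_one_iff.1 hdet with h1 | h1 <;> rw [h1] at hM <;> norm_num at hM

/-- Translations along two adjacent sides of the pentagon have no common fixed point at infinity: a
common eigenvector would be an eigenvector of the two reflections, whose matrices anticommute. -/
lemma no_common_eigenvector {m n : ℕ} (hm : 2 < |(M₁ ^ m) 0 0 + (M₁ ^ m) 1 1|)
    (hn : 2 < |(M₂ ^ n) 0 0 + (M₂ ^ n) 1 1|) {u : Fin 2 → ℂ} (hu : u ≠ 0) {μ ν : ℂ}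
    (h : (M₁ ^ m).1.map Complex.ofRealHom *ᵥ u = μ • u)
    (h' : (M₂ ^ n).1.map Complex.ofRealHom *ᵥ u = ν • u) : False := by
  have key {M : SL(2, ℝ)} {n : ℕ} {k : Fin 5} (hk : Commute (A k) M.1)
      (hn : 2 < |(M ^ n) 0 0 + (M ^ n) 1 1|) {μ : ℂ}
      (h : (M ^ n).1.map Complex.ofRealHom *ᵥ u = μ • u) :
      ∃ x : ℂ, x ≠ 0 ∧ (A k).map Complex.ofRealHom *ᵥ u = x • u := by
    obtain ⟨x, hx⟩ := eq_smul_of_eigenvector hn hu h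
      (w := (A k).map Complex.ofRealHom *ᵥ u) (by
        have hc : Commute (A k) (M ^ n).1 := by
          rw [coe_pow_eq]; exact hk.pow_right n
        rw [mulVec_mulVec, ← Matrix.map_mul, ← hc.eq, Matrix.map_mul, ← mulVec_mulVec, h, mulVec_smul])
    refine ⟨x, fun h0 => hu ?_, hx⟩
    rw [h0, zero_smul] at hx
    rw [← one_mulVec u, ← Matrix.map_one Complex.ofRealHom (map_zero _) (map_one _), ← A_mul_self k,
      Matrix.map_mul, ← mulVec_mulVec, hx, mulVec_zero]
  obtain ⟨x, hx, h1⟩ := key commute_M₁ hm h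
  obtain ⟨y, hy, h2⟩ := key commute_M₂ hn h'
  have h3 : (A 0 * A 1).map Complex.ofRealHom *ᵥ u = (x * y) • u := by
    rw [Matrix.map_mul, ← mulVec_mulVec, h2, mulVec_smul, h1, smul_smul, mul_comm]
  have h4 : (A 1 * A 0).map Complex.ofRealHom *ᵥ u = (x * y) • u := by
    rw [Matrix.map_mul, ← mulVec_mulVec, h1, mulVec_smul, h2, smul_smul]
  have h5 : (A 0 * A 1).map Complex.ofRealHom = -((A 1 * A 0).map Complex.ofRealHom) := by
    rw [A_anticomm (by decide : Adj 0 1)]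
    ext i j
    rw [Matrix.neg_apply, map_apply, map_apply, Matrix.neg_apply, map_neg]
  rw [h5, neg_mulVec, h4, ← neg_smul, ← sub_eq_zero, ← sub_smul, smul_eq_zero] at h3
  refine hu (h3.resolve_left fun h6 => mul_ne_zero hx hy ?_)
  linear_combination -h6 / 2

/-- The powers of an element with real eigenvalues of modulus other than one are nontrivial. -/
lemma two_lt_abs_trace_pow {M : SL(2, ℝ)} {g : H 8} (hg : g ∈ G 8) (hM : σ g = lin M)
    (htr : 2 < |M 0 0 + M 1 1|) {n : ℕ} (hn : n ≠ 0) : 2 < |(M ^ n) 0 0 + (M ^ n) 1 1| := by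
  obtain ⟨N, hN, hN'⟩ := exists_lin (pow_mem hg n)
  have : N = M ^ n := lin_injective (by rw [← hN, map_pow, hM, lin_pow])
  rw [← this]
  refine hN' fun h1 => ?_
  obtain ⟨s, ε, a, b, hs, hax⟩ := exists_isAxis htr
  have h2 : M ^ n = 1 := lin_injective (by rw [← lin_pow, ← hM, ← map_pow, h1, map_one, lin_one])
  have h3 : (1 : Matrix (Fin 2) (Fin 2) ℝ) *ᵥ b = _ := h2 ▸ pow_mulVec_eq hax.right n
  rw [one_mulVec] at h3
  have hb : b ≠ 0 := fun h0 => hax.indep (by simp [h0])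
  have h4 : (s * ε) ^ n = 1 := by
    have : ((s * ε) ^ n - 1) • b = 0 := by rw [sub_smul, ← h3, one_smul, sub_self]
    exact sub_eq_zero.1 ((smul_eq_zero.1 this).resolve_right hb)
  have hε : ε ^ 2 = 1 := hax.ε_sq
  have h5 : (s ^ 2) ^ n = 1 :=
    calc (s ^ 2) ^ n = ((s * ε) ^ 2) ^ n := by rw [mul_pow, hε, mul_one]
      _ = ((s * ε) ^ n) ^ 2 := pow_right_comm _ _ _
      _ = 1 := by rw [h4, one_pow]
  have h6 : 1 < (s ^ 2) ^ n := one_lt_pow₀ (by nlinarith) hn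
  linarith

lemma exists_pow_smul_eq {K : Subgroup SU21} {X : Set (ℙ ℂ V)} (hX : X.Finite)
    (hinv : LeavesInvariant K X) {g : SU21} (hg : g ∈ K) {x : ℙ ℂ V} (hx : x ∈ X) :
    ∃ n, n ≠ 0 ∧ g ^ n • x = x := by
  have hmem (n : ℕ) : g ^ n • x ∈ X := by
    rw [← hinv _ (pow_mem hg n)]; exact ⟨x, hx, rfl⟩
  have := hX.to_subtype
  obtain ⟨m, n, hmn, h⟩ := Finite.exists_ne_map_eq_of_infinite (fun n : ℕ => (⟨_, hmem n⟩ : X))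
  rw [Subtype.mk.injEq] at h
  wlog hlt : m < n generalizing m n
  · exact this n m hmn.symm h.symm (lt_of_le_of_ne (not_lt.1 hlt) hmn.symm)
  refine ⟨n - m, by lia, ?_⟩
  rw [← smul_left_cancel_iff (g ^ m), ← SemigroupAction.mul_smul, ← pow_add,
    Nat.add_sub_cancel' hlt.le, h]

/-- A power of each of two translations along adjacent sides would fix a point of a finite invariant
set. -/
lemma isNonElementary {K : Subgroup SU21} (hK : ∀ g ∈ G 8, σ g ∈ K) : IsNonElementary K := by
  intro X hX hfin ⟨x, hx⟩ hinv
  obtain ⟨m, hm, h1⟩ := exists_pow_smul_eq hfin hinv (hK _ (r_mul_r_mem 5 6)) hx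
  obtain ⟨n, hn, h2⟩ := exists_pow_smul_eq hfin hinv (hK _ (r_mul_r_mem 6 7)) hx
  have t1 := two_lt_abs_trace_pow (r_mul_r_mem 5 6) σ_r_five_mul_r_six trace_M₁ hm
  have t2 := two_lt_abs_trace_pow (r_mul_r_mem 6 7) σ_r_six_mul_r_seven trace_M₂ hn
  rw [σ_r_five_mul_r_six, lin_pow] at h1
  rw [σ_r_six_mul_r_seven, lin_pow] at h2
  obtain ⟨v, hv, rfl, μ, hμ⟩ := exists_eigenvector h1
  rw [smul_mk_eq _ hv (mulVec_ne_zero _ hv), Projectivization.mk_eq_mk_iff'] at h2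
  obtain ⟨ν, hν⟩ := h2
  obtain ⟨y, u, rfl⟩ := exists_emb v
  rw [lin_mulVec, ← emb_smul] at hμ hν
  have hμ' := congrArg crd hμ
  have hν' := congrArg crd hν
  rw [crd_emb, crd_emb] at hμ' hν'
  by_cases hu : u = 0
  · subst hu
    rcases hX hx with h | h
    · rw [mk_mem_H2C, IsNegative, herm_emb] at h
      simp at h
      nlinarith [mul_self_nonneg y.re, mul_self_nonneg y.im]
    · rw [mk_mem_boundaryH2C, herm_emb] at h
      simp at h
      exact hv (by rw [h]; ext i; fin_cases i <;> simp [emb])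
  · exact no_common_eigenvector t1 t2 hu hμ' hν'.symm

/-! ### The group is not `ℝ`-Fuchsian -/

/-- The product of three vectors whose argument is Cartan's angular invariant. -/
def triple (u v w : V) : ℂ := herm u v * herm v w * herm w u

lemma triple_smul (x y z : ℂ) (u v w : V) : triple (x • u) (y • v) (z • w) =
    ((Complex.normSq x * Complex.normSq y * Complex.normSq z : ℝ) : ℂ) * triple u v w := by
  simp only [triple, herm_smul_left, herm_smul_right, Complex.ofReal_mul,
    Complex.normSq_eq_conj_mul_self]
  ring

lemma continuous_herm : Continuous fun p : V × V => herm p.1 p.2 := by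
  unfold herm
  have := Complex.continuous_conj
  fun_prop

lemma herm_tendsto {f g : ℕ → V} {u v : V} (hf : Tendsto f atTop (𝓝 u))
    (hg : Tendsto g atTop (𝓝 v)) :
    Tendsto (fun n => herm (f n) (g n)) atTop (𝓝 (herm u v)) := by
  have h : Tendsto (fun n => (f n, g n)) atTop (𝓝 (u, v)) := hf.prodMk_nhds hg
  have h' := (continuous_herm.tendsto (u, v)).comp h
  exact h'

lemma triple_tendsto {f g h : ℕ → V} {u v w : V} (hf : Tendsto f atTop (𝓝 u))
    (hg : Tendsto g atTop (𝓝 v)) (hh : Tendsto h atTop (𝓝 w)) :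
    Tendsto (fun n => triple (f n) (g n) (h n)) atTop (𝓝 (triple u v w)) :=
  ((herm_tendsto hf hg).mul (herm_tendsto hg hh)).mul (herm_tendsto hh hf)

/-- The triple product of three isotropic vectors with real coordinates is purely imaginary. -/
lemma triple_cplx (a b d : Fin 2 → ℝ) :
    triple (emb 0 (cplx a)) (emb 0 (cplx b)) (emb 0 (cplx d)) =
      -8 * ((a 0 * b 1 - a 1 * b 0) * (b 0 * d 1 - b 1 * d 0) * (d 0 * a 1 - d 1 * a 0) : ℝ) *
        Complex.I := by
  have : Complex.I ^ 3 = -Complex.I := Complex.I_pow_three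
  simp only [triple, herm_emb, cplx, Complex.conj_ofReal]
  push_cast
  simp only [zero_mul, zero_add]
  linear_combination (8 * (a 0 * b 1 - a 1 * b 0) * (b 0 * d 1 - b 1 * d 0) *
    (d 0 * a 1 - d 1 * a 0)) * this

/-- The positive powers of a hyperbolic element, suitably rescaled, move a negative vector
towards the attracting fixed point. -/
lemma IsAxis.tendsto {M : SL(2, ℝ)} {s ε : ℝ} {a b : Fin 2 → ℝ} (h : IsAxis M s ε a b) (hs : 1 < s)
    {v : V} (hv : IsNegative v) : ∃ y : ℂ, y ≠ 0 ∧ Tendsto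
      (fun n : ℕ => (((s * ε)⁻¹ ^ n : ℝ) : ℂ) • ((lin M ^ n).1.1 *ᵥ v)) atTop
      (𝓝 (y • emb 0 (cplx b))) := by
  obtain ⟨x, u, rfl⟩ := exists_emb v
  have hi : (a 0 * b 1 - a 1 * b 0 : ℂ) ≠ 0 := by exact_mod_cast h.indep
  obtain ⟨p, q, rfl⟩ : ∃ p q : ℂ, u = p • cplx a + q • cplx b := by
    refine ⟨(u 0 * b 1 - u 1 * b 0) / (a 0 * b 1 - a 1 * b 0),
      (a 0 * u 1 - a 1 * u 0) / (a 0 * b 1 - a 1 * b 0), ?_⟩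
    ext i
    fin_cases i
    · change u 0 = _ / _ * (a 0 : ℂ) + _ / _ * (b 0 : ℂ)
      rw [div_mul_eq_mul_div, div_mul_eq_mul_div, ← add_div, eq_div_iff hi]; ring
    · change u 1 = _ / _ * (a 1 : ℂ) + _ / _ * (b 1 : ℂ)
      rw [div_mul_eq_mul_div, div_mul_eq_mul_div, ← add_div, eq_div_iff hi]; ring
  have hsε : s * ε ≠ 0 := mul_ne_zero h.s_pos.ne' fun h0 => by simpa [h0] using h.ε_sq
  have hpow (k : ℕ) (y : Fin 2 → ℝ) (z : ℝ) (hy : M.1 *ᵥ y = z • y) :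
      (M ^ k).1.map Complex.ofRealHom *ᵥ cplx y = ((z ^ k : ℝ) : ℂ) • cplx y := by
    rw [map_mulVec_cplx, pow_mulVec_eq hy]
    ext i; simp [cplx]
  have hs0 := h.s_pos
  have hε : |ε| = 1 := by
    rw [← sq_eq_sq₀ (abs_nonneg ε) zero_le_one, sq_abs, h.ε_sq, one_pow]
  refine ⟨q, fun hq => ?_, ?_⟩
  · subst hq
    have h1 : herm (emb x (p • cplx a + (0 : ℂ) • cplx b)) (emb x (p • cplx a + (0 : ℂ) • cplx b)) =
        x * conj x := by
      rw [herm_emb]; simp [cplx]; ring_nf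
    rw [IsNegative, h1, Complex.mul_conj, Complex.ofReal_re] at hv
    exact absurd hv (Complex.normSq_nonneg x).not_gt
  · have heq (n : ℕ) : (((s * ε)⁻¹ ^ n : ℝ) : ℂ) •
          ((lin M ^ n).1.1 *ᵥ emb x (p • cplx a + q • cplx b)) =
        (((s * ε)⁻¹ ^ n : ℝ) : ℂ) • emb x 0 + ((((s ^ 2)⁻¹) ^ n : ℝ) : ℂ) • emb 0 (p • cplx a) +
          q • emb 0 (cplx b) := by
      have h1 : (s * ε)⁻¹ ^ n * (s⁻¹ * ε) ^ n = ((s ^ 2)⁻¹) ^ n := by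
        rw [← mul_pow]
        congr 1
        have hε0 : ε ≠ 0 := right_ne_zero_of_mul hsε
        field_simp
      have h2 : (s * ε)⁻¹ ^ n * (s * ε) ^ n = 1 := by
        rw [← mul_pow, inv_mul_cancel₀ hsε, one_pow]
      have h3 (α β : ℂ) : emb x (p • α • cplx a + q • β • cplx b) =
          emb x 0 + α • emb 0 (p • cplx a) + β • q • emb 0 (cplx b) := by
        rw [smul_comm p, smul_comm q, ← emb_smul q, ← emb_smul β, ← emb_smul α, ← emb_add, ← emb_add]
        simp
      rw [lin_pow, lin_mulVec, mulVec_add, mulVec_smul, mulVec_smul, hpow n a _ h.left,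
        hpow n b _ h.right, h3, smul_add, smul_add, smul_smul, smul_smul _ _ (q • _),
        ← Complex.ofReal_mul, ← Complex.ofReal_mul, h1, h2, Complex.ofReal_one, one_smul]
    simp only [heq]
    have hlim {z : ℝ} (hz : |z| < 1) : Tendsto (fun n : ℕ => ((z ^ n : ℝ) : ℂ)) atTop (𝓝 0) := by
      have := (Complex.continuous_ofReal.tendsto 0).comp
        (tendsto_pow_atTop_nhds_zero_of_abs_lt_one hz)
      rwa [Complex.ofReal_zero] at this
    have l1 := (hlim (z := (s * ε)⁻¹) (by
      rw [abs_inv, abs_mul, hε, mul_one, abs_of_pos hs0]; exact inv_lt_one_of_one_lt₀ hs)).smul_const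
        (emb x 0)
    have l2 := (hlim (z := (s ^ 2)⁻¹) (by
      rw [abs_inv, abs_of_pos (by positivity)]
      exact inv_lt_one_of_one_lt₀ (by nlinarith))).smul_const (emb 0 (p • cplx a))
    have l3 := (l1.add l2).add (tendsto_const_nhds (x := q • emb 0 (cplx b)))
    rwa [zero_smul, zero_smul, add_zero, zero_add] at l3

/-- Three attracting fixed points are limits of an orbit in the invariant totally real plane, but their
triple product is imaginary and not zero. -/
lemma not_isRFuchsian {K : Subgroup SU21} (hK : ∀ g ∈ G 8, σ g ∈ K) : ¬ IsRFuchsian K := by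
  rintro ⟨U, -, hU, ⟨v, hvU, hv⟩, hinv⟩
  have hv0 : v ≠ 0 := fun h0 => by simp [IsNegative, h0, herm] at hv
  have horbit (g : SU21) (hg : g ∈ K) : ∃ x : ℂ, ∃ u ∈ U, g.1.1 *ᵥ v = x • u := by
    have hmem : Projectivization.mk ℂ v hv0 ∈ {x ∈ H2C | ∃ u ∈ U, u ≠ 0 ∧ u ∈ x.submodule} :=
      ⟨(mk_mem_H2C hv0).2 hv, v, hvU, hv0, by
        rw [Projectivization.submodule_mk]; exact Submodule.mem_span_singleton_self v⟩
    have hmem' : g • Projectivization.mk ℂ v hv0 ∈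
        {x ∈ H2C | ∃ u ∈ U, u ≠ 0 ∧ u ∈ x.submodule} := by
      rw [← hinv g hg]; exact ⟨_, hmem, rfl⟩
    obtain ⟨-, u, hu, hu0, hu'⟩ := hmem'
    rw [smul_mk_eq g hv0 (mulVec_ne_zero g hv0), Projectivization.submodule_mk,
      Submodule.mem_span_singleton] at hu'
    obtain ⟨y, rfl⟩ := hu'
    have hy : y ≠ 0 := fun h0 => hu0 (by rw [h0, zero_smul])
    exact ⟨y⁻¹, _, hu, by rw [smul_smul, inv_mul_cancel₀ hy, one_smul]⟩
  -- The triple products of the points of an orbit in the totally real plane are real.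
  have htriple (g₁ g₂ g₃ : SU21) (h₁ : g₁ ∈ K) (h₂ : g₂ ∈ K) (h₃ : g₃ ∈ K) (x y z : ℂ) :
      (triple (x • g₁.1.1 *ᵥ v) (y • g₂.1.1 *ᵥ v) (z • g₃.1.1 *ᵥ v)).im = 0 := by
    obtain ⟨x', u₁, hu₁, e₁⟩ := horbit g₁ h₁
    obtain ⟨y', u₂, hu₂, e₂⟩ := horbit g₂ h₂
    obtain ⟨z', u₃, hu₃, e₃⟩ := horbit g₃ h₃
    rw [e₁, e₂, e₃, smul_smul, smul_smul, smul_smul, triple_smul, Complex.im_ofReal_mul, triple]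
    simp [hU u₁ hu₁ u₂ hu₂, hU u₂ hu₂ u₃ hu₃, hU u₃ hu₃ u₁ hu₁]
  have hM₁ : lin M₁ ∈ K := σ_r_five_mul_r_six ▸ hK _ (r_mul_r_mem 5 6)
  have hM₂ : lin M₂ ∈ K := σ_r_six_mul_r_seven ▸ hK _ (r_mul_r_mem 6 7)
  have hM₁' : lin M₁⁻¹ ∈ K := by rw [← lin_inv]; exact inv_mem hM₁
  obtain ⟨s, ε, a, b, hs, hax⟩ := exists_isAxis trace_M₁
  obtain ⟨s', ε', a', b', hs', hax'⟩ := exists_isAxis trace_M₂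
  obtain ⟨x, hx, l₁⟩ := hax.tendsto hs hv
  obtain ⟨y, hy, l₂⟩ := hax.inv.tendsto hs hv
  obtain ⟨z, hz, l₃⟩ := hax'.tendsto hs' hv
  have hlim := (Complex.continuous_im.tendsto _).comp (triple_tendsto l₁ l₂ l₃)
  have h0 : (triple (x • emb 0 (cplx b)) (y • emb 0 (cplx a)) (z • emb 0 (cplx b'))).im = 0 := by
    refine tendsto_nhds_unique hlim ((tendsto_const_nhds (x := (0 : ℝ))).congr fun n => ?_)
    exact (htriple _ _ _ (pow_mem hM₁ n) (pow_mem hM₁' n) (pow_mem hM₂ n) _ _ _).symm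
  rw [triple_smul, triple_cplx, Complex.im_ofReal_mul] at h0
  have hx' := (Complex.normSq_pos.2 hx).ne'
  have hy' := (Complex.normSq_pos.2 hy).ne'
  have hz' := (Complex.normSq_pos.2 hz).ne'
  have h1 : (b 0 * a 1 - b 1 * a 0) * (a 0 * b' 1 - a 1 * b' 0) * (b' 0 * b 1 - b' 1 * b 0) = 0 := by
    have h2 := (mul_eq_zero.1 h0).resolve_left (mul_ne_zero (mul_ne_zero hx' hy') hz')
    rw [show (-8 : ℂ) = ((-8 : ℝ) : ℂ) by norm_num, ← Complex.ofReal_mul, Complex.im_ofReal_mul,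
      Complex.I_im, mul_one] at h2
    linarith
  -- The three attracting fixed points are distinct.
  have hcommon {u : Fin 2 → ℝ} {μ : ℝ} (hu : u ≠ 0) (hM : M₁.1 *ᵥ u = μ • u)
      (hD : u 0 * b' 1 - u 1 * b' 0 = 0) : False := by
    have hc {w : Fin 2 → ℝ} (hw : w ≠ 0) : cplx w ≠ 0 := fun h0 => hw (by
      ext i; simpa [cplx] using congrFun h0 i)
    have hb' : b' ≠ 0 := fun h0 => hax'.indep (by simp [h0])
    have hce {M : SL(2, ℝ)} {w : Fin 2 → ℝ} {μ : ℝ} (h : M.1 *ᵥ w = μ • w) :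
        (M ^ 1).1.map Complex.ofRealHom *ᵥ cplx w = (μ : ℂ) • cplx w := by
      rw [pow_one, map_mulVec_cplx, h]; ext i; simp [cplx]
    obtain ⟨y, hy⟩ := eq_smul_of_det_eq_zero (w := cplx b') (hc hu) (by
      simp only [cplx]; exact_mod_cast hD)
    refine no_common_eigenvector (m := 1) (n := 1) (by rw [pow_one]; exact trace_M₁)
      (by rw [pow_one]; exact trace_M₂) (hc hb') (μ := μ) ?_ (hce hax'.right)
    rw [hy, mulVec_smul, hce hM, smul_comm]
  rcases mul_eq_zero.1 h1 with h1 | h1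
  · rcases mul_eq_zero.1 h1 with h1 | h1
    · exact hax.indep (by linarith)
    · exact hcommon (fun h0 => hax.indep (by simp [h0])) hax.left h1
  · exact hcommon (u := b) (fun h0 => hax.indep (by simp [h0])) hax.right (by linarith)

end
end PentagonGroup
theorem mainTheorem2 :
    ∃ (T : ComplexHyperbolic.PentagonConfiguration)
      (σ : ComplexHyperbolic.H 8 →* ComplexHyperbolic.SU21)
      (X : Type) (_ : TopologicalSpace X) (x₀ : X)
      (φ : FundamentalGroup X x₀ ≃* ComplexHyperbolic.G 8)
      (ρ : FundamentalGroup X x₀ →* ComplexHyperbolic.SU21),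
      -- `X` is a closed surface of genus `3`, with fundamental group `G 8`
      ComplexHyperbolic.IsClosedSurfaceOfGenus 3 X ∧
      -- `σ` is given by the involutions `Q(q_i)`, and is `ℂ`-Fuchsian, faithful, and discrete
      (∀ (i : Fin 8) (v : ComplexHyperbolic.V),
        (σ (ComplexHyperbolic.r i)).1.1.mulVec v = ComplexHyperbolic.Q T.e (T.q (i + 1)) v) ∧
      Function.Injective σ ∧
      ComplexHyperbolic.IsDiscrete σ.range ∧
      ComplexHyperbolic.IsCFuchsian σ.range ∧
      -- `ρ` is the restriction of `σ`, and is `ℂ`-Fuchsian, faithful, and discrete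
      (∀ γ, ρ γ = σ (φ γ)) ∧
      Function.Injective ρ ∧
      ComplexHyperbolic.IsDiscrete ρ.range ∧
      ComplexHyperbolic.IsCFuchsian ρ.range ∧
      -- the form of the elements
      (∀ g ∈ ρ.range, ∃ (b : Module.Basis (Fin 3) ℂ ComplexHyperbolic.V) (s ε : ℝ),
        b 0 = T.e ∧
        ComplexHyperbolic.herm (b 1) T.e = 0 ∧ ComplexHyperbolic.herm (b 1) (b 1) = 0 ∧
        ComplexHyperbolic.herm (b 2) T.e = 0 ∧ ComplexHyperbolic.herm (b 2) (b 2) = 0 ∧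
        0 < s ∧ (ε = 1 ∨ ε = -1) ∧
        LinearMap.toMatrix b b (Matrix.toLin' g.1.1) =
          Matrix.diagonal ![(1 : ℂ), (s : ℂ)⁻¹ * ε, s * ε]) ∧
      ComplexHyperbolic.LoxodromicCondition ρ.range ∧
      -- the announced characterization fails for this group
      ComplexHyperbolic.IsNonElementary ρ.range ∧
      ¬ ComplexHyperbolic.IsRFuchsian ρ.range ∧
      ¬ ComplexHyperbolic.AnnouncedCharacterization := by
  have hx : Nonempty PentagonGroup.Surface := PentagonGroup.isClosedSurface.connected.toNonempty
  obtain ⟨x₀⟩ := hx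
  let φ := PentagonGroup.fundamentalGroupSurface x₀
  let ρ : FundamentalGroup PentagonGroup.Surface x₀ →* ComplexHyperbolic.SU21 :=
    (PentagonGroup.σ.comp (ComplexHyperbolic.G 8).subtype).comp φ.toMonoidHom
  have hρ (g : ComplexHyperbolic.SU21) :
      g ∈ ρ.range ↔ ∃ h ∈ ComplexHyperbolic.G 8, PentagonGroup.σ h = g := by
    constructor
    · rintro ⟨γ, rfl⟩
      exact ⟨φ γ, (φ γ).2, rfl⟩
    · rintro ⟨h, hh, rfl⟩
      exact ⟨φ.symm ⟨h, hh⟩, congrArg (fun h : ComplexHyperbolic.G 8 => PentagonGroup.σ h)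
        (φ.apply_symm_apply ⟨h, hh⟩)⟩
  have hle : ρ.range ≤ PentagonGroup.σ.range := fun g hg => by
    obtain ⟨h, -, rfl⟩ := (hρ g).1 hg
    exact ⟨h, rfl⟩
  have hmem (g) (hg : g ∈ ComplexHyperbolic.G 8) : PentagonGroup.σ g ∈ ρ.range :=
    (hρ _).2 ⟨g, hg, rfl⟩
  have hdisc := PentagonGroup.isDiscrete_mono hle PentagonGroup.isDiscrete_range
  have hlox := PentagonGroup.loxodromicCondition (K := ρ.range) fun g hg => (hρ g).1 hg
  have hne := PentagonGroup.isNonElementary hmem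
  have hR := PentagonGroup.not_isRFuchsian hmem
  exact ⟨PentagonGroup.configuration, PentagonGroup.σ, PentagonGroup.Surface, inferInstance, x₀, φ, ρ,
    PentagonGroup.isClosedSurface, PentagonGroup.σ_r_mulVec, PentagonGroup.σ_injective,
    PentagonGroup.isDiscrete_range, PentagonGroup.isCFuchsian_of_le le_rfl, fun _ => rfl,
    PentagonGroup.σ_injective.comp (Subtype.val_injective.comp φ.injective), hdisc,
    PentagonGroup.isCFuchsian_of_le hle, fun g hg => PentagonGroup.diagonal_form ((hρ g).1 hg), hlox,
    hne, hR, fun h => hR ((h _ hdisc hne).2 hlox)⟩
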